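/- Let $n\ge 3$, let $q_0,q_1>0$ with $q_0+q_1=1$ and $q_0\ge 2/\bigl(\binom{2n}{n}+2\bigr)$, and put $|\psi_t\rangle=\sqrt{q_0}\,|\mathrm{GHZ}_{2n}\rangle+\sqrt{q_1}\,|D_{2n}^n\rangle$ on $2n$ qubits, where $|\mathrm{GHZ}_{2n}\rangle=(|0^{2n}\rangle+|1^{2n}\rangle)/\sqrt2$ and $|D_{2n}^n\rangle=\binom{2n}{n}^{-1/2}\sum_{|z|=n}|z\rangle$ ($|z|$ is the Hamming weight). Let $$\lambda_0=\frac{\binom{2n}{n}q_0}{\binom{2n}{n}q_0+2q_1},\qquad \lambda_1=\frac{2q_1}{\binom{2n}{n}q_0+2q_1}.$$ One round of the verification protocol (with its free parameter $p$ set to $0$) acts on a $2n$-qubit state as follows. Choose a set $R$ of $n$ qubits uniformly at random, measure the qubits in $R$ in the Pauli-$Z$ basis, and let $l$ be the Hamming weight of the outcome string. * If $l=0$: choose uniformly at random a qubit $k\notin R$ and bits $r_i$ for the other qubits $i\notin R$; measure each such $i\ne k$ in the basis $\{S^{r_i}|+\rangle,S^{r_i}|-\rangle\}$, $S=\mathrm{diag}(1,\mathrm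 i)$, with outcome $o_i\in\{0,1\}$; let $r_k,o_k\in\{0,1\}$ make $\sum_{i\notin R}r_i$ and $\sum_{i\notin R}o_i$ even; accept iff qubit $k$ is found in the state $FS^{r_k}Z^{o_k+(\sum_{i\notin R} r_i)/2}|+\rangle$, where $F=\sqrt2\,\mathrm{diag}(\sqrt{\lambda_0},\sqrt{\lambda_1})$. * If $l=n$: do the same with $X$ additionally applied to all measurement bases. * If $1\le l\le n-1$: choose uniformly at random two qubits $k_1<k_2$ outside $R$, measure the other $n-2$ qubits outside $R$ in the $Z$ basis, and let $w$ be the weight of their outcomes. If $w\in\{n-l,n-l-2\}$, measure $k_1,k_2$ in the $Z$ basis and accept iff the total weight of the outcomes outside $R$ is $n-l$. If $w=n-l-1$, measure $k_1,k_2$ in the $X$ basis and accept iff the two outcomes agree. Otherwise reject. Let $\Omega$ be the operator such that a round accepts $\rho$ with probability $\mathrm{Tr}[\Omega\rho]$, and let $\nu(\Omega)$ be its spectral gap, the difference between its two largest eigenvalues (counted with multiplicity). With $M$ samples, round $j$ is run on the sample $\rho_j$, and the protocol accepts iff all rounds accept; so it accepts $\bigotimes_{j=1}^M\rho_j$ with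 probability $\prod_{j=1}^M\mathrm{Tr}[\Omega\rho_j]$. Then: 1. $\nu(\Omega)>0$. If $\lambda_0\bigl(1+2/\binom{2n}{n}\bigr)+\frac1{2n-1}<1$, then $\frac1{\nu(\Omega)}<2n-1$. If $\lambda_0\bigl(1+2/\binom{2n}{n}\bigr)+\frac1{2n-1}\ge1$, then $$\frac1{\nu(\Omega)}<\frac{\frac{4^n}{\sqrt{\pi n}}\,q_0+2q_1}{2q_1}.$$ 2. (Perfect completeness) If all samples are in the state $|\psi_t\rangle$, the protocol accepts with probability $1$, for every number of samples. 3. (Failure probability) Let $0<\epsilon\le1$, $0<\delta<1$ and $$M=\max\left\{\left\lceil\frac{(2n-1)\log\delta^{-1}}{\epsilon}\right\rceil,\ \left\lceil\left(\frac{q_0\,4^n}{2q_1\sqrt{\pi n}}+1\right)\frac{\log\delta^{-1}}{\epsilon}\right\rceil\right\}.$$ If $\rho_1,\dots,\rho_M$ are density operators on $2n$ qubits with $\langle\psi_t|\rho_j|\psi_t\rangle\le1-\epsilon$ for all $j$, the protocol accepts $\bigotimes_{j=1}^M\rho_j$ with probability at most $\delta$. 4. (Growth of $M$) For constant $q_0$,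 $M=O\!\left(\frac{4^n\log\delta^{-1}}{\sqrt n\,\epsilon}\right)$. Precisely: for fixed $q_0,q_1>0$ with $q_0+q_1=1$ there is a constant $C$ depending only on $q_0$ such that $M\le C\,\frac{4^n\log\delta^{-1}}{\sqrt n\,\epsilon}+1$ for all $n\ge3$, $0<\epsilon\le1$, $0<\delta<1$; and for every $\delta_0<1$ there is a constant $C'$ depending only on $q_0$ and $\delta_0$ such that $M\le C'\,\frac{4^n\log\delta^{-1}}{\sqrt n\,\epsilon}$ for all $n\ge3$, $0<\epsilon\le1$, $0<\delta\le\delta_0$. -/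

import Mathlib

open scoped BigOperators Matrix ComplexOrder

namespace QSV

noncomputable section

/-! ### Qubit registers

A register is a finite type `κ` of qubits, its computational basis consists of the bit strings
`κ → Bool` (`false` is `0`, `true` is `1`). -/

/-- Vectors of the state space of the register `κ`. -/
abbrev Ket (κ : Type*) := (κ → Bool) → ℂ

/-- Linear operators on the state space of the register `κ`. -/
abbrev Op (κ : Type*) := Matrix (κ → Bool) (κ → Bool) ℂ

/-- Hamming weight of a bit string. -/
def weight {κ : Type*} [Fintype κ] (x : κ → Bool) : ℕ :=
  (Finset.univ.filter fun i => x i = true).card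

/-- The computational basis vector `|x⟩`. -/
def ket {κ : Type*} [DecidableEq κ] [Fintype κ] (x : κ → Bool) : Ket κ := Pi.single x 1

/-- The rank-one operator `|v⟩⟨v|`. -/
def proj {β : Type*} (v : β → ℂ) : Matrix β β ℂ := Matrix.vecMulVec v (star v)

/-- Tensor product of single-qubit operators, one for each qubit of the register. -/
def tensor {κ : Type*} [Fintype κ] (A : κ → Matrix Bool Bool ℂ) : Op κ :=
  Matrix.of fun x y => ∏ i, A i (x i) (y i)

/-- `A ⊗ B` where `A` acts on the qubits in `R` and `B` on the qubits outside `R`. -/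
def tensorSplit {κ : Type*} (R : Finset κ) (A : Op {i // i ∈ R}) (B : Op {i // i ∉ R}) : Op κ :=
  Matrix.of fun x y =>
    A (fun i => x i.1) (fun i => y i.1) * B (fun i => x i.1) (fun i => y i.1)

/-- The GHZ state `(|0…0⟩ + |1…1⟩) / √2`. -/
def ghzState (κ : Type*) [DecidableEq κ] [Fintype κ] : Ket κ :=
  ((1 / Real.sqrt 2 : ℝ) : ℂ) • (ket (fun _ => false) + ket (fun _ => true))

/-- The Dicke state with `k` excitations. -/
def dickeState (κ : Type*) [DecidableEq κ] [Fintype κ] (k : ℕ) : Ket κ :=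
  ((1 / Real.sqrt ((Fintype.card κ).choose k) : ℝ) : ℂ) •
    ∑ x ∈ Finset.univ.filter (fun x : κ → Bool => weight x = k), ket x

/-- The `2n`-qubit target state `√q₀ |GHZ⟩ + √q₁ |D⟩`, with `n` excitations in `|D⟩`. -/
def targetState (n : ℕ) (q₀ q₁ : ℝ) : Ket (Fin (2 * n)) :=
  ((Real.sqrt q₀ : ℝ) : ℂ) • ghzState (Fin (2 * n)) +
    ((Real.sqrt q₁ : ℝ) : ℂ) • dickeState (Fin (2 * n)) n

/-! ### Single-qubit objects -/

/-- `|+⟩ = (|0⟩ + |1⟩) / √2`. -/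
def plus : Bool → ℂ := fun _ => ((1 / Real.sqrt 2 : ℝ) : ℂ)

/-- `Z = |0⟩⟨0| - |1⟩⟨1|`. -/
def pauliZ : Matrix Bool Bool ℂ := Matrix.diagonal fun b => if b then -1 else 1

/-- `X = |1⟩⟨0| + |0⟩⟨1|`. -/
def pauliX : Matrix Bool Bool ℂ := Matrix.of fun a b => if a = b then 0 else 1

/-- `S = |0⟩⟨0| + i |1⟩⟨1|`. -/
def phaseS : Matrix Bool Bool ℂ := Matrix.diagonal fun b => if b then Complex.I else 1

/-- `F = √2 (√μ₀ |0⟩⟨0| + √μ₁ |1⟩⟨1|)`. -/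
def filterF (μ₀ μ₁ : ℝ) : Matrix Bool Bool ℂ :=
  Matrix.diagonal fun b => ((Real.sqrt 2 * (if b then Real.sqrt μ₁ else Real.sqrt μ₀) : ℝ) : ℂ)

/-- Projector for the outcome `o` of the Pauli-`Z` measurement. -/
def zProj (o : Bool) : Matrix Bool Bool ℂ := proj (Pi.single o 1)

/-- Projector for the outcome `o` of the measurement in the basis `{S^r |+⟩, S^r |-⟩}`, where
`|-⟩ = Z |+⟩`. For `r = 0` this is the Pauli-`X` measurement. -/
def sProj (r o : Bool) : Matrix Bool Bool ℂ :=
  proj ((phaseS ^ r.toNat * pauliZ ^ o.toNat) *ᵥ plus)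

/-- Projector onto `F S^r Z^e |+⟩`. -/
def fProj (μ₀ μ₁ : ℝ) (r : Bool) (e : ℕ) : Matrix Bool Bool ℂ :=
  proj ((filterF μ₀ μ₁ * phaseS ^ r.toNat * pauliZ ^ e) *ᵥ plus)

/-! ### The two subroutines

A strategy is the sum, over the classical random choices and the accepting outcomes, of the
probability of the choices times the product of the local projectors of the outcomes. -/

/-- The strategy verifying the GHZ-like state `√μ₀ |0…0⟩ + √μ₁ |1…1⟩` on the register `κ`.
With probability `p` all qubits are measured in the `Z` basis, and equal outcomes are accepted.
With probability `1 - p` a uniformly random qubit `k` is chosen; every other qubit `i` is measured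
in the basis `S^{r i} |±⟩` for a uniformly random bit `r i`, with outcome `o i`; the bits `r k`
and `o k` are those that make the sum of all `r i`, and of all `o i`, even; finally qubit `k` is
projected onto `F S^{r k} Z^{o k + (∑ r i)/2} |+⟩`. -/
def ghzLikeStrategy (κ : Type*) [DecidableEq κ] [Fintype κ] (p μ₀ μ₁ : ℝ) : Op κ :=
  (p : ℂ) • (∑ b : Bool, tensor fun _ : κ => zProj b) +
    ((1 - p : ℝ) : ℂ) • ((1 / (Fintype.card κ : ℝ) : ℝ) : ℂ) • ∑ k : κ,
      ((1 / 2 ^ (Fintype.card κ - 1) : ℝ) : ℂ) •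
        ∑ r ∈ Finset.univ.filter (fun r : κ → Bool => Even (weight r)),
          ∑ o ∈ Finset.univ.filter (fun o : κ → Bool => Even (weight o)),
            tensor fun i =>
              if i = k then fProj μ₀ μ₁ (r k) ((o k).toNat + weight r / 2)
              else sProj (r i) (o i)

/-- Hamming weight of the string `o` outside of the positions `k₁`, `k₂`. -/
def weightOff {κ : Type*} [DecidableEq κ] [Fintype κ] (k₁ k₂ : κ) (o : κ → Bool) : ℕ :=
  (Finset.univ.filter fun i => i ≠ k₁ ∧ i ≠ k₂ ∧ o i = true).card

/-- The acceptance rule of the Dicke-state verification with `k` excitations: `w` is the weight of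
the outcomes off `{k₁, k₂}`. If `w ∈ {k, k - 2}` the total weight has to be `k`, if `w = k - 1` the
outcomes at `k₁` and `k₂` have to agree, and otherwise one rejects. -/
def dickeAccepts {κ : Type*} [DecidableEq κ] [Fintype κ] (k : ℕ) (k₁ k₂ : κ) (o : κ → Bool) :
    Prop :=
  ((weightOff k₁ k₂ o = k ∨ weightOff k₁ k₂ o + 2 = k) ∧ weight o = k) ∨
    (weightOff k₁ k₂ o + 1 = k ∧ o k₁ = o k₂)

open Classical in
/-- The strategy verifying the Dicke state with `k` excitations on the register `κ`: a uniformly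
random pair `k₁ < k₂` is chosen, all other qubits are measured in the `Z` basis, and `k₁`, `k₂` are
measured in the `X` basis if the weight of these outcomes is `k - 1`, and in the `Z` basis
otherwise. -/
def dickeStrategy (κ : Type*) [LinearOrder κ] [Fintype κ] (k : ℕ) : Op κ :=
  ((1 / ((Fintype.card κ).choose 2 : ℝ) : ℝ) : ℂ) •
    ∑ e ∈ Finset.univ.filter (fun e : κ × κ => e.1 < e.2),
      ∑ o ∈ Finset.univ.filter (fun o : κ → Bool => dickeAccepts k e.1 e.2 o),
        tensor fun i =>
          if (i = e.1 ∨ i = e.2) ∧ weightOff e.1 e.2 o + 1 = k then sProj false (o i)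
          else zProj (o i)

/-! ### The protocol for the superposition of GHZ and Dicke states -/

/-- `λ₀ = C(2n,n) q₀ / (C(2n,n) q₀ + 2 q₁)`. -/
def lam₀ (n : ℕ) (q₀ q₁ : ℝ) : ℝ :=
  ((2 * n).choose n : ℝ) * q₀ / (((2 * n).choose n : ℝ) * q₀ + 2 * q₁)

/-- `λ₁ = 2 q₁ / (C(2n,n) q₀ + 2 q₁)`. -/
def lam₁ (n : ℕ) (q₀ q₁ : ℝ) : ℝ :=
  2 * q₁ / (((2 * n).choose n : ℝ) * q₀ + 2 * q₁)

/-- What is done with the `n` unmeasured qubits when the `Z` measurement of the other `n` qubits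
gave a string of weight `l`: GHZ-like verification if `l = 0`, GHZ-like verification with `X` added
to all measurement bases if `l = n`, and Dicke-state verification with `n - l` excitations
otherwise. -/
def subStrategy (κ : Type*) [LinearOrder κ] [Fintype κ] (n : ℕ) (p μ₀ μ₁ : ℝ) (l : ℕ) : Op κ :=
  if l = 0 then ghzLikeStrategy κ p μ₀ μ₁
  else if l = n then
    (tensor fun _ : κ => pauliX) * ghzLikeStrategy κ p μ₀ μ₁ * (tensor fun _ : κ => pauliX)
  else dickeStrategy κ (n - l)

/-- The strategy `Ω` of one round of the protocol: a uniformly random set `R` of `n` of the `2n`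
qubits is measured in the `Z` basis, with outcomes `o`, and the remaining qubits are verified by
`subStrategy` according to the weight of `o`. -/
def strategy (n : ℕ) (p q₀ q₁ : ℝ) : Op (Fin (2 * n)) :=
  ((1 / ((2 * n).choose n : ℝ) : ℝ) : ℂ) •
    ∑ R ∈ Finset.powersetCard n (Finset.univ : Finset (Fin (2 * n))),
      ∑ o : {i // i ∈ R} → Bool,
        tensorSplit R (tensor fun i => zProj (o i))
          (subStrategy {i // i ∉ R} n p (lam₀ n q₀ q₁) (lam₁ n q₀ q₁) (weight o))

/-! ### Verification framework -/

/-- Density operators. -/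
def IsDensity {β : Type*} [Fintype β] (ρ : Matrix β β ℂ) : Prop :=
  ρ.PosSemidef ∧ ρ.trace = 1

/-- The fidelity `⟨ψ|ρ|ψ⟩`. -/
def fidelity {β : Type*} [Fintype β] (ψ : β → ℂ) (ρ : Matrix β β ℂ) : ℝ :=
  (star ψ ⬝ᵥ (ρ *ᵥ ψ)).re

/-- Probability that all `M` rounds with the strategy `Ω` accept, when round `j` is run on its own
copy `ρ j`: a round accepts with probability `Tr[Ω ρ j]`. -/
def acceptProb {β : Type*} [Fintype β] {M : ℕ} (Ω : Matrix β β ℂ) (ρ : Fin M → Matrix β β ℂ) : ℝ :=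
  ∏ j, (Ω * ρ j).trace.re

open Classical in
/-- Spectral gap of a Hermitian matrix of size at least two: the difference between its two largest
eigenvalues, counted with multiplicity (`eigenvalues₀` lists them in decreasing order). -/
def spectralGap {β : Type*} [Fintype β] (A : Matrix β β ℂ) : ℝ :=
  if h : A.IsHermitian ∧ 2 ≤ Fintype.card β then
    h.1.eigenvalues₀ ⟨0, by omega⟩ - h.1.eigenvalues₀ ⟨1, by omega⟩
  else 0

/-- The number of samples used by the protocol. -/
def sampleCount (n : ℕ) (q₀ q₁ ε δ : ℝ) : ℕ :=
  max ⌈(2 * (n : ℝ) - 1) * Real.log δ⁻¹ / ε⌉₊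
    ⌈(q₀ * 4 ^ n / (2 * q₁ * Real.sqrt (Real.pi * n)) + 1) * (Real.log δ⁻¹ / ε)⌉₊

end

end QSV

/-!
The strategy `Ω` has real entries, so it is governed by its quadratic form on real vectors
`a : (Fin (2n) → Bool) → ℝ`. Summing over measurement settings, outcomes and sets `R` makes this
form explicit (`strategy_apply`, `realStrategy_form`). Let `B = C(2n, n)`, let `λ₀`, `λ₁` be the
parameters of the filter, and let `S` be the sum of `a` over the slice of weight `n`.

* The GHZ-like tests are diagonal, up to a coupling of `0…0` and `1…1` to the slice of weight `n`.
  That coupling sees the slice only through `S`.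
* The Dicke tests act on the slice as the adjacency operator of the Johnson graph, whose spectral
  gap is obtained here from the commutation relation of the ladder operators (`sum_exchange_le`).
  They also couple the weights `n - 1` and `n + 1`, which is absorbed into the diagonal by the
  inequality of arithmetic and geometric means (`crossForm_le`).

Thus `Ω` is at most `λ₀` on the antisymmetric combination of `0…0` and `1…1`, at most
`1 - 1/(2n-1) - 2λ₀/B` on the part of the slice orthogonal to the Dicke state, and at most
`1/2 ≤ λ₀` on all strings of other weights (`realStrategy_form_le`); `1/2 ≤ λ₀` is what the
hypothesis on `q₀` says. On the span of the GHZ and the Dicke state, `Ω` has the target state `ψ` as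
an eigenvector of eigenvalue `1`, and its other eigenvalue is `λ₀ (1 - 2/B)` (`two_dim_block`). With
`β = max(λ₀, 1 - 1/(2n-1) - 2λ₀/B)` this gives
`Ω ≤ β + (1 - β) |ψ⟩⟨ψ|` and `⟨ψ|Ω|ψ⟩ = 1` (`posSemidef_secondBound`, `target_form`).

All claims about the protocol follow from these two facts. Completeness is the second one. The gap
of `Ω` is at least `1 - β = min(λ₁, 1/(2n-1) + 2λ₀/B)` (`le_spectralGap`), and the case distinction
in the theorem is the one that decides which term is the minimum; `B < 4 ^ n / √(π n)` is a bound
on Wallis products. A round accepts a state of infidelity at least `ε` with probability at most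
`1 - (1 - β) ε`, so `M` rounds accept with probability at most `exp (-(1 - β) ε M)`, and
`M ≥ log δ⁻¹ / ((1 - β) ε)` for the stated number of samples (`acceptProb_le`).
-/

namespace QSV

/-! ### The size of the central binomial coefficient and of the number of samples -/

/-- A consequence of the lower estimate of the partial Wallis products. -/
theorem choose_lt_four_pow_div_sqrt (n : ℕ) (hn : 0 < n) :
    ((2 * n).choose n : ℝ) < 4 ^ n / Real.sqrt (Real.pi * n) := by
  have hn' : (0 : ℝ) < n := by exact_mod_cast hn
  have hB : (0 : ℝ) < ((2 * n).choose n : ℝ) := by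
    exact_mod_cast Nat.choose_pos (by omega)
  have hW := Real.Wallis.le_W n
  rw [Real.Wallis.W_eq_factorial_ratio] at hW
  have hfac : (((2 * n).factorial : ℕ) : ℝ) = ((2 * n).choose n : ℝ) * (n.factorial : ℝ) ^ 2 := by
    have h := Nat.choose_mul_factorial_mul_factorial (show n ≤ 2 * n by omega)
    rw [show 2 * n - n = n by omega] at h
    rw [← h]; push_cast; ring
  have hf : (0 : ℝ) < (n.factorial : ℝ) := by exact_mod_cast n.factorial_pos
  rw [hfac] at hW
  have hpi := Real.pi_pos
  have e : (2 : ℝ) ^ (4 * n) * (n.factorial : ℝ) ^ 4 /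
      ((((2 * n).choose n : ℝ) * (n.factorial : ℝ) ^ 2) ^ 2 * (2 * (n : ℝ) + 1)) =
      (4 ^ n) ^ 2 / (((2 * n).choose n : ℝ) ^ 2 * (2 * n + 1)) := by
    have : (2 : ℝ) ^ (4 * n) = (4 ^ n) ^ 2 := by
      rw [← pow_mul, show (4 : ℝ) = 2 ^ 2 by norm_num, ← pow_mul]; congr 1; ring
    rw [this]; field_simp
  rw [e, le_div_iff₀ (by positivity)] at hW
  rw [lt_div_iff₀ (by positivity)]
  apply lt_of_pow_lt_pow_left₀ 2 (by positivity)
  rw [mul_pow, Real.sq_sqrt (by positivity)]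
  refine lt_of_lt_of_le ?_ hW
  have h2 : (n : ℝ) < (2 * n + 1) / (2 * n + 2) / 2 * (2 * n + 1) := by
    rw [div_div, div_mul_eq_mul_div, lt_div_iff₀ (by positivity)]; nlinarith
  have h3 : 0 < ((2 * n).choose n : ℝ) ^ 2 * Real.pi := by positivity
  calc _ = ((2 * n).choose n : ℝ) ^ 2 * Real.pi * n := by ring
    _ < ((2 * n).choose n : ℝ) ^ 2 * Real.pi * ((2 * n + 1) / (2 * n + 2) / 2 * (2 * n + 1)) :=
        mul_lt_mul_of_pos_left h2 h3
    _ = _ := by ring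

theorem sq_le_four_pow (n : ℕ) : n ^ 2 ≤ 4 ^ n := by
  calc n ^ 2 ≤ (2 ^ n) ^ 2 := Nat.pow_le_pow_left Nat.lt_two_pow_self.le 2
    _ = 4 ^ n := by rw [← pow_mul, mul_comm, pow_mul]; norm_num

theorem self_le_four_pow_div_sqrt (n : ℕ) (hn : 0 < n) : (n : ℝ) ≤ 4 ^ n / Real.sqrt n := by
  have hn' : (1 : ℝ) ≤ n := by exact_mod_cast hn
  rw [le_div_iff₀ (by positivity)]
  have h : Real.sqrt n ≤ n := Real.sqrt_le_iff.2 ⟨by positivity, by nlinarith⟩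
  have h2 : (n : ℝ) ^ 2 ≤ 4 ^ n := by exact_mod_cast sq_le_four_pow n
  nlinarith

/-- Both ceilings in the sample count are of numbers of order `4 ^ n log δ⁻¹ / (√n ε)`. -/
theorem sampleCount_le (q₀ q₁ : ℝ) (h₀ : 0 < q₀) (h₁ : 0 < q₁) (n : ℕ) (ε δ : ℝ) (hn : 0 < n)
    (hε : 0 < ε) (hδ : 0 < δ) (hδ1 : δ < 1) :
    (sampleCount n q₀ q₁ ε δ : ℝ) ≤
      (q₀ / q₁ + 2) * (4 ^ n * Real.log δ⁻¹ / (Real.sqrt n * ε)) + 1 := by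
  have hn' : (1 : ℝ) ≤ n := by exact_mod_cast hn
  have hL : 0 < Real.log δ⁻¹ := Real.log_pos ((one_lt_inv₀ hδ).2 hδ1)
  have hK : 0 < Real.log δ⁻¹ / ε := by positivity
  have hs := self_le_four_pow_div_sqrt n hn
  have hsp : 0 < Real.sqrt n := by positivity
  have hpi : 1 ≤ Real.sqrt Real.pi := Real.one_le_sqrt.2 (by linarith [Real.pi_gt_three])
  set K := Real.log δ⁻¹ / ε with hKdef
  set t : ℝ := 4 ^ n / Real.sqrt n with ht
  have ht0 : 0 < t := by positivity
  have hr : 0 < q₀ / q₁ := by positivity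
  have eT : 4 ^ n * Real.log δ⁻¹ / (Real.sqrt n * ε) = t * K := by
    rw [ht, hKdef]; field_simp
  have b1 : (2 * (n : ℝ) - 1) * Real.log δ⁻¹ / ε ≤ (q₀ / q₁ + 2) * (t * K) := by
    rw [mul_div_assoc, ← hKdef, ← mul_assoc]
    apply mul_le_mul_of_nonneg_right _ hK.le
    nlinarith
  have b2 : (q₀ * 4 ^ n / (2 * q₁ * Real.sqrt (Real.pi * n)) + 1) * K ≤
      (q₀ / q₁ + 2) * (t * K) := by
    rw [← mul_assoc]
    apply mul_le_mul_of_nonneg_right _ hK.le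
    have e : q₀ * 4 ^ n / (2 * q₁ * Real.sqrt (Real.pi * n)) =
        (q₀ / q₁) * t / (2 * Real.sqrt Real.pi) := by
      rw [Real.sqrt_mul Real.pi_pos.le, ht]; field_simp
    have : (q₀ / q₁) * t / (2 * Real.sqrt Real.pi) ≤ (q₀ / q₁) * t :=
      div_le_self (by positivity) (by linarith)
    rw [e]; nlinarith
  have c1 := Nat.ceil_lt_add_one (show 0 ≤ (2 * (n : ℝ) - 1) * Real.log δ⁻¹ / ε by
    apply div_nonneg (mul_nonneg (by linarith) hL.le) hε.le)
  have c2 := Nat.ceil_lt_add_one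
    (show 0 ≤ (q₀ * 4 ^ n / (2 * q₁ * Real.sqrt (Real.pi * n)) + 1) * K by positivity)
  rw [eT, sampleCount, Nat.cast_max, max_le_iff]
  constructor <;> linarith

theorem sampleCount_growth (q₀ q₁ : ℝ) (h₀ : 0 < q₀) (h₁ : 0 < q₁) :
    (∃ C : ℝ, 0 < C ∧ ∀ (n : ℕ) (ε δ : ℝ), 3 ≤ n → 0 < ε → ε ≤ 1 → 0 < δ → δ < 1 →
        (sampleCount n q₀ q₁ ε δ : ℝ) ≤
          C * (4 ^ n * Real.log δ⁻¹ / (Real.sqrt n * ε)) + 1) ∧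
      (∀ δ₀ : ℝ, δ₀ < 1 →
        ∃ C : ℝ, 0 < C ∧ ∀ (n : ℕ) (ε δ : ℝ), 3 ≤ n → 0 < ε → ε ≤ 1 → 0 < δ → δ ≤ δ₀ →
          (sampleCount n q₀ q₁ ε δ : ℝ) ≤
            C * (4 ^ n * Real.log δ⁻¹ / (Real.sqrt n * ε))) := by
  refine ⟨⟨q₀ / q₁ + 2, by positivity, fun n ε δ hn hε _ hδ hδ1 =>
    sampleCount_le q₀ q₁ h₀ h₁ n ε δ (by omega) hε hδ hδ1⟩, fun δ₀ hδ₀ => ?_⟩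
  rcases le_or_gt δ₀ 0 with hneg | hpos
  · exact ⟨1, one_pos, fun n ε δ _ _ _ hδ hδ' => absurd hδ' (by linarith)⟩
  have hL₀ : 0 < Real.log δ₀⁻¹ := Real.log_pos ((one_lt_inv₀ hpos).2 hδ₀)
  -- the additive `1` is at most `(log δ₀⁻¹)⁻¹` times the main term
  refine ⟨q₀ / q₁ + 2 + (Real.log δ₀⁻¹)⁻¹, by positivity, fun n ε δ hn hε hε1 hδ hδ' => ?_⟩
  refine (sampleCount_le q₀ q₁ h₀ h₁ n ε δ (by omega) hε hδ (by linarith)).trans ?_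
  rw [add_mul _ (Real.log δ₀⁻¹)⁻¹]
  have hlog : Real.log δ₀⁻¹ ≤ Real.log δ⁻¹ :=
    Real.log_le_log (by positivity) (inv_anti₀ hδ hδ')
  have hs := self_le_four_pow_div_sqrt n (by omega)
  have hn' : (3 : ℝ) ≤ n := by exact_mod_cast hn
  have hsp : 0 < Real.sqrt n := by positivity
  have e : 4 ^ n * Real.log δ⁻¹ / (Real.sqrt n * ε) =
      4 ^ n / Real.sqrt n * (Real.log δ⁻¹ / ε) := by field_simp
  have h1 : Real.log δ₀⁻¹ ≤ Real.log δ⁻¹ / ε :=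
    hlog.trans (le_div_self (by linarith) hε hε1)
  have h2 : Real.log δ₀⁻¹ ≤ 4 ^ n * Real.log δ⁻¹ / (Real.sqrt n * ε) := by
    rw [e]; nlinarith
  have h3 : 1 ≤ (Real.log δ₀⁻¹)⁻¹ * (4 ^ n * Real.log δ⁻¹ / (Real.sqrt n * ε)) := by
    rw [inv_mul_eq_div, le_div_iff₀ hL₀]; linarith
  linarith

/-! ### The exchange form on a slice of the cube -/

section Slice

variable {κ : Type*} [DecidableEq κ]

/-- The bit string `x` with the bit at `i` inverted. -/
def flipAt (i : κ) (x : κ → Bool) : κ → Bool := Function.update x i (!x i)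

theorem flipAt_same (i : κ) (x : κ → Bool) : flipAt i x i = !x i := by simp [flipAt]

theorem flipAt_of_ne {i j : κ} (h : j ≠ i) (x : κ → Bool) : flipAt i x j = x j := by
  simp [flipAt, h]

theorem flipAt_flipAt (i : κ) (x : κ → Bool) : flipAt i (flipAt i x) = x := by
  funext j
  by_cases h : j = i
  · subst h; simp [flipAt_same]
  · simp [flipAt_of_ne h]

theorem flipAt_comm (i j : κ) (x : κ → Bool) : flipAt i (flipAt j x) = flipAt j (flipAt i x) := by
  by_cases h : i = j
  · rw [h]
  funext m
  by_cases h1 : m = i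
  · subst h1; rw [flipAt_same, flipAt_of_ne h, flipAt_of_ne h, flipAt_same]
  · by_cases h2 : m = j
    · subst h2; rw [flipAt_of_ne h1, flipAt_same, flipAt_same, flipAt_of_ne h1]
    · simp [flipAt_of_ne h1, flipAt_of_ne h2]

variable [Fintype κ]

theorem sum_flipAt (i : κ) (h : (κ → Bool) → ℝ) : ∑ x, h (flipAt i x) = ∑ x, h x :=
  Equiv.sum_comp (Function.Involutive.toPerm (flipAt i) (flipAt_flipAt i)) h

theorem cast_weight {κ : Type*} [Fintype κ] (x : κ → Bool) :
    (weight x : ℝ) = ∑ i, if x i = true then 1 else 0 := by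
  simp [weight]

theorem cast_card_sub_weight {κ : Type*} [Fintype κ] (x : κ → Bool) :
    (Fintype.card κ : ℝ) - weight x = ∑ i, if x i = true then 0 else 1 := by
  rw [cast_weight, ← Finset.card_univ, Finset.cast_card, ← Finset.sum_sub_distrib]
  exact Finset.sum_congr rfl fun i _ => by split_ifs <;> simp

theorem weight_flipAt_of_false {i : κ} {x : κ → Bool} (h : x i = false) :
    weight (flipAt i x) = weight x + 1 := by
  unfold weight
  have : (Finset.univ.filter fun j => flipAt i x j = true) =
      insert i (Finset.univ.filter fun j => x j = true) := by
    ext j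
    by_cases hj : j = i
    · subst hj; simp [flipAt_same, h]
    · simp [flipAt_of_ne hj, hj]
  rw [this, Finset.card_insert_of_notMem (by simp [h])]

theorem weight_le_card {κ : Type*} [Fintype κ] (x : κ → Bool) : weight x ≤ Fintype.card κ :=
  Finset.card_le_univ _

theorem weight_eq_zero_iff {κ : Type*} [Fintype κ] (x : κ → Bool) :
    weight x = 0 ↔ x = fun _ => false := by
  simp [weight, Finset.filter_eq_empty_iff, funext_iff]

theorem weight_eq_card_iff {κ : Type*} [Fintype κ] (x : κ → Bool) :
    weight x = Fintype.card κ ↔ x = fun _ => true := by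
  simp [weight, Finset.card_eq_iff_eq_univ, Finset.eq_univ_iff_forall, funext_iff]

/-- Strings of weight `k` correspond to subsets of size `k`. -/
theorem card_filter_weight (κ : Type*) [DecidableEq κ] [Fintype κ] (k : ℕ) :
    (Finset.univ.filter fun x : κ → Bool => weight x = k).card = (Fintype.card κ).choose k := by
  rw [← Finset.card_univ, ← Finset.card_powersetCard]
  refine Finset.card_bij' (fun x _ => Finset.univ.filter fun i => x i = true)
    (fun s _ i => decide (i ∈ s)) ?_ ?_ ?_ ?_
  · intro x hx
    exact Finset.mem_powersetCard.2 ⟨Finset.subset_univ _, (Finset.mem_filter.1 hx).2⟩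
  · intro s hs
    refine Finset.mem_filter.2 ⟨Finset.mem_univ _, ?_⟩
    simpa [weight] using (Finset.mem_powersetCard.1 hs).2
  · intro x _; funext i; simp
  · intro s _; ext i; simp

/-- The ladder operator that raises the weight of the support by one. -/
def raise (f : (κ → Bool) → ℝ) (x : κ → Bool) : ℝ :=
  ∑ i, if x i = true then f (flipAt i x) else 0

/-- The ladder operator that lowers the weight of the support by one. -/
def lower (f : (κ → Bool) → ℝ) (x : κ → Bool) : ℝ :=
  ∑ i, if x i = true then 0 else f (flipAt i x)

theorem sum_mul_raise (f g : (κ → Bool) → ℝ) :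
    ∑ x, f x * raise g x = ∑ x, lower f x * g x := by
  simp only [raise, lower, Finset.mul_sum, Finset.sum_mul]
  rw [Finset.sum_comm, Finset.sum_comm (γ := κ → Bool)]
  refine Finset.sum_congr rfl fun i _ => ?_
  rw [← sum_flipAt i]
  refine Finset.sum_congr rfl fun x _ => ?_
  rw [flipAt_same, flipAt_flipAt]
  cases x i <;> simp

theorem sum_lower (f : (κ → Bool) → ℝ) : ∑ x, lower f x = ∑ x, (weight x : ℝ) * f x := by
  have h := sum_mul_raise f (fun _ => 1)
  simp only [mul_one] at h
  rw [← h]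
  refine Finset.sum_congr rfl fun x _ => ?_
  rw [cast_weight, mul_comm, raise]

/-- For `i ≠ j` the products of the `i`-th and the `j`-th term have the same sum for `raise` and for
`lower`, so that only diagonal terms enter the commutation relation. -/
theorem sum_raise_pair {i j : κ} (hij : i ≠ j) (f : (κ → Bool) → ℝ) :
    ∑ x, (if x i = true then f (flipAt i x) else 0) * (if x j = true then f (flipAt j x) else 0) =
      ∑ x, (if x i = true then 0 else f (flipAt i x)) *
        (if x j = true then 0 else f (flipAt j x)) := by
  rw [← sum_flipAt i, ← sum_flipAt j]
  refine Finset.sum_congr rfl fun x _ => ?_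
  rw [flipAt_same, flipAt_flipAt, flipAt_of_ne hij, flipAt_of_ne hij.symm, flipAt_same,
    flipAt_comm i j, flipAt_flipAt]
  cases x i <;> cases x j <;> simp [mul_comm]

/-- The commutation relation of the ladder operators. -/
theorem sum_raise_sq (f : (κ → Bool) → ℝ) :
    ∑ x, raise f x ^ 2 =
      ∑ x, lower f x ^ 2 + ∑ x, ((Fintype.card κ : ℝ) - 2 * weight x) * f x ^ 2 := by
  have h1 : ∀ x, raise f x ^ 2 = ∑ i, ∑ j, (if x i = true then f (flipAt i x) else 0) *
      (if x j = true then f (flipAt j x) else 0) := fun x => by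
    rw [raise, sq, Finset.sum_mul_sum]
  have h2 : ∀ x, lower f x ^ 2 = ∑ i, ∑ j, (if x i = true then 0 else f (flipAt i x)) *
      (if x j = true then 0 else f (flipAt j x)) := fun x => by
    rw [lower, sq, Finset.sum_mul_sum]
  have h3 : ∀ x, ((Fintype.card κ : ℝ) - 2 * weight x) * f x ^ 2 =
      ∑ i, ∑ j, if i = j then (if x i = true then -f x ^ 2 else f x ^ 2) else 0 := fun x => by
    rw [show (Fintype.card κ : ℝ) - 2 * weight x = (Fintype.card κ - weight x) - weight x by ring,
      cast_card_sub_weight, cast_weight, ← Finset.sum_sub_distrib, Finset.sum_mul]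
    refine Finset.sum_congr rfl fun i _ => ?_
    rw [Finset.sum_ite_eq, if_pos (Finset.mem_univ i)]
    split_ifs <;> ring
  have swap : ∀ F : (κ → Bool) → κ → κ → ℝ,
      ∑ x, ∑ i, ∑ j, F x i j = ∑ i, ∑ j, ∑ x, F x i j := fun F => by
    rw [Finset.sum_comm]
    exact Finset.sum_congr rfl fun i _ => Finset.sum_comm
  simp only [h1, h2, h3]
  rw [swap, swap, swap, ← Finset.sum_add_distrib]
  refine Finset.sum_congr rfl fun i _ => ?_
  rw [← Finset.sum_add_distrib]
  refine Finset.sum_congr rfl fun j _ => ?_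
  by_cases hij : i = j
  · subst hij
    have e : ∑ x, (if x i = true then f (flipAt i x) else 0) *
        (if x i = true then f (flipAt i x) else 0) =
        ∑ x : κ → Bool, if x i = true then 0 else f x * f x := by
      rw [← sum_flipAt i]
      refine Finset.sum_congr rfl fun x _ => ?_
      rw [flipAt_same, flipAt_flipAt]
      cases x i <;> simp
    have e' : ∑ x, (if x i = true then 0 else f (flipAt i x)) *
        (if x i = true then 0 else f (flipAt i x)) =
        ∑ x : κ → Bool, if x i = true then f x * f x else 0 := by
      rw [← sum_flipAt i]
      refine Finset.sum_congr rfl fun x _ => ?_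
      rw [flipAt_same, flipAt_flipAt]
      cases x i <;> simp
    rw [e, e', ← Finset.sum_add_distrib]
    refine Finset.sum_congr rfl fun x _ => ?_
    cases x i <;> simp [sq]
  · simp only [if_neg hij, Finset.sum_const_zero, add_zero]
    exact sum_raise_pair hij f

theorem lower_eq_zero {f : (κ → Bool) → ℝ} {k : ℕ} (hf : ∀ x, weight x ≠ k + 1 → f x = 0)
    (x : κ → Bool) (hx : weight x ≠ k) : lower f x = 0 := by
  refine Finset.sum_eq_zero fun i _ => ?_
  cases h : x i
  · rw [if_neg (by simp)]
    exact hf _ (by rw [weight_flipAt_of_false h]; omega)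
  · simp

theorem sum_lower_of_support {f : (κ → Bool) → ℝ} {k : ℕ} (hf : ∀ x, weight x ≠ k → f x = 0) :
    ∑ x, lower f x = k * ∑ x, f x := by
  rw [sum_lower, Finset.mul_sum]
  refine Finset.sum_congr rfl fun x _ => ?_
  by_cases h : weight x = k
  · rw [h]
  · rw [hf x h]; simp

/-- Norm bound for `lower` on the functions of mean zero on a slice. By Cauchy–Schwarz
`‖lower f‖⁴ ≤ ‖f‖² ‖raise (lower f)‖²`, and the commutation relation reduces the last factor to
`lower` on the slice below. -/
theorem sum_lower_sq_le_of_sum_eq_zero (k : ℕ) (hk : k + 1 ≤ Fintype.card κ)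
    (f : (κ → Bool) → ℝ) (hf : ∀ x, weight x ≠ k + 1 → f x = 0) (h0 : ∑ x, f x = 0) :
    ∑ x, lower f x ^ 2 ≤ k * ((Fintype.card κ : ℝ) - k - 1) * ∑ x, f x ^ 2 := by
  induction k generalizing f with
  | zero =>
    have hs : ∑ x, lower f x = 0 := by rw [sum_lower_of_support hf, h0, mul_zero]
    have hl : ∀ x, lower f x = 0 := by
      intro x
      by_cases hx : weight x = 0
      · rw [weight_eq_zero_iff] at hx
        rw [Finset.sum_eq_single x] at hs
        · exact hs
        · intro y _ hy
          refine lower_eq_zero hf y fun h => hy ?_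
          rw [weight_eq_zero_iff] at h
          rw [h, hx]
        · simp
      · exact lower_eq_zero hf x hx
    simp [hl]
  | succ k ih =>
    have hg : ∀ x, weight x ≠ k + 1 → lower f x = 0 := lower_eq_zero hf
    have hg0 : ∑ x, lower f x = 0 := by rw [sum_lower_of_support hf, h0, mul_zero]
    have hi := ih (by omega) (lower f) hg hg0
    have hc := sum_raise_sq (lower f)
    have hw : ∑ x, ((Fintype.card κ : ℝ) - 2 * weight x) * lower f x ^ 2 =
        ((Fintype.card κ : ℝ) - 2 * (k + 1)) * ∑ x, lower f x ^ 2 := by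
      rw [Finset.mul_sum]
      refine Finset.sum_congr rfl fun x _ => ?_
      by_cases h : weight x = k + 1
      · rw [h]; push_cast; ring
      · rw [hg x h]; ring
    have hcs := Finset.sum_mul_sq_le_sq_mul_sq Finset.univ f (raise (lower f))
    rw [sum_mul_raise] at hcs
    simp only [← sq] at hcs
    set A := ∑ x, lower f x ^ 2
    set D := ∑ x, f x ^ 2
    have hA : 0 ≤ A := Finset.sum_nonneg fun x _ => sq_nonneg _
    have hD : 0 ≤ D := Finset.sum_nonneg fun x _ => sq_nonneg _
    have hN : (k : ℝ) + 1 + 1 ≤ Fintype.card κ := by exact_mod_cast hk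
    have hr : ∑ x, raise (lower f) x ^ 2 ≤ (k + 1) * ((Fintype.card κ : ℝ) - (k + 1) - 1) * A := by
      rw [hc, hw]; nlinarith
    have h2 : A ^ 2 ≤ D * ((k + 1) * ((Fintype.card κ : ℝ) - (k + 1) - 1) * A) :=
      hcs.trans (mul_le_mul_of_nonneg_left hr hD)
    have hnn : 0 ≤ ((k : ℝ) + 1) * ((Fintype.card κ : ℝ) - (k + 1) - 1) * D :=
      mul_nonneg (mul_nonneg (by positivity) (by linarith)) hD
    push_cast
    rcases hA.eq_or_lt with hz | hp
    · rw [← hz]; exact hnn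
    · refine le_of_mul_le_mul_right ?_ hp
      nlinarith

theorem lower_add_const_mul (f g : (κ → Bool) → ℝ) (c : ℝ) (x : κ → Bool) :
    lower (fun y => f y + c * g y) x = lower f x + c * lower g x := by
  simp only [lower, Finset.mul_sum, ← Finset.sum_add_distrib]
  refine Finset.sum_congr rfl fun i _ => ?_
  split_ifs <;> ring

theorem lower_indicator (k : ℕ) (x : κ → Bool) :
    lower (fun y => if weight y = k + 1 then 1 else 0) x =
      if weight x = k then (Fintype.card κ : ℝ) - k else 0 := by
  split_ifs with h
  · rw [← h, cast_card_sub_weight, lower]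
    refine Finset.sum_congr rfl fun i _ => ?_
    cases hi : x i
    · simp [weight_flipAt_of_false hi]
    · simp
  · exact lower_eq_zero (fun y hy => if_neg hy) x h

/-- Without the condition on the mean, the constant functions on the slice contribute the
eigenvalue that `lower` has on them. -/
theorem sum_lower_sq_le (k : ℕ) (hk : k + 1 ≤ Fintype.card κ)
    (f : (κ → Bool) → ℝ) (hf : ∀ x, weight x ≠ k + 1 → f x = 0) :
    ∑ x, lower f x ^ 2 ≤ k * ((Fintype.card κ : ℝ) - k - 1) * ∑ x, f x ^ 2 +
      Fintype.card κ * (∑ x, f x) ^ 2 / (Fintype.card κ).choose (k + 1) := by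
  set N := Fintype.card κ with hNdef
  have hB : (0 : ℝ) < (N.choose (k + 1) : ℝ) := by exact_mod_cast Nat.choose_pos hk
  set e : (κ → Bool) → ℝ := fun y => if weight y = k + 1 then 1 else 0 with he
  set c : ℝ := (∑ x, f x) / N.choose (k + 1) with hc
  set g : (κ → Bool) → ℝ := fun y => f y + (-c) * e y with hgdef
  have hfg : f = fun y => g y + c * e y := by funext y; simp [hgdef]
  have hesum : ∑ x, e x = N.choose (k + 1) := by
    rw [he, ← card_filter_weight κ (k + 1)]; simp
  have hg : ∀ x, weight x ≠ k + 1 → g x = 0 := fun x hx => by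
    simp [hgdef, he, hf x hx, hx]
  have hg0 : ∑ x, g x = 0 := by
    simp only [hgdef, Finset.sum_add_distrib, ← Finset.mul_sum, hesum, hc]
    field_simp; ring
  have hge : ∑ x, g x * e x = 0 := by
    rw [← hg0]
    refine Finset.sum_congr rfl fun x _ => ?_
    by_cases h : weight x = k + 1
    · simp [he, h]
    · simp [hg x h]
  have hee : ∑ x, e x ^ 2 = N.choose (k + 1) := by
    rw [← hesum]
    refine Finset.sum_congr rfl fun x _ => ?_
    simp only [he]; split_ifs <;> simp
  have hff : ∑ x, f x ^ 2 = ∑ x, g x ^ 2 + c ^ 2 * N.choose (k + 1) := by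
    have : ∀ x, f x ^ 2 = g x ^ 2 + 2 * c * (g x * e x) + c ^ 2 * e x ^ 2 := fun x => by
      rw [congrFun hfg x]; ring
    simp only [this, Finset.sum_add_distrib, ← Finset.mul_sum, hge, hee]; ring
  have hlg : ∑ x, lower g x * lower e x = 0 := by
    have hlg0 : ∑ x, lower g x = 0 := by rw [sum_lower_of_support hg, hg0, mul_zero]
    have : ∀ x, lower g x * lower e x = lower g x * ((N : ℝ) - k) := fun x => by
      rw [he, lower_indicator]
      split_ifs with h
      · rfl
      · rw [lower_eq_zero hg x h]; simp
    simp only [this, ← Finset.sum_mul, hlg0, zero_mul]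
  have hch : ((N.choose (k + 1) : ℕ) : ℝ) * (k + 1) = N.choose k * ((N : ℝ) - k) := by
    have := Nat.choose_succ_right_eq N k
    rw [← Nat.cast_sub (by omega)]
    exact_mod_cast this
  have hle : ∑ x, lower e x ^ 2 = N.choose (k + 1) * (k + 1) * ((N : ℝ) - k) := by
    rw [hch]
    have : ∀ x, lower e x ^ 2 = if weight x = k then ((N : ℝ) - k) ^ 2 else 0 := fun x => by
      rw [he, lower_indicator]; split_ifs <;> simp [hNdef]
    simp only [this]
    rw [← Finset.sum_filter, Finset.sum_const, card_filter_weight, nsmul_eq_mul]; ring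
  have hlf : ∑ x, lower f x ^ 2 = ∑ x, lower g x ^ 2 + c ^ 2 * ∑ x, lower e x ^ 2 := by
    have : ∀ x, lower f x ^ 2 =
        lower g x ^ 2 + 2 * c * (lower g x * lower e x) + c ^ 2 * lower e x ^ 2 := fun x => by
      rw [hfg, lower_add_const_mul]; ring
    simp only [this, Finset.sum_add_distrib, ← Finset.mul_sum, hlg]; ring
  have hmain := sum_lower_sq_le_of_sum_eq_zero k hk g hg hg0
  have hs : (∑ x, f x) = c * N.choose (k + 1) := by rw [hc]; field_simp
  rw [hlf, hle, hff, hs]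
  have e1 : (N : ℝ) * (c * N.choose (k + 1)) ^ 2 / N.choose (k + 1) =
      N * c ^ 2 * N.choose (k + 1) := by field_simp
  rw [e1]
  nlinarith

/-- The exchange form in terms of `lower`. -/
theorem sum_exchange_eq (f : (κ → Bool) → ℝ) :
    ∑ i, ∑ j, ∑ x : κ → Bool, (if x i ≠ x j then f x * f (flipAt i (flipAt j x)) else 0) =
      2 * (∑ x, lower f x ^ 2 - ∑ x, (weight x : ℝ) * f x ^ 2) := by
  have key : ∀ i j : κ, ∑ x, (if x i = true then 0 else f (flipAt i x)) *
      (if x j = true then 0 else f (flipAt j x)) =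
      ∑ x, (if x i = true ∧ x j = false then f x * f (flipAt i (flipAt j x)) else 0) +
      if i = j then ∑ x, (if x i = true then 1 else 0) * f x ^ 2 else 0 := by
    intro i j
    rw [← sum_flipAt i]
    by_cases hij : i = j
    · subst hij
      rw [if_pos rfl, ← Finset.sum_add_distrib]
      refine Finset.sum_congr rfl fun x _ => ?_
      rw [flipAt_same, flipAt_flipAt]
      cases x i <;> simp [sq]
    · rw [if_neg hij, add_zero]
      refine Finset.sum_congr rfl fun x _ => ?_
      rw [flipAt_same, flipAt_flipAt, flipAt_of_ne (Ne.symm hij), flipAt_comm j i]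
      cases x i <;> cases x j <;> simp
  have h2 : ∑ x, lower f x ^ 2 = ∑ i, ∑ j, ∑ x, (if x i = true then 0 else f (flipAt i x)) *
      (if x j = true then 0 else f (flipAt j x)) := by
    rw [Finset.sum_congr rfl fun i _ => Finset.sum_comm, Finset.sum_comm]
    exact Finset.sum_congr rfl fun x _ => by rw [lower, sq, Finset.sum_mul_sum]
  have h3 : ∑ x, (weight x : ℝ) * f x ^ 2 =
      ∑ i, ∑ j, if i = j then ∑ x, (if x i = true then 1 else 0) * f x ^ 2 else 0 := by
    simp only [Finset.sum_ite_eq, Finset.mem_univ, if_true]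
    rw [Finset.sum_comm]
    exact Finset.sum_congr rfl fun x _ => by rw [cast_weight, Finset.sum_mul]
  have h4 : ∑ x, lower f x ^ 2 - ∑ x, (weight x : ℝ) * f x ^ 2 = ∑ i, ∑ j,
      ∑ x, (if x i = true ∧ x j = false then f x * f (flipAt i (flipAt j x)) else 0) := by
    rw [h2, h3, ← Finset.sum_sub_distrib]
    refine Finset.sum_congr rfl fun i _ => ?_
    rw [← Finset.sum_sub_distrib]
    refine Finset.sum_congr rfl fun j _ => ?_
    rw [key]; ring
  have h5 : ∑ i, ∑ j, ∑ x, (if x j = true ∧ x i = false then f x * f (flipAt i (flipAt j x)) else 0)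
      = ∑ i, ∑ j,
      ∑ x, (if x i = true ∧ x j = false then f x * f (flipAt i (flipAt j x)) else 0) := by
    rw [Finset.sum_comm]
    refine Finset.sum_congr rfl fun i _ => Finset.sum_congr rfl fun j _ =>
      Finset.sum_congr rfl fun x _ => ?_
    rw [flipAt_comm]
  rw [h4, two_mul]
  nth_rewrite 2 [← h5]
  rw [← Finset.sum_add_distrib]
  refine Finset.sum_congr rfl fun i _ => ?_
  rw [← Finset.sum_add_distrib]
  refine Finset.sum_congr rfl fun j _ => ?_
  rw [← Finset.sum_add_distrib]
  refine Finset.sum_congr rfl fun x _ => ?_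
  cases x i <;> cases x j <;> simp

/-- The spectral gap of the Johnson graph, as a bound for the exchange form on the slice of
weight `k + 1`. -/
theorem sum_exchange_le (k : ℕ) (hk : k + 1 ≤ Fintype.card κ)
    (f : (κ → Bool) → ℝ) (hf : ∀ x, weight x ≠ k + 1 → f x = 0) :
    ∑ i, ∑ j, ∑ x : κ → Bool, (if x i ≠ x j then f x * f (flipAt i (flipAt j x)) else 0) ≤
      2 * ((k * ((Fintype.card κ : ℝ) - k - 1) - (k + 1)) * ∑ x, f x ^ 2 +
        Fintype.card κ * (∑ x, f x) ^ 2 / (Fintype.card κ).choose (k + 1)) := by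
  have hw : ∑ x, (weight x : ℝ) * f x ^ 2 = (k + 1) * ∑ x, f x ^ 2 := by
    rw [Finset.mul_sum]
    refine Finset.sum_congr rfl fun x _ => ?_
    by_cases h : weight x = k + 1
    · rw [h]; push_cast; ring
    · rw [hf x h]; ring
  rw [sum_exchange_eq, hw]
  have := sum_lower_sq_le k hk f hf
  linarith

end Slice

/-! ### Matrix elements of the two subroutines -/

theorem zProj_apply (o a b : Bool) : zProj o a b = if a = o ∧ b = o then 1 else 0 := by
  cases o <;> cases a <;> cases b <;> simp [zProj, proj, Matrix.vecMulVec_apply]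

theorem plus_sq : ((1 / Real.sqrt 2 : ℝ) : ℂ) * ((1 / Real.sqrt 2 : ℝ) : ℂ) = 1 / 2 := by
  rw [← Complex.ofReal_mul, div_mul_div_comm, Real.mul_self_sqrt (by norm_num)]
  norm_num

theorem phase_mulVec_plus (r : Bool) (e : ℕ) (a : Bool) :
    ((phaseS ^ r.toNat * pauliZ ^ e) *ᵥ plus) a =
      (if a then Complex.I ^ r.toNat * (-1) ^ e else 1) * ((1 / Real.sqrt 2 : ℝ) : ℂ) := by
  rw [phaseS, pauliZ, Matrix.diagonal_pow, Matrix.diagonal_pow, Matrix.diagonal_mul_diagonal,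
    Matrix.mulVec_diagonal, plus]
  cases a <;> simp

theorem sProj_apply (r o a b : Bool) : sProj r o a b =
    1 / 2 * ((if a then Complex.I ^ r.toNat * (-1) ^ o.toNat else 1) *
      star (if b then Complex.I ^ r.toNat * (-1) ^ o.toNat else 1)) := by
  rw [sProj, proj, Matrix.vecMulVec_apply, Pi.star_apply, phase_mulVec_plus, phase_mulVec_plus,
    ← plus_sq, star_mul', Complex.star_def, Complex.conj_ofReal]
  ring

theorem fProj_apply (μ₀ μ₁ : ℝ) (r : Bool) (e : ℕ) (a b : Bool) : fProj μ₀ μ₁ r e a b =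
    ((if a then Real.sqrt μ₁ else Real.sqrt μ₀ : ℝ) : ℂ) *
      ((if b then Real.sqrt μ₁ else Real.sqrt μ₀ : ℝ) : ℂ) *
      ((if a then Complex.I ^ r.toNat * (-1) ^ e else 1) *
      star (if b then Complex.I ^ r.toNat * (-1) ^ e else 1)) := by
  have h2 : ((Real.sqrt 2 : ℝ) : ℂ) * ((1 / Real.sqrt 2 : ℝ) : ℂ) = 1 := by
    rw [← Complex.ofReal_mul, mul_one_div_cancel (by positivity), Complex.ofReal_one]
  rw [fProj, proj, mul_assoc, ← Matrix.mulVec_mulVec, Matrix.vecMulVec_apply, Pi.star_apply,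
    filterF, Matrix.mulVec_diagonal, Matrix.mulVec_diagonal, phase_mulVec_plus, phase_mulVec_plus]
  simp only [star_mul', Complex.star_def, Complex.conj_ofReal, Complex.ofReal_mul]
  linear_combination (((if a then Real.sqrt μ₁ else Real.sqrt μ₀ : ℝ) : ℂ) *
      ((if b then Real.sqrt μ₁ else Real.sqrt μ₀ : ℝ) : ℂ) *
      ((if a then Complex.I ^ r.toNat * (-1) ^ e else 1) *
      (starRingEnd ℂ) (if b then Complex.I ^ r.toNat * (-1) ^ e else 1))) *
      (((Real.sqrt 2 : ℝ) : ℂ) * ((1 / Real.sqrt 2 : ℝ) : ℂ) + 1) * h2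

/-- Phase of the off-diagonal elements `⟨a|·|!a⟩` of the measurement with setting `r`. -/
def offPhase (r a : Bool) : ℂ := if a then Complex.I ^ r.toNat else (-Complex.I) ^ r.toNat

theorem sProj_add (r a b : Bool) :
    sProj r false a b + sProj r true a b = if a = b then 1 else 0 := by
  cases r <;> cases a <;> cases b <;> norm_num [sProj_apply]

theorem sProj_sub (r a b : Bool) :
    sProj r false a b - sProj r true a b = if a ≠ b then offPhase r a else 0 := by
  cases r <;> cases a <;> cases b <;> norm_num [sProj_apply, offPhase] <;> ring

theorem fProj_add {μ₀ μ₁ : ℝ} (h₀ : 0 ≤ μ₀) (h₁ : 0 ≤ μ₁) (r : Bool) (m : ℕ) (a b : Bool) :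
    fProj μ₀ μ₁ r (false.toNat + m) a b + fProj μ₀ μ₁ r (true.toNat + m) a b =
      2 * ((if a then μ₁ else μ₀ : ℝ) : ℂ) * if a = b then 1 else 0 := by
  have e₀ : ((Real.sqrt μ₀ : ℝ) : ℂ) * ((Real.sqrt μ₀ : ℝ) : ℂ) = μ₀ := by
    rw [← Complex.ofReal_mul, Real.mul_self_sqrt h₀]
  have e₁ : ((Real.sqrt μ₁ : ℝ) : ℂ) * ((Real.sqrt μ₁ : ℝ) : ℂ) = μ₁ := by
    rw [← Complex.ofReal_mul, Real.mul_self_sqrt h₁]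
  have em : ((-1 : ℂ) ^ m) * ((-1 : ℂ) ^ m) = 1 := by
    rw [← mul_pow]; norm_num
  cases r <;> cases a <;> cases b <;>
    simp [fProj_apply, pow_add, mul_mul_mul_comm, e₀, e₁, em] <;> ring

theorem fProj_sub (μ₀ μ₁ : ℝ) (r : Bool) (m : ℕ) (a b : Bool) :
    fProj μ₀ μ₁ r (false.toNat + m) a b - fProj μ₀ μ₁ r (true.toNat + m) a b =
      2 * (Real.sqrt μ₀ * Real.sqrt μ₁ : ℝ) * (-1) ^ m * if a ≠ b then offPhase r a else 0 := by
  have em : ((-1 : ℂ) ^ m) * ((-1 : ℂ) ^ m) = 1 := by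
    rw [← mul_pow]; norm_num
  cases r <;> cases a <;> cases b <;>
    simp [fProj_apply, pow_add, offPhase, mul_mul_mul_comm, em] <;> ring

section Parity

variable {κ : Type*} [DecidableEq κ] [Fintype κ]

theorem weight_eq_sum_toNat {κ : Type*} [Fintype κ] (o : κ → Bool) :
    weight o = ∑ i, (o i).toNat := by
  rw [weight, Finset.card_filter]
  exact Finset.sum_congr rfl fun i _ => by cases o i <;> rfl

/-- A product summed over the strings of even parity. -/
theorem sum_even_prod (h : κ → Bool → ℂ) :
    ∑ o ∈ Finset.univ.filter (fun o : κ → Bool => Even (weight o)), ∏ i, h i (o i) =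
      1 / 2 * (∏ i, (h i false + h i true) + ∏ i, (h i false - h i true)) := by
  have h1 : ∏ i, (h i false + h i true) = ∑ o : κ → Bool, ∏ i, h i (o i) := by
    rw [← Fintype.piFinset_univ, ← Finset.prod_univ_sum]
    exact Finset.prod_congr rfl fun i _ => by rw [Fintype.sum_bool, add_comm]
  have h2 : ∏ i, (h i false - h i true) =
      ∑ o : κ → Bool, (-1) ^ weight o * ∏ i, h i (o i) := by
    have : ∀ o : κ → Bool, (-1) ^ weight o * ∏ i, h i (o i) =
        ∏ i, (-1) ^ (o i).toNat * h i (o i) := fun o => by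
      rw [weight_eq_sum_toNat, ← Finset.prod_pow_eq_pow_sum, Finset.prod_mul_distrib]
    simp only [this]
    rw [← Fintype.piFinset_univ,
      ← Finset.prod_univ_sum (fun _ : κ => Finset.univ) fun i b => (-1) ^ b.toNat * h i b]
    exact Finset.prod_congr rfl fun i _ => by rw [Fintype.sum_bool]; simp; ring
  rw [h1, h2, ← Finset.sum_add_distrib, Finset.mul_sum, Finset.sum_filter]
  refine Finset.sum_congr rfl fun o _ => ?_
  split_ifs with he
  · rw [he.neg_one_pow]; ring
  · rw [(Nat.not_even_iff_odd.1 he).neg_one_pow]; ring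

theorem prod_single_mul (k : κ) (c : ℂ) (e : κ → ℂ) :
    ∏ i, ((if i = k then c else 1) * e i) = c * ∏ i, e i := by
  rw [Finset.prod_mul_distrib, Finset.prod_ite_eq' Finset.univ k, if_pos (Finset.mem_univ k)]

/-- The sum over the outcomes for fixed measurement settings. -/
theorem sum_outcomes_apply {μ₀ μ₁ : ℝ} (h₀ : 0 ≤ μ₀) (h₁ : 0 ≤ μ₁) (k : κ) (r : κ → Bool)
    (m : ℕ) (x y : κ → Bool) :
    ∑ o ∈ Finset.univ.filter (fun o : κ → Bool => Even (weight o)),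
      tensor (fun i => if i = k then fProj μ₀ μ₁ (r k) ((o k).toNat + m)
        else sProj (r i) (o i)) x y =
      (if x = y then ((if x k then μ₁ else μ₀ : ℝ) : ℂ) else 0) +
        if ∀ i, x i ≠ y i then
          (Real.sqrt μ₀ * Real.sqrt μ₁ : ℝ) * (-1) ^ m * ∏ i, offPhase (r i) (x i) else 0 := by
  have h : ∀ o : κ → Bool, tensor (fun i => if i = k then fProj μ₀ μ₁ (r k) ((o k).toNat + m)
        else sProj (r i) (o i)) x y =
      ∏ i, (fun (i : κ) (b : Bool) => if i = k then fProj μ₀ μ₁ (r k) (b.toNat + m) (x i) (y i)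
        else sProj (r i) b (x i) (y i)) i (o i) := by
    intro o
    rw [tensor, Matrix.of_apply]
    refine Finset.prod_congr rfl fun i _ => ?_
    by_cases hi : i = k
    · subst hi; simp
    · simp [hi]
  rw [Finset.sum_congr rfl fun o _ => h o, sum_even_prod fun (i : κ) (b : Bool) =>
    if i = k then fProj μ₀ μ₁ (r k) (b.toNat + m) (x i) (y i) else sProj (r i) b (x i) (y i)]
  have hadd : ∀ i, (if i = k then fProj μ₀ μ₁ (r k) (false.toNat + m) (x i) (y i)
        else sProj (r i) false (x i) (y i)) +
      (if i = k then fProj μ₀ μ₁ (r k) (true.toNat + m) (x i) (y i)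
        else sProj (r i) true (x i) (y i)) =
      (if i = k then 2 * ((if x k then μ₁ else μ₀ : ℝ) : ℂ) else 1) *
        if x i = y i then 1 else 0 := by
    intro i
    by_cases hi : i = k
    · subst hi; simp only [if_true]; exact fProj_add h₀ h₁ _ _ _ _
    · simp only [hi, if_false, one_mul]; exact sProj_add _ _ _
  have hsub : ∀ i, (if i = k then fProj μ₀ μ₁ (r k) (false.toNat + m) (x i) (y i)
        else sProj (r i) false (x i) (y i)) -
      (if i = k then fProj μ₀ μ₁ (r k) (true.toNat + m) (x i) (y i)
        else sProj (r i) true (x i) (y i)) =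
      (if i = k then (2 * ((Real.sqrt μ₀ * Real.sqrt μ₁ : ℝ) : ℂ) * (-1) ^ m) else 1) *
        if x i ≠ y i then offPhase (r i) (x i) else 0 := by
    intro i
    by_cases hi : i = k
    · subst hi; simp only [if_true]; exact fProj_sub _ _ _ _ _ _
    · simp only [hi, if_false, one_mul]; exact sProj_sub _ _ _
  simp only [hadd, hsub]
  rw [prod_single_mul, prod_single_mul, Finset.prod_ite_zero, Finset.prod_ite_zero]
  simp only [funext_iff (f := x), Finset.mem_univ, true_implies,
    Finset.prod_const_one]
  split_ifs <;> ring

/-- For settings of even weight the sign of the correction turns the product of the phases into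
signs that average to zero unless the string is constant. -/
theorem sum_settings_phase (x : κ → Bool) :
    ∑ r ∈ Finset.univ.filter (fun r : κ → Bool => Even (weight r)),
      (-1 : ℂ) ^ (weight r / 2) * ∏ i, offPhase (r i) (x i) =
      1 / 2 * 2 ^ Fintype.card κ *
        ((if x = fun _ => false then 1 else 0) + if x = fun _ => true then 1 else 0) := by
  have h : ∀ r ∈ Finset.univ.filter (fun r : κ → Bool => Even (weight r)),
      (-1 : ℂ) ^ (weight r / 2) * ∏ i, offPhase (r i) (x i) =
        ∏ i, (fun (i : κ) (b : Bool) => if x i then (-1 : ℂ) ^ b.toNat else 1) i (r i) := by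
    intro r hr
    have hI : (-1 : ℂ) ^ (weight r / 2) = ∏ i, Complex.I ^ (r i).toNat := by
      rw [Finset.prod_pow_eq_pow_sum, ← weight_eq_sum_toNat, ← Complex.I_sq, ← pow_mul,
        Nat.mul_div_cancel' (Finset.mem_filter.1 hr).2.two_dvd]
    rw [hI, ← Finset.prod_mul_distrib]
    refine Finset.prod_congr rfl fun i _ => ?_
    cases hr : r i <;> cases hx : x i <;> simp [offPhase, hx]
  rw [Finset.sum_congr rfl h,
    sum_even_prod fun (i : κ) (b : Bool) => if x i then (-1 : ℂ) ^ b.toNat else 1]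
  have e1 : ∀ i, (if x i then (-1 : ℂ) ^ false.toNat else 1) +
      (if x i then (-1 : ℂ) ^ true.toNat else 1) = if x i = false then 2 else 0 := fun i => by
    cases x i <;> norm_num
  have e2 : ∀ i, (if x i then (-1 : ℂ) ^ false.toNat else 1) -
      (if x i then (-1 : ℂ) ^ true.toNat else 1) = if x i = true then 2 else 0 := fun i => by
    cases x i <;> norm_num
  simp only [e1, e2, Finset.prod_ite_zero, Finset.mem_univ, true_implies, Finset.prod_const,
    Finset.card_univ, funext_iff]
  split_ifs <;> ring

theorem card_even_settings [Nonempty κ] :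
    ((Finset.univ.filter (fun r : κ → Bool => Even (weight r))).card : ℂ) =
      1 / 2 * 2 ^ Fintype.card κ := by
  have h := sum_even_prod (κ := κ) fun _ _ => 1
  simp only [Finset.prod_const_one, Finset.sum_const, nsmul_eq_mul, mul_one, sub_self,
    Finset.prod_const, Finset.card_univ, zero_pow Fintype.card_ne_zero, add_zero] at h
  rw [h]; norm_num

/-- Matrix elements of the GHZ-like strategy without the `Z` test. -/
theorem ghzLikeStrategy_apply [Nonempty κ] {μ₀ μ₁ : ℝ} (h₀ : 0 ≤ μ₀) (h₁ : 0 ≤ μ₁)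
    (x y : κ → Bool) :
    ghzLikeStrategy κ 0 μ₀ μ₁ x y =
      (((if x = y then (∑ k, if x k then μ₁ else μ₀) / Fintype.card κ else 0) +
        if (∀ i, x i ≠ y i) ∧ ((x = fun _ => false) ∨ (x = fun _ => true)) then
          Real.sqrt μ₀ * Real.sqrt μ₁ else 0 : ℝ) : ℂ) := by
  have hn : (Fintype.card κ : ℂ) ≠ 0 := by exact_mod_cast Fintype.card_ne_zero
  have hp : (2 : ℂ) ^ Fintype.card κ = 2 * 2 ^ (Fintype.card κ - 1) := by
    rw [← pow_succ', Nat.sub_add_cancel Fintype.card_pos]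
  have hft : (fun _ : κ => false) ≠ fun _ => true := fun h => by
    simpa using congrFun h (Classical.arbitrary κ)
  have key : ∀ k : κ, ∑ r ∈ Finset.univ.filter (fun r : κ → Bool => Even (weight r)),
      ∑ o ∈ Finset.univ.filter (fun o : κ → Bool => Even (weight o)),
        tensor (fun i => if i = k then fProj μ₀ μ₁ (r k) ((o k).toNat + weight r / 2)
              else sProj (r i) (o i)) x y =
      2 ^ (Fintype.card κ - 1) * ((if x = y then ((if x k then μ₁ else μ₀ : ℝ) : ℂ) else 0) +
        if (∀ i, x i ≠ y i) ∧ ((x = fun _ => false) ∨ (x = fun _ => true)) then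
          ((Real.sqrt μ₀ * Real.sqrt μ₁ : ℝ) : ℂ) else 0) := by
    intro k
    simp only [sum_outcomes_apply h₀ h₁]
    rw [Finset.sum_add_distrib, Finset.sum_const, nsmul_eq_mul, card_even_settings, hp, mul_add]
    congr 1
    · ring
    · by_cases hd : ∀ i, x i ≠ y i
      · simp only [if_pos hd, mul_assoc, ← Finset.mul_sum]
        rw [sum_settings_phase, hp]
        by_cases hx : x = fun _ => false
        · have hx' : x ≠ fun _ => true := fun h => hft (hx.symm.trans h)
          rw [if_pos hx, if_neg hx', if_pos ⟨hd, Or.inl hx⟩]; ring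
        · by_cases hx' : x = fun _ => true
          · rw [if_neg hx, if_pos hx', if_pos ⟨hd, Or.inr hx'⟩]; ring
          · rw [if_neg hx, if_neg hx', if_neg (by tauto)]; ring
      · simp [hd]
  rw [ghzLikeStrategy]
  simp only [Complex.ofReal_zero, zero_smul, zero_add, sub_zero, Complex.ofReal_one, one_smul,
    Matrix.smul_apply, Matrix.sum_apply, smul_eq_mul, key]
  have h2 : ((1 / 2 ^ (Fintype.card κ - 1) : ℝ) : ℂ) * 2 ^ (Fintype.card κ - 1) = 1 := by
    push_cast; field_simp
  simp only [← mul_assoc, h2, one_mul]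
  have h3 : ((1 / (Fintype.card κ : ℝ) : ℝ) : ℂ) * Fintype.card κ = 1 := by
    push_cast; field_simp
  rw [Finset.sum_add_distrib, Finset.sum_const, nsmul_eq_mul, Finset.card_univ, mul_add,
    ← mul_assoc, h3, one_mul, Complex.ofReal_add]
  congr 1
  · by_cases hxy : x = y
    · simp only [if_pos hxy]
      push_cast
      rw [one_div_mul_eq_div]
    · simp only [if_neg hxy, Finset.sum_const_zero, mul_zero, Complex.ofReal_zero]
  · split_ifs <;> simp

end Parity

section Dicke

variable {κ : Type*} [DecidableEq κ]

/-- The string `x` with the bits `b` at `i` and `c` at `j`. -/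
def setPair (i j : κ) (x : κ → Bool) (b c : Bool) : κ → Bool :=
  Function.update (Function.update x i b) j c

theorem setPair_fst {i j : κ} (hij : i ≠ j) (x : κ → Bool) (b c : Bool) :
    setPair i j x b c i = b := by simp [setPair, hij]

theorem setPair_snd (i j : κ) (x : κ → Bool) (b c : Bool) :
    setPair i j x b c j = c := by simp [setPair]

theorem setPair_of_ne {i j m : κ} (hi : m ≠ i) (hj : m ≠ j) (x : κ → Bool) (b c : Bool) :
    setPair i j x b c m = x m := by simp [setPair, hi, hj]

theorem eq_flip_pair_iff {i j : κ} (hij : i ≠ j) (x y : κ → Bool) :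
    y = flipAt i (flipAt j x) ↔ (∀ m, m ≠ i → m ≠ j → x m = y m) ∧ x i ≠ y i ∧ x j ≠ y j := by
  constructor
  · rintro rfl
    refine ⟨fun m hi hj => by rw [flipAt_of_ne hi, flipAt_of_ne hj], ?_, ?_⟩
    · rw [flipAt_same, flipAt_of_ne hij]; cases x i <;> simp
    · rw [flipAt_of_ne hij.symm, flipAt_same]; cases x j <;> simp
  · rintro ⟨h, hi, hj⟩
    funext m
    by_cases hmi : m = i
    · subst hmi
      rw [flipAt_same, flipAt_of_ne hij]
      revert hi; cases x m <;> cases y m <;> simp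
    · by_cases hmj : m = j
      · subst hmj
        rw [flipAt_of_ne hmi, flipAt_same]
        revert hj; cases x m <;> cases y m <;> simp
      · rw [flipAt_of_ne hmi, flipAt_of_ne hmj, h m hmi hmj]

theorem eq_iff_pair (i j : κ) (x y : κ → Bool) :
    y = x ↔ (∀ m, m ≠ i → m ≠ j → x m = y m) ∧ x i = y i ∧ x j = y j := by
  constructor
  · rintro rfl; simp
  · rintro ⟨h, hi, hj⟩
    funext m
    by_cases hmi : m = i
    · rw [hmi, hi]
    · by_cases hmj : m = j
      · rw [hmj, hj]
      · rw [h m hmi hmj]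

variable [Fintype κ]

theorem weightOff_comm (i j : κ) (x : κ → Bool) : weightOff i j x = weightOff j i x := by
  unfold weightOff
  congr 1
  ext m
  simp only [Finset.mem_filter]
  tauto

theorem weightOff_congr {i j : κ} {x y : κ → Bool} (h : ∀ m, m ≠ i → m ≠ j → x m = y m) :
    weightOff i j x = weightOff i j y := by
  unfold weightOff
  congr 1
  ext m
  simp only [Finset.mem_filter, Finset.mem_univ, true_and]
  constructor
  · rintro ⟨h1, h2, h3⟩; exact ⟨h1, h2, by rw [← h m h1 h2, h3]⟩
  · rintro ⟨h1, h2, h3⟩; exact ⟨h1, h2, by rw [h m h1 h2, h3]⟩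

theorem weight_eq_weightOff_add {i j : κ} (hij : i ≠ j) (x : κ → Bool) :
    weight x = weightOff i j x + (x i).toNat + (x j).toNat := by
  have h1 : weightOff i j x = ∑ m, if m ≠ i ∧ m ≠ j ∧ x m = true then 1 else 0 := by
    rw [weightOff, Finset.card_filter]
  have h2 : (x i).toNat = ∑ m, if m = i then (x m).toNat else 0 := by simp
  have h3 : (x j).toNat = ∑ m, if m = j then (x m).toNat else 0 := by simp
  rw [weight_eq_sum_toNat, h1, h2, h3, ← Finset.sum_add_distrib, ← Finset.sum_add_distrib]
  refine Finset.sum_congr rfl fun m _ => ?_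
  by_cases hi : m = i
  · subst hi; simp [hij]
  · by_cases hj : m = j
    · subst hj; simp [hi]
    · cases hm : x m <;> simp [hi, hj]

theorem sProj_false_apply (b a c : Bool) :
    sProj false b a c = 1 / 2 * if a = c then 1 else (-1) ^ b.toNat := by
  cases b <;> cases a <;> cases c <;> norm_num [sProj_apply]

/-- The matrix of the test of the Dicke strategy on a fixed pair of qubits: the `XX` parity
projector of the pair if the weight outside is `k - 1`, and the projector onto weight `k`
otherwise. -/
noncomputable def pairEntry (k : ℕ) (i j : κ) (x y : κ → Bool) : ℝ :=
  (if y = x then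
      (if weightOff i j x + 1 = k then 1 / 2 else if weight x = k then 1 else 0) else 0) +
    if y = flipAt i (flipAt j x) then (if weightOff i j x + 1 = k then 1 / 2 else 0) else 0

theorem sum_eq_sum_setPair {i j : κ} (hij : i ≠ j) (x : κ → Bool) (g : (κ → Bool) → ℂ)
    (h : ∀ o m, m ≠ i → m ≠ j → o m ≠ x m → g o = 0) :
    ∑ o, g o = ∑ b, ∑ c, g (setPair i j x b c) := by
  rw [← Fintype.sum_prod_type' (f := fun b c => g (setPair i j x b c))]
  symm
  refine Fintype.sum_of_injective (fun p : Bool × Bool => setPair i j x p.1 p.2) ?_ _ _ ?_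
    fun _ => rfl
  · intro p q hpq
    have h1 := congrFun hpq i
    have h2 := congrFun hpq j
    simp only [setPair_fst hij, setPair_snd] at h1 h2
    exact Prod.ext h1 h2
  · intro o ho
    by_contra hne
    refine ho ⟨(o i, o j), ?_⟩
    funext m
    by_cases hi : m = i
    · subst hi; exact setPair_fst hij _ _ _
    · by_cases hj : m = j
      · subst hj; exact setPair_snd _ _ _ _ _
      · refine (setPair_of_ne hi hj _ _ _).trans ?_
        by_contra hm
        exact hne (h o m hi hj (Ne.symm hm))

theorem prod_pair_mul (i j : κ) (c d : ℂ) (e : κ → ℂ) :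
    ∏ m, ((if m = i then c else 1) * ((if m = j then d else 1) * e m)) = c * (d * ∏ m, e m) := by
  rw [prod_single_mul, prod_single_mul]

open Classical in
/-- The accepting outcomes that contribute to the entry at `x`, `y` agree with `x` off the pair, so
only the four choices of the bits at `i` and `j` remain. -/
theorem sum_accepted_apply (k : ℕ) {i j : κ} (hij : i ≠ j) (x y : κ → Bool) :
    ∑ o ∈ Finset.univ.filter (fun o : κ → Bool => dickeAccepts k i j o),
      tensor (fun m => if (m = i ∨ m = j) ∧ weightOff i j o + 1 = k then sProj false (o m)
        else zProj (o m)) x y = (pairEntry k i j x y : ℂ) := by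
  rw [Finset.sum_filter, sum_eq_sum_setPair hij x]
  rotate_left
  · intro o m hi hj hm
    split_ifs with hacc
    · rw [tensor, Matrix.of_apply]
      refine Finset.prod_eq_zero (Finset.mem_univ m) ?_
      rw [if_neg (by tauto), zProj_apply, if_neg (fun h => hm h.1.symm)]
    · rfl
  have hw : ∀ b c, weightOff i j (setPair i j x b c) = weightOff i j x := fun b c =>
    weightOff_congr fun m hi hj => setPair_of_ne hi hj _ _ _
  have hwt : ∀ b c, weight (setPair i j x b c) = weightOff i j x + b.toNat + c.toNat :=
      fun b c => by
    rw [weight_eq_weightOff_add hij, hw, setPair_fst hij, setPair_snd]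
  have ht : ∀ b c, tensor (fun m => if (m = i ∨ m = j) ∧ weightOff i j x + 1 = k
        then sProj false (setPair i j x b c m) else zProj (setPair i j x b c m)) x y =
      (if weightOff i j x + 1 = k then sProj false b (x i) (y i) else zProj b (x i) (y i)) *
      ((if weightOff i j x + 1 = k then sProj false c (x j) (y j) else zProj c (x j) (y j)) *
        if ∀ m, m ≠ i → m ≠ j → x m = y m then 1 else 0) := by
    intro b c
    rw [show (if ∀ m, m ≠ i → m ≠ j → x m = y m then (1 : ℂ) else 0) =
      ∏ m, if m ≠ i → m ≠ j → x m = y m then 1 else 0 by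
        rw [Finset.prod_ite_zero]; simp, ← prod_pair_mul i j, tensor, Matrix.of_apply]
    refine Finset.prod_congr rfl fun m _ => ?_
    by_cases hi : m = i
    · subst hi
      rw [setPair_fst hij]
      simp only [true_or, true_and, if_true, hij, if_false, ne_eq, not_true,
        false_implies, mul_one]
      split_ifs <;> rfl
    · by_cases hj : m = j
      · subst hj
        rw [setPair_snd]
        simp only [or_true, true_and, if_true, hi, if_false, one_mul, ne_eq, not_true,
          false_implies, implies_true, mul_one]
        split_ifs <;> rfl
      · simp [setPair_of_ne hi hj, zProj_apply, hi, hj, eq_comm]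
  simp only [dickeAccepts, hw, hwt, setPair_fst hij, setPair_snd, ht]
  have hwx := weight_eq_weightOff_add hij x
  unfold pairEntry
  simp only [eq_iff_pair i j x y, eq_flip_pair_iff hij x y]
  by_cases hE : ∀ m, m ≠ i → m ≠ j → x m = y m
  · simp only [eq_true hE, if_true, mul_one, true_and]
    by_cases hk : weightOff i j x + 1 = k
    · simp only [if_pos hk, sProj_false_apply, Fintype.sum_bool]
      have n1 : weightOff i j x ≠ k := by omega
      have n2 : weightOff i j x + 2 ≠ k := by omega
      simp only [hk, n1, n2]
      cases x i <;> cases x j <;> cases y i <;> cases y j <;> norm_num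
    · simp only [if_neg hk, zProj_apply, Fintype.sum_bool, hwx]
      have hk' : ∀ b c : Bool, ((weightOff i j x = k ∨ weightOff i j x + 2 = k) ∧
          weightOff i j x + b.toNat + c.toNat = k) ↔ weightOff i j x + b.toNat + c.toNat = k := by
        intro b c
        cases b <;> cases c <;> simp <;> omega
      simp only [hk', hk, false_and, or_false]
      cases x i <;> cases x j <;> cases y i <;> cases y j <;> simp <;> split_ifs <;> simp
  · simp [hE]

theorem sum_lt_eq_half {κ : Type*} [LinearOrder κ] [Fintype κ] (f : κ → κ → ℝ)
    (hf : ∀ i j, f i j = f j i) :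
    ∑ e ∈ Finset.univ.filter (fun e : κ × κ => e.1 < e.2), f e.1 e.2 =
      1 / 2 * ∑ i, ∑ j, if i ≠ j then f i j else 0 := by
  rw [Finset.sum_filter, Fintype.sum_prod_type' (f := fun i j => if i < j then f i j else 0)]
  have h2 : ∑ i, ∑ j, (if i < j then f i j else 0) = ∑ i, ∑ j, if j < i then f i j else 0 := by
    rw [Finset.sum_comm]
    exact Finset.sum_congr rfl fun i _ => Finset.sum_congr rfl fun j _ => by rw [hf]
  have h3 : ∑ i, ∑ j, (if i ≠ j then f i j else 0) =
      ∑ i, ∑ j, (if i < j then f i j else 0) + ∑ i, ∑ j, if j < i then f i j else 0 := by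
    simp only [← Finset.sum_add_distrib]
    refine Finset.sum_congr rfl fun i _ => Finset.sum_congr rfl fun j _ => ?_
    rcases lt_trichotomy i j with h | h | h
    · simp [h, h.ne, h.not_gt]
    · simp [h]
    · simp [h, h.ne', h.not_gt]
  rw [h3, ← h2]; ring

theorem pairEntry_comm (k : ℕ) (i j : κ) (x y : κ → Bool) :
    pairEntry k i j x y = pairEntry k j i x y := by
  unfold pairEntry
  rw [weightOff_comm, flipAt_comm]

/-- Matrix elements of the Dicke strategy, as a sum over ordered pairs. -/
theorem dickeStrategy_apply {κ : Type*} [LinearOrder κ] [Fintype κ] (k : ℕ)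
    (x y : κ → Bool) :
    dickeStrategy κ k x y =
      ((1 / ((Fintype.card κ : ℝ) * (Fintype.card κ - 1)) *
        ∑ i, ∑ j, if i ≠ j then pairEntry k i j x y else 0 : ℝ) : ℂ) := by
  rw [dickeStrategy, Matrix.smul_apply, Matrix.sum_apply, smul_eq_mul]
  simp only [Matrix.sum_apply]
  rw [Finset.sum_congr rfl fun e he =>
      sum_accepted_apply k (Finset.mem_filter.1 he).2.ne x y,
    ← Complex.ofReal_sum, ← Complex.ofReal_mul,
    sum_lt_eq_half (fun i j => pairEntry k i j x y) fun i j => pairEntry_comm k i j x y,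
    Nat.cast_choose_two, ← mul_assoc]
  congr 2
  rw [one_div_div, div_mul_div_comm, mul_one, mul_comm _ (2 : ℝ)]
  nth_rewrite 1 [← mul_one (2 : ℝ)]
  rw [mul_div_mul_left _ _ two_ne_zero]

end Dicke

/-! ### Matrix elements of one round -/

theorem tensor_zProj_apply {κ : Type*} [DecidableEq κ] [Fintype κ] (o x y : κ → Bool) :
    tensor (fun i => zProj (o i)) x y = if o = x ∧ x = y then 1 else 0 := by
  simp only [tensor, Matrix.of_apply, zProj_apply, Finset.prod_ite_zero, Finset.prod_const_one]
  refine if_congr ?_ rfl rfl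
  simp only [Finset.mem_univ, true_implies, funext_iff]
  exact ⟨fun h => ⟨fun i => (h i).1.symm, fun i => (h i).1.trans (h i).2.symm⟩,
    fun h i => ⟨(h.1 i).symm, ((h.1 i).trans (h.2 i)).symm⟩⟩

theorem tensor_pauliX_apply {κ : Type*} [DecidableEq κ] [Fintype κ] (x y : κ → Bool) :
    tensor (fun _ : κ => pauliX) x y = if y = fun i => !x i then 1 else 0 := by
  have : ∀ a b : Bool, pauliX a b = if b = !a then 1 else 0 := by
    intro a b; cases a <;> cases b <;> simp [pauliX]
  simp only [tensor, Matrix.of_apply, this, Finset.prod_ite_zero, Finset.prod_const_one]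
  simp [funext_iff]

theorem tensor_pauliX_conj_apply {κ : Type*} [DecidableEq κ] [Fintype κ] (A : Op κ)
    (x y : κ → Bool) :
    ((tensor fun _ : κ => pauliX) * A * tensor fun _ : κ => pauliX) x y =
      A (fun i => !x i) (fun i => !y i) := by
  have h : ∀ z : κ → Bool, (y = fun i => !z i) = (z = fun i => !y i) := fun z => by
    refine propext ⟨fun h => ?_, fun h => ?_⟩ <;> simp [h]
  rw [Matrix.mul_apply]
  simp only [Matrix.mul_apply, tensor_pauliX_apply, h, ite_mul, one_mul, zero_mul,
    mul_ite, mul_one, mul_zero, Finset.sum_ite_eq', Finset.mem_univ, if_true]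

theorem weight_restrict_eq_zero_iff {ι : Type*} (R : Finset ι) (x : ι → Bool) :
    weight (fun i : {i // i ∈ R} => x i) = 0 ↔ ∀ i ∈ R, x i = false := by
  rw [weight_eq_zero_iff, funext_iff, Subtype.forall]

theorem weight_restrict_eq_card_iff {ι : Type*} (R : Finset ι) (x : ι → Bool) :
    weight (fun i : {i // i ∈ R} => x i) = R.card ↔ ∀ i ∈ R, x i = true := by
  rw [← Fintype.card_coe R, weight_eq_card_iff, funext_iff, Subtype.forall]

section Lift

variable {ι : Type*} [LinearOrder ι] [Fintype ι]

theorem weight_restrict_add (R : Finset ι) (x : ι → Bool) :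
    weight (fun i : {i // i ∈ R} => x i) + weight (fun i : {i // i ∉ R} => x i) = weight x := by
  simp only [weight_eq_sum_toNat]
  convert! Fintype.sum_subtype_add_sum_subtype (fun i => i ∈ R) fun i => (x i).toNat

theorem sum_outside (R : Finset ι) (f : ι → ℝ) :
    ∑ i : {i // i ∉ R}, f i = ∑ i, if i ∉ R then f i else 0 := by
  rw [← Finset.sum_filter]
  exact (Finset.sum_subtype _ (by simp) f).symm

/-- Measuring the qubits in `R` and acting on the others according to the weight of the outcome. -/
theorem sum_tensorSplit_apply (R : Finset ι) (A : ℕ → Op {i // i ∉ R}) (x y : ι → Bool) :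
    ∑ o : {i // i ∈ R} → Bool, tensorSplit R (tensor fun i => zProj (o i)) (A (weight o)) x y =
      if ∀ i ∈ R, x i = y i then
        A (weight fun i : {i // i ∈ R} => x i) (fun i => x i) (fun i => y i) else 0 := by
  simp only [tensorSplit, Matrix.of_apply, tensor_zProj_apply]
  have h : ((fun i : {i // i ∈ R} => x i) = fun i : {i // i ∈ R} => y i) ↔ ∀ i ∈ R, x i = y i := by
    simp [funext_iff]
  by_cases hR : ∀ i ∈ R, x i = y i
  · simp only [h.2 hR, and_true, if_pos hR, ite_mul, one_mul, zero_mul, Finset.sum_ite_eq',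
      Finset.mem_univ, if_true]
  · have h' := mt h.1 hR
    simp only [if_neg hR, h', and_false, if_false, zero_mul, Finset.sum_const_zero]

theorem restrict_eq_iff {ι : Type*} [DecidableEq ι] (R : Finset ι) (x y : ι → Bool) :
    (y = x) ↔ (∀ i ∈ R, x i = y i) ∧
      (fun i : {i // i ∉ R} => y i) = fun i : {i // i ∉ R} => x i := by
  constructor
  · rintro rfl; simp
  · rintro ⟨h1, h2⟩
    funext i
    by_cases hi : i ∈ R
    · exact (h1 i hi).symm
    · exact congrFun h2 ⟨i, hi⟩

/-- The string with the bit `b` on `R` and `!b` outside. -/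
def splitString (R : Finset ι) (b : Bool) : ι → Bool := fun i => if i ∈ R then b else !b

/-- Contribution to the matrix of one round of the GHZ-like test that is performed when all
outcomes on `R` are `b`. -/
noncomputable def ghzPart (R : Finset ι) (b : Bool) (n : ℕ) (μ₀ μ₁ : ℝ) (x y : ι → Bool) : ℝ :=
  (if y = x then (if ∀ i ∈ R, x i = b then
    (∑ i, if i ∉ R then (if x i = b then μ₀ else μ₁) else 0) / n else 0) else 0) +
  ((if x = (fun _ => b) then
      (if y = splitString R b then Real.sqrt μ₀ * Real.sqrt μ₁ else 0) else 0) +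
    if y = (fun _ => b) then
      (if x = splitString R b then Real.sqrt μ₀ * Real.sqrt μ₁ else 0) else 0)

theorem ghzPart_eq_zero {R : Finset ι} {b : Bool} (n : ℕ) (μ₀ μ₁ : ℝ) {x : ι → Bool}
    (y : ι → Bool) {i : ι} (hi : i ∈ R) (hx : x i ≠ b) : ghzPart R b n μ₀ μ₁ x y = 0 := by
  have h1 : ¬ ∀ i ∈ R, x i = b := fun h => hx (h i hi)
  have h2 : x ≠ fun _ => b := fun h => hx (congrFun h i)
  have h3 : x ≠ splitString R b := fun h => hx (by rw [h]; simp [splitString, hi])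
  simp [ghzPart, h1, h2, h3]

/-- The matrix of the GHZ-like strategy on the qubits outside of `R`, read as a matrix on all
qubits. -/
theorem ghz_lift {R : Finset ι} {b : Bool} {n : ℕ} (μ₀ μ₁ : ℝ) (hn : 0 < n)
    (hc : Fintype.card {i // i ∉ R} = n) (x y : ι → Bool) (hx : ∀ i ∈ R, x i = b) :
    (if ∀ i ∈ R, x i = y i then
      (if (fun i : {i // i ∉ R} => x i) = (fun i : {i // i ∉ R} => y i) then
        (∑ k : {i // i ∉ R}, if x k = b then μ₀ else μ₁) / Fintype.card {i // i ∉ R} else 0) +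
      (if (∀ i : {i // i ∉ R}, x i ≠ y i) ∧ ((∀ i : {i // i ∉ R}, x i = b) ∨
          (∀ i : {i // i ∉ R}, x i = !b)) then Real.sqrt μ₀ * Real.sqrt μ₁ else 0) else 0) =
      ghzPart R b n μ₀ μ₁ x y := by
  have hne : Nonempty {i // i ∉ R} := Fintype.card_pos_iff.1 (by omega)
  obtain ⟨⟨m, hm⟩⟩ := hne
  have e1 : (y = x) = ((∀ i ∈ R, x i = y i) ∧ (fun i : {i // i ∉ R} => x i) =
      (fun i : {i // i ∉ R} => y i)) := by
    rw [restrict_eq_iff R]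
    exact propext (and_congr_right fun _ => eq_comm)
  have hconst : ∀ z : ι → Bool, z = (fun _ => b) ↔ (∀ i ∈ R, z i = b) ∧ ∀ i ∉ R, z i = b := by
    intro z
    rw [funext_iff]
    exact ⟨fun h => ⟨fun i _ => h i, fun i _ => h i⟩, fun h i => by
      by_cases hi : i ∈ R
      · exact h.1 i hi
      · exact h.2 i hi⟩
  have hsplit : ∀ z : ι → Bool, z = splitString R b ↔
      (∀ i ∈ R, z i = b) ∧ ∀ i ∉ R, z i = !b := by
    intro z
    rw [funext_iff]
    refine ⟨fun h => ⟨fun i hi => by rw [h i, splitString, if_pos hi],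
      fun i hi => by rw [h i, splitString, if_neg hi]⟩, fun h i => ?_⟩
    by_cases hi : i ∈ R
    · rw [h.1 i hi, splitString, if_pos hi]
    · rw [h.2 i hi, splitString, if_neg hi]
  have hflip : ∀ a c : Bool, (a ≠ c ↔ c = !a) := by decide
  rw [hc, sum_outside R fun i => if x i = b then μ₀ else μ₁, ghzPart, if_pos hx]
  by_cases hA : ∀ i ∈ R, x i = y i
  · have hy : ∀ i ∈ R, y i = b := fun i hi => (hA i hi).symm.trans (hx i hi)
    rw [if_pos hA]
    congr 1
    · by_cases hxy : y = x
      · rw [if_pos hxy, if_pos (e1.mp hxy).2]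
      · rw [if_neg hxy, if_neg fun h => hxy (e1.mpr ⟨hA, h⟩)]
    · have c1 : x = (fun _ => b) ↔ ∀ i ∉ R, x i = b := by rw [hconst]; tauto
      have c2 : y = (fun _ => b) ↔ ∀ i ∉ R, y i = b := by rw [hconst]; tauto
      have c3 : x = splitString R b ↔ ∀ i ∉ R, x i = !b := by rw [hsplit]; tauto
      have c4 : y = splitString R b ↔ ∀ i ∉ R, y i = !b := by rw [hsplit]; tauto
      have hbb : (!b) ≠ b := by cases b <;> simp
      simp only [c1, c2, c3, c4, Subtype.forall]
      by_cases hx1 : ∀ i ∉ R, x i = b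
      · have hx2 : ¬ ∀ i ∉ R, x i = !b := fun h => hbb ((h m hm).symm.trans (hx1 m hm))
        have : ((∀ i ∉ R, x i ≠ y i) ∧ ((∀ i ∉ R, x i = b) ∨ ∀ i ∉ R, x i = !b)) ↔
            ∀ i ∉ R, y i = !b := by
          refine ⟨fun h i hi => ?_, fun h => ⟨fun i hi => ?_, Or.inl hx1⟩⟩
          · rw [← hx1 i hi]; exact (hflip _ _).1 (h.1 i hi)
          · rw [hflip, hx1 i hi]; exact h i hi
        simp only [this]
        simp only [eq_true hx1, eq_false hx2, if_true, if_false, ite_self, add_zero]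
      · by_cases hx2 : ∀ i ∉ R, x i = !b
        · have : ((∀ i ∉ R, x i ≠ y i) ∧ ((∀ i ∉ R, x i = b) ∨ ∀ i ∉ R, x i = !b)) ↔
              ∀ i ∉ R, y i = b := by
            refine ⟨fun h i hi => ?_, fun h => ⟨fun i hi => ?_, Or.inr hx2⟩⟩
            · have := (hflip _ _).1 (h.1 i hi)
              rw [this, hx2 i hi, Bool.not_not]
            · rw [hflip, hx2 i hi, Bool.not_not]; exact h i hi
          simp only [this]
          simp only [eq_false hx1, eq_true hx2, if_true, if_false, zero_add]
        · simp only [eq_false hx1, eq_false hx2, or_false, and_false, if_false, ite_self, add_zero]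
  · rw [if_neg hA]
    have n1 : y ≠ x := fun h => hA (e1.mp h).1
    have n2 : ∀ z w : ι → Bool, (∀ i ∈ R, z i = b) → y = z → False := by
      rintro z _ hz rfl
      exact hA fun i hi => (hx i hi).trans (hz i hi).symm
    have n3 : y ≠ splitString R b := fun h => n2 _ x (((hsplit _).1 rfl).1) h
    have n4 : y ≠ fun _ => b := fun h => n2 _ x (fun _ _ => rfl) h
    simp only [n1, n3, n4, if_false, ite_self, add_zero]

/-- Contribution to the matrix of one round of the Dicke tests, which are performed when the
outcomes on `R` are not all equal. -/
noncomputable def dickePart (R : Finset ι) (n : ℕ) (x y : ι → Bool) : ℝ :=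
  if (∃ i ∈ R, x i = true) ∧ (∃ i ∈ R, x i = false) then
    1 / ((n : ℝ) * (n - 1)) * ∑ i, ∑ j, if i ≠ j ∧ i ∉ R ∧ j ∉ R then pairEntry n i j x y else 0
  else 0

theorem weightOff_restrict_add (R : Finset ι) {i j : ι} (hij : i ≠ j) (hi : i ∉ R) (hj : j ∉ R)
    (x : ι → Bool) :
    weight (fun i : {i // i ∈ R} => x i) +
      weightOff (⟨i, hi⟩ : {i // i ∉ R}) ⟨j, hj⟩ (fun i => x i) = weightOff i j x := by
  have h1 := weight_eq_weightOff_add hij x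
  have h2 := weight_eq_weightOff_add (i := (⟨i, hi⟩ : {i // i ∉ R})) (j := ⟨j, hj⟩)
    (fun h => hij (congrArg Subtype.val h)) (fun i => x i)
  have h3 := weight_restrict_add R x
  dsimp only at h2
  omega

theorem pairEntry_restrict (R : Finset ι) {n : ℕ} {i j : ι} (hij : i ≠ j) (hi : i ∉ R)
    (hj : j ∉ R) (x y : ι → Bool) (hl : weight (fun i : {i // i ∈ R} => x i) < n)
    (hA : ∀ i ∈ R, x i = y i) :
    pairEntry (n - weight (fun i : {i // i ∈ R} => x i)) (⟨i, hi⟩ : {i // i ∉ R}) ⟨j, hj⟩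
      (fun i => x i) (fun i => y i) = pairEntry n i j x y := by
  have h1 := weightOff_restrict_add R hij hi hj x
  have h2 := weight_restrict_add R x
  have e1 : weightOff (⟨i, hi⟩ : {i // i ∉ R}) ⟨j, hj⟩ (fun i => x i) + 1 =
      n - weight (fun i : {i // i ∈ R} => x i) ↔ weightOff i j x + 1 = n := by omega
  have e2 : weight (fun i : {i // i ∉ R} => x i) =
      n - weight (fun i : {i // i ∈ R} => x i) ↔ weight x = n := by omega
  have e3 : ((fun i : {i // i ∉ R} => y i) = fun i : {i // i ∉ R} => x i) ↔ y = x := by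
    rw [restrict_eq_iff R x y]; exact ⟨fun h => ⟨hA, h⟩, fun h => h.2⟩
  have e4 : ((fun i : {i // i ∉ R} => y i) = flipAt (⟨i, hi⟩ : {i // i ∉ R})
      (flipAt ⟨j, hj⟩ fun i : {i // i ∉ R} => x i)) ↔ y = flipAt i (flipAt j x) := by
    rw [eq_flip_pair_iff hij, eq_flip_pair_iff fun h => hij (congrArg Subtype.val h)]
    refine and_congr_left fun _ => ⟨fun h m hmi hmj => ?_, fun h m hmi hmj => ?_⟩
    · by_cases hm : m ∈ R
      · exact hA m hm
      · exact h ⟨m, hm⟩ (fun h => hmi (congrArg Subtype.val h))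
          (fun h => hmj (congrArg Subtype.val h))
    · exact h m (fun h => hmi (Subtype.ext h)) fun h => hmj (Subtype.ext h)
  unfold pairEntry
  simp only [e1, e2, e3, e4]

theorem pairEntry_eq_zero {R : Finset ι} {i j : ι} (hij : i ≠ j) (hi : i ∉ R) (hj : j ∉ R) (n : ℕ)
    {x y : ι → Bool} (hA : ¬ ∀ i ∈ R, x i = y i) : pairEntry n i j x y = 0 := by
  have h1 : ∀ m ∈ R, m ≠ i ∧ m ≠ j := fun m hm => ⟨fun h => hi (h ▸ hm), fun h => hj (h ▸ hm)⟩
  have e1 : y ≠ x := fun h => hA fun m _ => by rw [h]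
  have e2 : y ≠ flipAt i (flipAt j x) := fun h => hA fun m hm =>
    ((eq_flip_pair_iff hij x y).1 h).1 m (h1 m hm).1 (h1 m hm).2
  simp [pairEntry, e1, e2]

/-- The matrix of the Dicke strategy on the qubits outside of `R`, read as a matrix on all qubits.
The excitations in `R` and those demanded outside add up to `n`. -/
theorem dicke_lift {R : Finset ι} {n : ℕ} (hc : Fintype.card {i // i ∉ R} = n)
    (x y : ι → Bool) (hl : weight (fun i : {i // i ∈ R} => x i) < n)
    (hx : (∃ i ∈ R, x i = true) ∧ (∃ i ∈ R, x i = false)) :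
    (if ∀ i ∈ R, x i = y i then
      dickeStrategy {i // i ∉ R} (n - weight (fun i : {i // i ∈ R} => x i))
        (fun i => x i) (fun i => y i) else 0) = (dickePart R n x y : ℂ) := by
  rw [dickePart, if_pos hx]
  by_cases hA : ∀ i ∈ R, x i = y i
  · rw [if_pos hA, dickeStrategy_apply, hc]
    congr 2
    have h1 : ∀ i j : {i // i ∉ R}, (if i ≠ j then
        pairEntry (n - weight (fun i : {i // i ∈ R} => x i)) i j (fun i => x i) (fun i => y i)
          else 0) = if i.1 ≠ j.1 then pairEntry n i.1 j.1 x y else 0 := by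
      intro i j
      by_cases hij : i = j
      · simp [hij]
      · have hij' : (i : ι) ≠ j := fun h => hij (Subtype.ext h)
        rw [if_pos hij, if_pos hij']
        exact pairEntry_restrict R hij' i.2 j.2 x y hl hA
    trans ∑ i : {i // i ∉ R}, ∑ j : {i // i ∉ R}, if i.1 ≠ j.1 then pairEntry n i.1 j.1 x y else 0
    · refine Finset.sum_congr rfl fun i _ => Finset.sum_congr rfl fun j _ => ?_
      rw [← h1]
      congr!
    have h2 : ∀ i : ι, ∑ j : {i // i ∉ R}, (if i ≠ j then pairEntry n i j x y else 0) =
        ∑ j, if j ∉ R then (if i ≠ j then pairEntry n i j x y else 0) else 0 := fun i =>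
      sum_outside R fun j : ι => if i ≠ j then pairEntry n i j x y else 0
    simp only [h2]
    rw [sum_outside R fun i : ι => ∑ j, if j ∉ R then (if i ≠ j then pairEntry n i j x y else 0)
      else 0]
    refine Finset.sum_congr rfl fun i _ => ?_
    by_cases hi : i ∈ R
    · simp [hi]
    · rw [if_pos hi]
      refine Finset.sum_congr rfl fun j _ => ?_
      by_cases hj : j ∈ R <;> simp [hi, hj]
  · rw [if_neg hA]
    symm
    rw [Complex.ofReal_eq_zero]
    apply mul_eq_zero_of_right
    refine Finset.sum_eq_zero fun i _ => Finset.sum_eq_zero fun j _ => ?_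
    split_ifs with h
    · exact pairEntry_eq_zero h.1 h.2.1 h.2.2 n hA
    · rfl

/-- Matrix elements of one round for a fixed set `R`. -/
theorem sum_subStrategy_apply {R : Finset ι} {n : ℕ} (hn : 0 < n) (hR : R.card = n)
    (hc : Fintype.card {i // i ∉ R} = n) {μ₀ μ₁ : ℝ} (h₀ : 0 ≤ μ₀) (h₁ : 0 ≤ μ₁)
    (x y : ι → Bool) :
    ∑ o : {i // i ∈ R} → Bool, tensorSplit R (tensor fun i => zProj (o i))
      (subStrategy {i // i ∉ R} n 0 μ₀ μ₁ (weight o)) x y =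
      ((ghzPart R false n μ₀ μ₁ x y + ghzPart R true n μ₀ μ₁ x y + dickePart R n x y : ℝ) : ℂ) := by
  rw [sum_tensorSplit_apply R fun l => subStrategy {i // i ∉ R} n 0 μ₀ μ₁ l]
  have hne : Nonempty {i // i ∉ R} := Fintype.card_pos_iff.1 (by omega)
  obtain ⟨m, hm⟩ := Finset.card_pos.1 (hR.symm ▸ hn)
  by_cases hx0 : ∀ i ∈ R, x i = false
  · have hmx : x m ≠ true := by rw [hx0 m hm]; simp
    have hd : dickePart R n x y = 0 := by
      rw [dickePart, if_neg]
      rintro ⟨⟨i, hi, hxi⟩, -⟩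
      rw [hx0 i hi] at hxi; exact absurd hxi (by simp)
    rw [ghzPart_eq_zero n μ₀ μ₁ y hm hmx, hd, add_zero, add_zero, ← ghz_lift μ₀ μ₁ hn hc x y hx0,
      (weight_restrict_eq_zero_iff R x).2 hx0, subStrategy, if_pos rfl, ghzLikeStrategy_apply h₀ h₁]
    by_cases hA : ∀ i ∈ R, x i = y i
    · rw [if_pos hA, if_pos hA]
      congr 2
      · refine if_congr Iff.rfl ?_ rfl
        congr 1
        exact Finset.sum_congr rfl fun k _ => by cases x k <;> rfl
      · simp only [funext_iff, Bool.not_false]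
    · rw [if_neg hA, if_neg hA, Complex.ofReal_zero]
  · by_cases hx1 : ∀ i ∈ R, x i = true
    · have hmx : x m ≠ false := by rw [hx1 m hm]; simp
      have hd : dickePart R n x y = 0 := by
        rw [dickePart, if_neg]
        rintro ⟨-, i, hi, hxi⟩
        rw [hx1 i hi] at hxi; exact absurd hxi (by simp)
      rw [ghzPart_eq_zero n μ₀ μ₁ y hm hmx, hd, add_zero, zero_add,
        ← ghz_lift μ₀ μ₁ hn hc x y hx1, (weight_restrict_eq_card_iff R x).2 hx1, hR, subStrategy,
        if_neg hn.ne', if_pos rfl, tensor_pauliX_conj_apply, ghzLikeStrategy_apply h₀ h₁]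
      by_cases hA : ∀ i ∈ R, x i = y i
      · rw [if_pos hA, if_pos hA]
        congr 2
        · refine if_congr ?_ ?_ rfl
          · simp [funext_iff]
          · congr 1
            exact Finset.sum_congr rfl fun k _ => by cases x k <;> rfl
        · refine if_congr ?_ rfl rfl
          simp [funext_iff]
      · rw [if_neg hA, if_neg hA, Complex.ofReal_zero]
    · have hl0 := mt (weight_restrict_eq_zero_iff R x).1 hx0
      have hl1 := mt (weight_restrict_eq_card_iff R x).1 hx1
      have hle := weight_le_card fun i : {i // i ∈ R} => x i
      rw [Fintype.card_coe] at hle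
      rw [hR] at hl1 hle
      have hx : (∃ i ∈ R, x i = true) ∧ (∃ i ∈ R, x i = false) := by
        push Not at hx0 hx1
        simpa using And.intro hx0 hx1
      obtain ⟨⟨i, hi, hxi⟩, j, hj, hxj⟩ := id hx
      rw [ghzPart_eq_zero n μ₀ μ₁ y hi (by rw [hxi]; simp),
        ghzPart_eq_zero n μ₀ μ₁ y hj (by rw [hxj]; simp), zero_add, zero_add,
        ← dicke_lift hc x y (by omega) hx, subStrategy, if_neg hl0, if_neg hl1]

end Lift

/-- Matrix elements of one round of the protocol. -/
theorem strategy_apply {n : ℕ} (hn : 0 < n) {q₀ q₁ : ℝ} (h₀ : 0 ≤ lam₀ n q₀ q₁)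
    (h₁ : 0 ≤ lam₁ n q₀ q₁) (x y : Fin (2 * n) → Bool) :
    strategy n 0 q₀ q₁ x y =
      ((1 / ((2 * n).choose n : ℝ) *
        ∑ R ∈ Finset.powersetCard n (Finset.univ : Finset (Fin (2 * n))),
          (ghzPart R false n (lam₀ n q₀ q₁) (lam₁ n q₀ q₁) x y +
            ghzPart R true n (lam₀ n q₀ q₁) (lam₁ n q₀ q₁) x y + dickePart R n x y) : ℝ) : ℂ) := by
  rw [strategy, Matrix.smul_apply, Matrix.sum_apply, smul_eq_mul, Complex.ofReal_mul,
    Complex.ofReal_sum]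
  congr 1
  refine Finset.sum_congr rfl fun R hR => ?_
  have hR' := (Finset.mem_powersetCard.1 hR).2
  have hc : Fintype.card {i // i ∉ R} = n := by
    rw [Fintype.card_subtype_compl, Fintype.card_coe, hR', Fintype.card_fin]; omega
  rw [Matrix.sum_apply, ← sum_subStrategy_apply hn hR' hc h₀ h₁]

/-! ### Counting sets and pairs of qubits -/

section Counting

variable {ι : Type*} [DecidableEq ι] [Fintype ι]

/-- Number of bits equal to `b`. -/
def bitCount {ι : Type*} [Fintype ι] (b : Bool) (x : ι → Bool) : ℕ :=
  (Finset.univ.filter fun i => x i = b).card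

theorem bitCount_true {ι : Type*} [Fintype ι] (x : ι → Bool) : bitCount true x = weight x := rfl

theorem bitCount_false {ι : Type*} [Fintype ι] (x : ι → Bool) :
    bitCount false x = Fintype.card ι - weight x := by
  have h := Finset.card_filter_add_card_filter_not (s := (Finset.univ : Finset ι))
    (fun i => x i = true)
  simp only [Bool.not_eq_true, Finset.card_univ] at h
  rw [bitCount, weight]
  omega

theorem bitCount_add {ι : Type*} [Fintype ι] (b : Bool) (x : ι → Bool) :
    bitCount b x + bitCount (!b) x = Fintype.card ι := by
  have h := weight_le_card x
  cases b
  · rw [Bool.not_false, bitCount_true, bitCount_false]; omega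
  · rw [Bool.not_true, bitCount_true, bitCount_false]; omega

theorem card_powersetCard_constant (n : ℕ) (b : Bool) (x : ι → Bool) :
    ((Finset.powersetCard n (Finset.univ : Finset ι)).filter fun R => ∀ i ∈ R, x i = b).card =
      (bitCount b x).choose n := by
  rw [bitCount, ← Finset.card_powersetCard]
  congr 1
  ext R
  simp only [Finset.mem_filter, Finset.mem_powersetCard, Finset.subset_iff, Finset.mem_univ,
    true_and, implies_true]
  tauto

theorem card_powersetCard_avoiding (n : ℕ) {i j : ι} (hij : i ≠ j) :
    ((Finset.powersetCard n (Finset.univ : Finset ι)).filter fun R => i ∉ R ∧ j ∉ R).card =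
      (Fintype.card ι - 2).choose n := by
  have h : ((Finset.univ : Finset ι) \ {i, j}).card = Fintype.card ι - 2 := by
    rw [Finset.card_sdiff_of_subset (Finset.subset_univ _), Finset.card_pair hij, Finset.card_univ]
  rw [← h, ← Finset.card_powersetCard]
  congr 1
  ext R
  simp only [Finset.mem_filter, Finset.mem_powersetCard, Finset.subset_iff, Finset.mem_univ,
    Finset.mem_sdiff, Finset.mem_insert, Finset.mem_singleton, true_and, implies_true]
  constructor
  · rintro ⟨h1, h2, h3⟩
    refine ⟨fun k hk hk' => ?_, h1⟩
    rcases hk' with rfl | rfl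
    · exact h2 hk
    · exact h3 hk
  · rintro ⟨h1, h2⟩
    exact ⟨h2, fun h => h1 h (Or.inl rfl), fun h => h1 h (Or.inr rfl)⟩

/-- Averaging over the sets `R` that avoid a pair. -/
theorem sum_powersetCard_pairs (n : ℕ) (f : ι → ι → ℝ) :
    ∑ R ∈ Finset.powersetCard n (Finset.univ : Finset ι),
      ∑ i, ∑ j, (if i ≠ j ∧ i ∉ R ∧ j ∉ R then f i j else 0) =
      ((Fintype.card ι - 2).choose n : ℝ) * ∑ i, ∑ j, if i ≠ j then f i j else 0 := by
  rw [Finset.sum_comm, Finset.mul_sum]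
  refine Finset.sum_congr rfl fun i _ => ?_
  rw [Finset.sum_comm, Finset.mul_sum]
  refine Finset.sum_congr rfl fun j _ => ?_
  by_cases hij : i = j
  · simp [hij]
  · simp only [ne_eq, hij, not_false_eq_true, true_and, if_true]
    rw [← Finset.sum_filter, Finset.sum_const, card_powersetCard_avoiding n hij, nsmul_eq_mul]

/-- Ordered pairs of distinct indices with a property. -/
theorem sum_ne_indicator (p : ι → Prop) [DecidablePred p] :
    ∑ i, ∑ j, (if i ≠ j ∧ p i ∧ p j then (1 : ℝ) else 0) =
      (Finset.univ.filter p).card * (((Finset.univ.filter p).card : ℝ) - 1) := by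
  have h1 : ((Finset.univ.filter p).card : ℝ) = ∑ i, if p i then 1 else 0 := by simp
  have h2 : ∀ i j, (if i ≠ j ∧ p i ∧ p j then (1 : ℝ) else 0) =
      (if p i then 1 else 0) * (if p j then 1 else 0) -
        if i = j then (if p i then 1 else 0) else 0 := by
    intro i j
    by_cases hij : i = j
    · subst hij; by_cases hp : p i <;> simp [hp]
    · by_cases hp : p i <;> by_cases hq : p j <;> simp [hij, hp, hq]
  simp only [h2, Finset.sum_sub_distrib, Finset.sum_ite_eq, Finset.mem_univ, if_true,
    ← Finset.mul_sum, ← Finset.sum_mul]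
  rw [← h1]; ring

theorem sum_ne_one (ι : Type*) [DecidableEq ι] [Fintype ι] :
    ∑ i : ι, ∑ j : ι, (if i ≠ j then (1 : ℝ) else 0) =
      Fintype.card ι * ((Fintype.card ι : ℝ) - 1) := by
  simpa using sum_ne_indicator (ι := ι) fun _ => True

theorem sum_bit_ne {ι : Type*} [Fintype ι] (x : ι → Bool) :
    ∑ i, ∑ j, (if x i ≠ x j then (1 : ℝ) else 0) =
      2 * weight x * ((Fintype.card ι : ℝ) - weight x) := by
  have h : ∀ i j, (if x i ≠ x j then (1 : ℝ) else 0) =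
      (if x i = true then 1 else 0) * (if x j = true then 0 else 1) +
        (if x i = true then 0 else 1) * (if x j = true then 1 else 0) := by
    intro i j
    cases x i <;> cases x j <;> simp
  simp only [h, Finset.sum_add_distrib, ← Finset.mul_sum, ← Finset.sum_mul,
    ← cast_card_sub_weight, ← cast_weight]
  ring

/-- The number of ordered pairs of equal bits outside of which the weight is `n - 1`. -/
theorem sum_equal_pairs (n : ℕ) (x : ι → Bool) (hN : Fintype.card ι = 2 * n) :
    ∑ i, ∑ j, (if i ≠ j ∧ weightOff i j x + 1 = n ∧ x i = x j then (1 : ℝ) else 0) =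
      if weight x + 1 = n ∨ weight x = n + 1 then (n : ℝ) * (n + 1) else 0 := by
  have key : ∀ i j, (i ≠ j ∧ weightOff i j x + 1 = n ∧ x i = x j) ↔
      i ≠ j ∧ ((weight x + 1 = n ∧ x i = false ∧ x j = false) ∨
        (weight x = n + 1 ∧ x i = true ∧ x j = true)) := by
    intro i j
    refine and_congr_right fun hij => ?_
    have := weight_eq_weightOff_add hij x
    cases hi : x i <;> cases hj : x j <;> simp [hi, hj] at this ⊢ <;> omega
  simp only [key]
  by_cases h1 : weight x + 1 = n
  · have h2 : weight x ≠ n + 1 := by omega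
    simp only [h1, h2, true_and, false_and, or_false, if_true]
    rw [sum_ne_indicator fun i => x i = false]
    have h3 : (Finset.univ.filter fun i => x i = false).card = n + 1 := by
      have := bitCount_false x
      rw [bitCount] at this
      omega
    rw [h3]; push_cast; ring
  · by_cases h2 : weight x = n + 1
    · simp only [h1, eq_true h2, true_and, false_and, false_or, if_true]
      rw [sum_ne_indicator fun i => x i = true]
      have h3 : (Finset.univ.filter fun i => x i = true).card = n + 1 := h2
      rw [h3]; push_cast; ring
    · simp [h1, h2]

end Counting

/-! ### The quadratic form of one round -/

section Form

variable {ι : Type*} [LinearOrder ι] [Fintype ι]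

/-- Weight of `|x⟩⟨x|` in the GHZ-like tests. -/
noncomputable def ghzDiag (b : Bool) (n : ℕ) (μ₀ μ₁ : ℝ) (x : ι → Bool) : ℝ :=
  (bitCount b x).choose n * ((((bitCount b x : ℝ) - n) * μ₀ + (2 * n - bitCount b x) * μ₁) / n)

/-- The strings that are constant on a set of size `n` and opposite outside are exactly those of
weight `n`. -/
theorem sum_splitString {n : ℕ} (hN : Fintype.card ι = 2 * n) (b : Bool) (a : (ι → Bool) → ℝ) :
    ∑ R ∈ Finset.powersetCard n (Finset.univ : Finset ι), a (splitString R b) =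
      ∑ x ∈ Finset.univ.filter (fun x : ι → Bool => weight x = n), a x := by
  have hb : ∀ x : ι → Bool, weight x = n ↔ bitCount b x = n := by
    intro x
    have h := weight_le_card x
    cases b
    · rw [bitCount_false]; omega
    · rw [bitCount_true]
  have hs : ∀ (R : Finset ι) (i : ι), splitString R b i = b ↔ i ∈ R := by
    intro R i
    by_cases hi : i ∈ R <;> cases b <;> simp [splitString, hi]
  refine Finset.sum_bij' (fun R _ => splitString R b)
    (fun x _ => Finset.univ.filter fun i => x i = b) ?_ ?_ ?_ ?_ fun _ _ => rfl
  · intro R hR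
    rw [Finset.mem_filter, hb, bitCount]
    simp only [hs, Finset.filter_univ_mem]
    exact ⟨Finset.mem_univ _, (Finset.mem_powersetCard.1 hR).2⟩
  · intro x hx
    rw [Finset.mem_filter, hb] at hx
    exact Finset.mem_powersetCard.2 ⟨Finset.subset_univ _, hx.2⟩
  · intro R _
    simp only [hs, Finset.filter_univ_mem]
  · intro x _
    funext i
    by_cases hi : x i = b
    · rw [hi, hs]; simp [hi]
    · have h1 : splitString (Finset.univ.filter fun i => x i = b) b i ≠ b := by
        rw [ne_eq, hs]; simp [hi]
      revert hi h1
      generalize splitString (Finset.univ.filter fun i => x i = b) b i = c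
      cases c <;> cases x i <;> cases b <;> simp

theorem ghzPart_form (R : Finset ι) (b : Bool) (n : ℕ) (μ₀ μ₁ : ℝ) (a : (ι → Bool) → ℝ) :
    ∑ x, ∑ y, ghzPart R b n μ₀ μ₁ x y * (a x * a y) =
      ∑ x, (if ∀ i ∈ R, x i = b then
        (∑ i, if i ∉ R then (if x i = b then μ₀ else μ₁) else 0) / n else 0) * a x ^ 2 +
      2 * (Real.sqrt μ₀ * Real.sqrt μ₁) * (a (fun _ => b) * a (splitString R b)) := by
  simp only [ghzPart, add_mul, Finset.sum_add_distrib, ite_mul, zero_mul, Finset.sum_ite_eq',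
    Finset.mem_univ, if_true, Finset.sum_ite_irrel, Finset.sum_const_zero, sq]
  ring

theorem sum_ghzPart_form {n : ℕ} (hN : Fintype.card ι = 2 * n) (b : Bool) (μ₀ μ₁ : ℝ)
    (a : (ι → Bool) → ℝ) :
    ∑ R ∈ Finset.powersetCard n (Finset.univ : Finset ι),
      ∑ x, ∑ y, ghzPart R b n μ₀ μ₁ x y * (a x * a y) =
      ∑ x, ghzDiag b n μ₀ μ₁ x * a x ^ 2 +
        2 * (Real.sqrt μ₀ * Real.sqrt μ₁) * (a (fun _ => b) *
          ∑ x ∈ Finset.univ.filter (fun x : ι → Bool => weight x = n), a x) := by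
  simp only [ghzPart_form]
  rw [Finset.sum_add_distrib, ← Finset.mul_sum, ← Finset.mul_sum, sum_splitString hN,
    Finset.sum_comm]
  congr 1
  refine Finset.sum_congr rfl fun x _ => ?_
  rw [← Finset.sum_mul, ghzDiag, ← card_powersetCard_constant, ← nsmul_eq_mul, ← Finset.sum_const,
    Finset.sum_filter]
  congr 1
  refine Finset.sum_congr rfl fun R hR => ?_
  have hR' := (Finset.mem_powersetCard.1 hR).2
  by_cases hx : ∀ i ∈ R, x i = b
  · rw [if_pos hx, if_pos hx]
    congr 1
    -- outside of `R` there are `bitCount b x - n` bits equal to `b`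
    have h1 : ∀ i, (if i ∉ R then (if x i = b then μ₀ else μ₁) else 0) =
        (if x i = b then μ₀ else 0) + ((if x i = !b then μ₁ else 0) - if i ∈ R then μ₀ else 0) := by
      intro i
      by_cases hi : i ∈ R
      · have := hx i hi
        cases b <;> simp [hi, this]
      · cases x i <;> cases b <;> simp [hi]
    have h2 : (bitCount b x : ℝ) + bitCount (!b) x = 2 * n := by
      exact_mod_cast (bitCount_add b x).trans hN
    simp only [h1]
    rw [Finset.sum_add_distrib, Finset.sum_sub_distrib, ← Finset.sum_filter, ← Finset.sum_filter,
      ← Finset.sum_filter, Finset.sum_const, Finset.sum_const, Finset.sum_const,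
      Finset.filter_univ_mem, hR', ← bitCount, ← bitCount]
    simp only [nsmul_eq_mul]
    linear_combination μ₁ * h2
  · rw [if_neg hx, if_neg hx]

/-- The part of a Dicke test on the pair `i`, `j` that acts within the slice of weight `n`. -/
noncomputable def sliceTerm (n : ℕ) (a : (ι → Bool) → ℝ) (i j : ι) (x : ι → Bool) : ℝ :=
  if weight x = n then
    (if x i ≠ x j then 1 / 2 * (a x ^ 2 + a x * a (flipAt i (flipAt j x))) else a x ^ 2) else 0

/-- The part of a Dicke test on the pair `i`, `j` that couples the weights `n - 1` and `n + 1`. -/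
noncomputable def crossTerm (n : ℕ) (a : (ι → Bool) → ℝ) (i j : ι) (x : ι → Bool) : ℝ :=
  if weightOff i j x + 1 = n ∧ x i = x j then
    1 / 2 * (a x ^ 2 + a x * a (flipAt i (flipAt j x))) else 0

theorem pairEntry_form {n : ℕ} {i j : ι} (hij : i ≠ j) (a : (ι → Bool) → ℝ) (x : ι → Bool) :
    ∑ y, pairEntry n i j x y * (a x * a y) = sliceTerm n a i j x + crossTerm n a i j x := by
  simp only [pairEntry, add_mul, Finset.sum_add_distrib, ite_mul, zero_mul, Finset.sum_ite_eq',
    Finset.mem_univ, if_true, sliceTerm, crossTerm]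
  have hw := weight_eq_weightOff_add hij x
  by_cases h1 : weightOff i j x + 1 = n
  · by_cases he : x i = x j
    · have hne : weight x ≠ n := by
        cases hi : x i <;> cases hj : x j <;> simp [hi, hj] at hw he <;> omega
      simp [h1, he, hne]; ring
    · have heq : weight x = n := by
        cases hi : x i <;> cases hj : x j <;> simp [hi, hj] at hw he <;> omega
      simp [h1, he, heq]; ring
  · by_cases h2 : weight x = n
    · have h3 : x i = x j := by
        cases hi : x i <;> cases hj : x j <;> simp [hi, hj] at hw ⊢ <;> omega
      simp [h1, h2, h3, sq]
    · simp [h1, h2]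

theorem dickePart_form (R : Finset ι) (n : ℕ) (a : (ι → Bool) → ℝ) :
    ∑ x, ∑ y, dickePart R n x y * (a x * a y) =
      1 / ((n : ℝ) * (n - 1)) * ∑ x, ∑ i, ∑ j, if i ≠ j ∧ i ∉ R ∧ j ∉ R then
        (if (∃ i ∈ R, x i = true) ∧ (∃ i ∈ R, x i = false) then
          sliceTerm n a i j x + crossTerm n a i j x else 0) else 0 := by
  rw [Finset.mul_sum]
  refine Finset.sum_congr rfl fun x _ => ?_
  by_cases hm : (∃ i ∈ R, x i = true) ∧ (∃ i ∈ R, x i = false)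
  · simp only [dickePart, if_pos hm, mul_assoc, ← Finset.mul_sum, Finset.sum_mul]
    congr 1
    rw [Finset.sum_comm]
    refine Finset.sum_congr rfl fun i _ => ?_
    rw [Finset.sum_comm]
    refine Finset.sum_congr rfl fun j _ => ?_
    split_ifs with h
    · exact pairEntry_form h.1 a x
    · simp
  · simp [dickePart, hm]

/-- If the outcomes on `R` are all equal, then so are the remaining bits of a string of weight `n`,
and every pair outside of `R` contributes `a x ^ 2`. -/
theorem sum_sliceTerm_of_constant {n : ℕ} (hN : Fintype.card ι = 2 * n) {R : Finset ι}
    (hR : R.card = n) {x : ι → Bool} (hx : weight x = n) {b : Bool} (hb : ∀ i ∈ R, x i = b)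
    (a : (ι → Bool) → ℝ) :
    ∑ i, ∑ j, (if i ≠ j ∧ i ∉ R ∧ j ∉ R then sliceTerm n a i j x else 0) =
      (n : ℝ) * (n - 1) * a x ^ 2 := by
  have hcount : bitCount b x = n := by
    cases b
    · rw [bitCount_false]; omega
    · rw [bitCount_true]; exact hx
  have hRe : R = Finset.univ.filter fun i => x i = b :=
    Finset.eq_of_subset_of_card_le (fun i hi => by simp [hb i hi]) (by
      rw [hR]; exact hcount.le)
  have hout : ∀ i, i ∉ R → x i = !b := by
    intro i hi
    rw [hRe] at hi
    simp only [Finset.mem_filter, Finset.mem_univ, true_and] at hi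
    revert hi
    cases x i <;> cases b <;> simp
  have h1 : ∀ i j, (if i ≠ j ∧ i ∉ R ∧ j ∉ R then sliceTerm n a i j x else 0) =
      (if i ≠ j ∧ i ∉ R ∧ j ∉ R then 1 else 0) * a x ^ 2 := by
    intro i j
    split_ifs with h
    · rw [sliceTerm, if_pos hx, if_neg (by rw [hout i h.2.1, hout j h.2.2]; simp), one_mul]
    · rw [zero_mul]
  have hc : (Finset.univ.filter fun i => i ∉ R).card = n := by
    rw [← Finset.compl_filter, Finset.card_compl, hN, Finset.filter_univ_mem, hR]; omega
  simp only [h1, ← Finset.sum_mul]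
  rw [sum_ne_indicator fun i => i ∉ R, hc]

/-- Summing the slice part over `R`: the sets on which the outcomes are all equal have to be taken
out, since no Dicke test is performed there. -/
theorem sum_slice_mixed {n : ℕ} (hn : 0 < n) (hN : Fintype.card ι = 2 * n)
    (a : (ι → Bool) → ℝ) (x : ι → Bool) :
    ∑ R ∈ Finset.powersetCard n (Finset.univ : Finset ι),
      ∑ i, ∑ j, (if i ≠ j ∧ i ∉ R ∧ j ∉ R then
        (if (∃ i ∈ R, x i = true) ∧ (∃ i ∈ R, x i = false) then
          sliceTerm n a i j x else 0) else 0) =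
      ((2 * n - 2).choose n : ℝ) * (∑ i, ∑ j, if i ≠ j then sliceTerm n a i j x else 0) -
        2 * ((n : ℝ) * (n - 1)) * if weight x = n then a x ^ 2 else 0 := by
  by_cases hx : weight x = n
  · have key : ∀ R ∈ Finset.powersetCard n (Finset.univ : Finset ι),
        ∑ i, ∑ j, (if i ≠ j ∧ i ∉ R ∧ j ∉ R then
          (if (∃ i ∈ R, x i = true) ∧ (∃ i ∈ R, x i = false) then
            sliceTerm n a i j x else 0) else 0) =
        ∑ i, ∑ j, (if i ≠ j ∧ i ∉ R ∧ j ∉ R then sliceTerm n a i j x else 0) -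
          ((if ∀ i ∈ R, x i = true then (n : ℝ) * (n - 1) * a x ^ 2 else 0) +
            if ∀ i ∈ R, x i = false then (n : ℝ) * (n - 1) * a x ^ 2 else 0) := by
      intro R hR
      have hR' := (Finset.mem_powersetCard.1 hR).2
      obtain ⟨m, hm⟩ := Finset.card_pos.1 (hR'.symm ▸ hn)
      by_cases h1 : ∀ i ∈ R, x i = true
      · have h0 : ¬ ∀ i ∈ R, x i = false := fun h => by
          have := h m hm; rw [h1 m hm] at this; exact absurd this (by simp)
        have hmix : ¬ ((∃ i ∈ R, x i = true) ∧ (∃ i ∈ R, x i = false)) := by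
          rintro ⟨-, i, hi, hxi⟩; rw [h1 i hi] at hxi; exact absurd hxi (by simp)
        rw [sum_sliceTerm_of_constant hN hR' hx h1, if_pos h1, if_neg h0]
        simp [hmix]
      · by_cases h0 : ∀ i ∈ R, x i = false
        · have hmix : ¬ ((∃ i ∈ R, x i = true) ∧ (∃ i ∈ R, x i = false)) := by
            rintro ⟨⟨i, hi, hxi⟩, -⟩; rw [h0 i hi] at hxi; exact absurd hxi (by simp)
          rw [sum_sliceTerm_of_constant hN hR' hx h0, if_neg h1, if_pos h0]
          simp [hmix]
        · have hmix : (∃ i ∈ R, x i = true) ∧ (∃ i ∈ R, x i = false) := by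
            push Not at h0 h1
            simpa using And.intro h0 h1
          rw [if_neg h1, if_neg h0, add_zero, sub_zero]
          simp only [if_pos hmix]
    have hcount : ∀ b, bitCount b x = n := by
      intro b
      cases b
      · rw [bitCount_false]; omega
      · rw [bitCount_true]; exact hx
    rw [Finset.sum_congr rfl key, Finset.sum_sub_distrib, Finset.sum_add_distrib,
      sum_powersetCard_pairs, hN, ← Finset.sum_filter, ← Finset.sum_filter, Finset.sum_const,
      Finset.sum_const, card_powersetCard_constant, card_powersetCard_constant, hcount, hcount,
      Nat.choose_self, if_pos hx]
    simp only [one_smul]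
    ring
  · simp [sliceTerm, hx]

/-- The exchange form of the restriction of `a` to the slice of weight `n`. -/
def exchangeForm (n : ℕ) (a : (ι → Bool) → ℝ) : ℝ :=
  ∑ i, ∑ j, ∑ x : ι → Bool, if x i ≠ x j then
    (if weight x = n then a x else 0) * (if weight (flipAt i (flipAt j x)) = n then
      a (flipAt i (flipAt j x)) else 0) else 0

theorem weight_flip_pair {i j : ι} {x : ι → Bool} (h : x i ≠ x j) :
    weight (flipAt i (flipAt j x)) = weight x := by
  have hij : i ≠ j := fun e => h (by rw [e])
  rw [weight_eq_weightOff_add hij, weight_eq_weightOff_add hij x,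
    weightOff_congr (y := x) fun m hi hj => by rw [flipAt_of_ne hi, flipAt_of_ne hj],
    flipAt_same, flipAt_of_ne hij, flipAt_of_ne hij.symm, flipAt_same]
  revert h
  cases x i <;> cases x j <;> simp

theorem sum_sliceTerm {n : ℕ} (hN : Fintype.card ι = 2 * n) (a : (ι → Bool) → ℝ) :
    ∑ x, ∑ i, ∑ j, (if i ≠ j then sliceTerm n a i j x else 0) =
      (3 * (n : ℝ) ^ 2 - 2 * n) * ∑ x, (if weight x = n then a x ^ 2 else 0) +
        1 / 2 * exchangeForm n a := by
  have hX : exchangeForm n a = ∑ x : ι → Bool, ∑ i, ∑ j, if x i ≠ x j then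
      (if weight x = n then a x * a (flipAt i (flipAt j x)) else 0) else 0 := by
    rw [exchangeForm, Finset.sum_congr rfl fun i _ => Finset.sum_comm, Finset.sum_comm]
    refine Finset.sum_congr rfl fun x _ => Finset.sum_congr rfl fun i _ =>
      Finset.sum_congr rfl fun j _ => ?_
    split_ifs with h1 h2 h3 h3
    · rfl
    · rw [weight_flip_pair h1] at h3; exact absurd h2 h3
    · simp
    · simp
    · rfl
  rw [hX, Finset.mul_sum, Finset.mul_sum, ← Finset.sum_add_distrib]
  refine Finset.sum_congr rfl fun x _ => ?_
  by_cases hx : weight x = n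
  · simp only [sliceTerm, if_pos hx]
    have h1 : ∀ i j, (if i ≠ j then (if x i ≠ x j then
        1 / 2 * (a x ^ 2 + a x * a (flipAt i (flipAt j x))) else a x ^ 2) else 0) =
        (if i ≠ j then (1 : ℝ) else 0) * a x ^ 2 - 1 / 2 * a x ^ 2 *
          (if x i ≠ x j then (1 : ℝ) else 0) +
          1 / 2 * if x i ≠ x j then a x * a (flipAt i (flipAt j x)) else 0 := by
      intro i j
      by_cases hij : i = j
      · subst hij; simp
      · by_cases he : x i = x j
        · simp [hij, he]
        · simp [hij, he]; ring
    simp only [h1, Finset.sum_add_distrib, Finset.sum_sub_distrib, ← Finset.mul_sum,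
      ← Finset.sum_mul]
    rw [sum_ne_one, sum_bit_ne, hN, hx]
    push_cast
    ring
  · simp [sliceTerm, hx]

/-- The part of the form of one round, summed over `R`, that couples the weights `n ± 1`. -/
noncomputable def crossForm (n : ℕ) (a : (ι → Bool) → ℝ) : ℝ :=
  ∑ R ∈ Finset.powersetCard n (Finset.univ : Finset ι), ∑ i, ∑ j, if i ≠ j ∧ i ∉ R ∧ j ∉ R then
    ∑ x, (if (∃ i ∈ R, x i = true) ∧ (∃ i ∈ R, x i = false) then crossTerm n a i j x else 0) else 0

theorem sum_dickePart_form {n : ℕ} (hn : 0 < n) (hN : Fintype.card ι = 2 * n)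
    (a : (ι → Bool) → ℝ) :
    ∑ R ∈ Finset.powersetCard n (Finset.univ : Finset ι),
      ∑ x, ∑ y, dickePart R n x y * (a x * a y) =
      1 / ((n : ℝ) * (n - 1)) * (((2 * n - 2).choose n : ℝ) *
        ((3 * (n : ℝ) ^ 2 - 2 * n) * ∑ x, (if weight x = n then a x ^ 2 else 0) +
          1 / 2 * exchangeForm n a) -
        2 * ((n : ℝ) * (n - 1)) * (∑ x, if weight x = n then a x ^ 2 else 0) + crossForm n a) := by
  simp only [dickePart_form]
  rw [← Finset.mul_sum]
  congr 1
  have h1 : ∀ (R : Finset ι) (x : ι → Bool), ∑ i, ∑ j, (if i ≠ j ∧ i ∉ R ∧ j ∉ R then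
        (if (∃ i ∈ R, x i = true) ∧ (∃ i ∈ R, x i = false) then
          sliceTerm n a i j x + crossTerm n a i j x else 0) else 0) =
      ∑ i, ∑ j, (if i ≠ j ∧ i ∉ R ∧ j ∉ R then
        (if (∃ i ∈ R, x i = true) ∧ (∃ i ∈ R, x i = false) then
          sliceTerm n a i j x else 0) else 0) +
      ∑ i, ∑ j, (if i ≠ j ∧ i ∉ R ∧ j ∉ R then
        (if (∃ i ∈ R, x i = true) ∧ (∃ i ∈ R, x i = false) then
          crossTerm n a i j x else 0) else 0) := by
    intro R x
    simp only [← Finset.sum_add_distrib]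
    refine Finset.sum_congr rfl fun i _ => Finset.sum_congr rfl fun j _ => ?_
    split_ifs <;> simp
  simp only [h1, Finset.sum_add_distrib]
  congr 1
  · rw [Finset.sum_comm]
    simp only [sum_slice_mixed hn hN]
    rw [Finset.sum_sub_distrib, ← Finset.mul_sum, ← Finset.mul_sum, sum_sliceTerm hN]
  · refine Finset.sum_congr rfl fun R _ => ?_
    rw [Finset.sum_comm]
    refine Finset.sum_congr rfl fun i _ => ?_
    rw [Finset.sum_comm]
    refine Finset.sum_congr rfl fun j _ => ?_
    split_ifs
    · rfl
    · simp

/-- By the inequality of arithmetic and geometric means, the coupling of `x` to the string with the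
pair inverted is bounded by the diagonal. -/
theorem sum_crossTerm_le (n : ℕ) (a : (ι → Bool) → ℝ) {R : Finset ι} {i j : ι} (hij : i ≠ j)
    (hi : i ∉ R) (hj : j ∉ R) :
    ∑ x, (if (∃ i ∈ R, x i = true) ∧ (∃ i ∈ R, x i = false) then crossTerm n a i j x else 0) ≤
      ∑ x, if weightOff i j x + 1 = n ∧ x i = x j then a x ^ 2 else 0 := by
  set p : (ι → Bool) → Prop := fun x => ((∃ i ∈ R, x i = true) ∧ (∃ i ∈ R, x i = false)) ∧
    weightOff i j x + 1 = n ∧ x i = x j with hp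
  have hinv : ∀ x, p (flipAt i (flipAt j x)) ↔ p x := by
    intro x
    have hR : ∀ m ∈ R, flipAt i (flipAt j x) m = x m := fun m hm => by
      rw [flipAt_of_ne (ne_of_mem_of_not_mem hm hi), flipAt_of_ne (ne_of_mem_of_not_mem hm hj)]
    have hex : ∀ b, (∃ m ∈ R, flipAt i (flipAt j x) m = b) ↔ ∃ m ∈ R, x m = b := fun b =>
      exists_congr fun m => and_congr_right fun hm => by rw [hR m hm]
    simp only [hp, hex]
    rw [weightOff_congr (y := x) fun m hi hj => by rw [flipAt_of_ne hi, flipAt_of_ne hj],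
      flipAt_same, flipAt_of_ne hij, flipAt_of_ne hij.symm, flipAt_same]
    simp
  classical
  have h1 : ∑ x, (if p x then a (flipAt i (flipAt j x)) ^ 2 else 0) =
      ∑ x, if p x then a x ^ 2 else 0 := by
    rw [← sum_flipAt i (fun x => if p x then a x ^ 2 else 0),
      ← sum_flipAt j (fun x => if p (flipAt i x) then a (flipAt i x) ^ 2 else 0)]
    exact Finset.sum_congr rfl fun x _ => if_congr (hinv x).symm rfl rfl
  calc ∑ x, (if (∃ i ∈ R, x i = true) ∧ (∃ i ∈ R, x i = false) then crossTerm n a i j x else 0)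
      ≤ ∑ x, (3 / 4 * (if p x then a x ^ 2 else 0) +
          1 / 4 * if p x then a (flipAt i (flipAt j x)) ^ 2 else 0) := by
        refine Finset.sum_le_sum fun x _ => ?_
        by_cases hm : (∃ i ∈ R, x i = true) ∧ (∃ i ∈ R, x i = false)
        · by_cases hc : weightOff i j x + 1 = n ∧ x i = x j
          · have : p x := ⟨hm, hc⟩
            rw [if_pos hm, crossTerm, if_pos hc, if_pos this, if_pos this]
            nlinarith [sq_nonneg (a x - a (flipAt i (flipAt j x)))]
          · have : ¬ p x := fun h => hc h.2
            rw [if_pos hm, crossTerm, if_neg hc, if_neg this, if_neg this]; simp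
        · have : ¬ p x := fun h => hm h.1
          rw [if_neg hm, if_neg this, if_neg this]; simp
    _ = ∑ x, if p x then a x ^ 2 else 0 := by
        rw [Finset.sum_add_distrib, ← Finset.mul_sum, ← Finset.mul_sum, h1]; ring
    _ ≤ _ := by
        refine Finset.sum_le_sum fun x _ => ?_
        by_cases h : p x
        · rw [if_pos h, if_pos h.2]
        · rw [if_neg h]; split_ifs <;> positivity

theorem crossForm_le {n : ℕ} (hN : Fintype.card ι = 2 * n) (a : (ι → Bool) → ℝ) :
    crossForm n a ≤ ((2 * n - 2).choose n : ℝ) *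
      ∑ x, (if weight x + 1 = n ∨ weight x = n + 1 then (n : ℝ) * (n + 1) else 0) * a x ^ 2 := by
  have h1 : crossForm n a ≤ ∑ R ∈ Finset.powersetCard n (Finset.univ : Finset ι), ∑ i, ∑ j,
      if i ≠ j ∧ i ∉ R ∧ j ∉ R then
        ∑ x, (if weightOff i j x + 1 = n ∧ x i = x j then a x ^ 2 else 0) else 0 := by
    refine Finset.sum_le_sum fun R _ => Finset.sum_le_sum fun i _ => Finset.sum_le_sum fun j _ => ?_
    split_ifs with h
    · exact sum_crossTerm_le n a h.1 h.2.1 h.2.2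
    · exact le_rfl
  refine h1.trans (le_of_eq ?_)
  rw [sum_powersetCard_pairs n fun i j =>
    ∑ x, (if weightOff i j x + 1 = n ∧ x i = x j then a x ^ 2 else 0), hN]
  congr 1
  simp only [← sum_equal_pairs n _ hN, Finset.sum_mul]
  rw [Finset.sum_comm (γ := ι → Bool)]
  refine Finset.sum_congr rfl fun i _ => ?_
  rw [Finset.sum_comm (γ := ι → Bool)]
  refine Finset.sum_congr rfl fun j _ => ?_
  by_cases hij : i = j
  · simp [hij]
  · simp [hij]

theorem crossForm_eq_zero (n : ℕ) (a : (ι → Bool) → ℝ)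
    (ha : ∀ x, weight x + 1 = n ∨ weight x = n + 1 → a x = 0) : crossForm n a = 0 := by
  refine Finset.sum_eq_zero fun R _ => Finset.sum_eq_zero fun i _ =>
    Finset.sum_eq_zero fun j _ => ?_
  split_ifs with h
  · refine Finset.sum_eq_zero fun x _ => ?_
    split_ifs
    · rw [crossTerm]
      split_ifs with hc
      · have hw := weight_eq_weightOff_add h.1 x
        rw [ha x]
        · ring
        · cases hi : x i <;> cases hj : x j <;> simp [hi, hj] at hw hc <;> omega
      · rfl
    · rfl
  · rfl

theorem exchangeForm_le {n : ℕ} (hn : 0 < n) (hN : Fintype.card ι = 2 * n)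
    (a : (ι → Bool) → ℝ) :
    exchangeForm n a ≤ 2 * (((n : ℝ) ^ 2 - 2 * n) * (∑ x, if weight x = n then a x ^ 2 else 0) +
      2 * n * (∑ x ∈ Finset.univ.filter (fun x : ι → Bool => weight x = n), a x) ^ 2 /
        (2 * n).choose n) := by
  obtain ⟨k, rfl⟩ : ∃ k, n = k + 1 := ⟨n - 1, by omega⟩
  have h := sum_exchange_le k (by omega) (fun x : ι → Bool => if weight x = k + 1 then a x else 0)
    fun x hx => if_neg hx
  simp only [ite_pow, zero_pow two_ne_zero] at h
  rw [hN] at h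
  rw [Finset.sum_filter]
  refine h.trans (le_of_eq ?_)
  push_cast
  ring

theorem exchangeForm_of_const {n : ℕ} (hN : Fintype.card ι = 2 * n) (a : (ι → Bool) → ℝ) (c : ℝ)
    (ha : ∀ x, weight x = n → a x = c) :
    exchangeForm n a = 2 * (n : ℝ) ^ 2 * ∑ x : ι → Bool, if weight x = n then a x ^ 2 else 0 := by
  rw [exchangeForm, Finset.sum_congr rfl fun i _ => Finset.sum_comm, Finset.sum_comm,
    Finset.mul_sum]
  refine Finset.sum_congr rfl fun x _ => ?_
  by_cases hx : weight x = n
  · have h1 : ∀ i j, (if x i ≠ x j then (if weight x = n then a x else 0) *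
        (if weight (flipAt i (flipAt j x)) = n then a (flipAt i (flipAt j x)) else 0) else 0) =
        (if x i ≠ x j then 1 else 0) * c ^ 2 := by
      intro i j
      split_ifs with h h2
      · rw [ha x hx, ha _ h2]; ring
      · rw [weight_flip_pair h] at h2; exact absurd hx h2
      · simp
    simp only [h1, ← Finset.sum_mul]
    rw [sum_bit_ne, hN, hx, if_pos rfl, ha x hx]
    push_cast; ring
  · simp [hx]

end Form

/-! ### Bounds for the coefficients of the quadratic form -/

theorem choose_sub_two_mul (n : ℕ) (hn : 2 ≤ n) :
    (((2 * n - 2).choose n : ℕ) : ℝ) * (2 * n * (2 * n - 1)) =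
      (2 * n).choose n * ((n : ℝ) * (n - 1)) := by
  obtain ⟨m, rfl⟩ : ∃ m, n = m + 2 := ⟨n - 2, by omega⟩
  have h1 := Nat.choose_mul_succ_eq (2 * m + 2) (m + 2)
  have h2 := Nat.choose_mul_succ_eq (2 * m + 3) (m + 2)
  rw [show 2 * m + 2 + 1 - (m + 2) = m + 1 by omega] at h1
  rw [show 2 * m + 3 + 1 - (m + 2) = m + 2 by omega] at h2
  have h1' : (((2 * m + 2).choose (m + 2) : ℕ) : ℝ) * (2 * m + 3) =
      (2 * m + 3).choose (m + 2) * (m + 1) := by exact_mod_cast h1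
  have h2' : (((2 * m + 3).choose (m + 2) : ℕ) : ℝ) * (2 * m + 4) =
      (2 * m + 4).choose (m + 2) * (m + 2) := by exact_mod_cast h2
  rw [show 2 * (m + 2) - 2 = 2 * m + 2 by omega, show 2 * (m + 2) = 2 * m + 4 by ring]
  push_cast
  linear_combination (2 * (m : ℝ) + 4) * h1' + ((m : ℝ) + 1) * h2'

theorem two_mul_choose_pred (n : ℕ) (hn : 1 ≤ n) :
    2 * (2 * n - 1).choose n = (2 * n).choose n := by
  obtain ⟨m, rfl⟩ : ∃ m, n = m + 1 := ⟨n - 1, by omega⟩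
  rw [show 2 * (m + 1) - 1 = 2 * m + 1 by omega, show 2 * (m + 1) = 2 * m + 1 + 1 by ring,
    Nat.choose_succ_succ (2 * m + 1) m, Nat.choose_symm_half, two_mul]

/-- The inequality that makes the strings of weight `n ± 1` harmless. -/
theorem mul_le_sub_two_mul_choose (n : ℕ) (hn : 3 ≤ n) :
    ((n : ℝ) + 1) * (2 * n - 1) ≤ (n - 2) * (2 * n).choose n := by
  rcases hn.eq_or_lt with rfl | h4
  · have : (2 * 3).choose 3 = 20 := by decide
    rw [this]; norm_num
  · have h : (2 * n).choose 2 ≤ (2 * n).choose n := by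
      have := Nat.choose_le_centralBinom 2 n
      rwa [Nat.centralBinom_eq_two_mul_choose] at this
    have h' : ((2 * n).choose 2 : ℝ) ≤ (2 * n).choose n := by exact_mod_cast h
    rw [Nat.cast_choose_two] at h'
    push_cast at h'
    have hn4 : (4 : ℝ) ≤ n := by exact_mod_cast h4
    have h5 : ((n : ℝ) - 2) * (n * (2 * n - 1)) ≤ (n - 2) * (2 * n).choose n :=
      mul_le_mul_of_nonneg_left (by linarith) (by linarith)
    refine le_trans ?_ h5
    have : ((n : ℝ) - 2) * (n * (2 * n - 1)) - (n + 1) * (2 * n - 1) =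
        (2 * n - 1) * (n * (n - 4) + (n - 1)) := by ring
    have h6 : 0 ≤ (2 * (n : ℝ) - 1) * (n * (n - 4) + (n - 1)) :=
      mul_nonneg (by linarith) (by nlinarith)
    linarith

section Coefficients

variable {ι : Type*} [Fintype ι] {n : ℕ} {μ₀ μ₁ : ℝ}

theorem ghzDiag_of_lt {b : Bool} {x : ι → Bool} (h : bitCount b x < n) :
    ghzDiag b n μ₀ μ₁ x = 0 := by
  rw [ghzDiag, Nat.choose_eq_zero_of_lt h]; simp

theorem ghzDiag_of_eq (hn : 0 < n) {b : Bool} {x : ι → Bool} (h : bitCount b x = n) :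
    ghzDiag b n μ₀ μ₁ x = μ₁ := by
  have : (n : ℝ) ≠ 0 := by exact_mod_cast hn.ne'
  rw [ghzDiag, h, Nat.choose_self]; field_simp; ring

theorem ghzDiag_of_eq_two_mul (hn : 0 < n) {b : Bool} {x : ι → Bool} (h : bitCount b x = 2 * n) :
    ghzDiag b n μ₀ μ₁ x = (2 * n).choose n * μ₀ := by
  have : (n : ℝ) ≠ 0 := by exact_mod_cast hn.ne'
  rw [ghzDiag, h]; push_cast; field_simp; ring

theorem ghzDiag_le_half (hn : 0 < n) (h₀ : 0 ≤ μ₀) (h₁ : 0 ≤ μ₁) (hs : μ₀ + μ₁ = 1) {b : Bool}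
    {x : ι → Bool} (h1 : n ≤ bitCount b x) (h2 : bitCount b x < 2 * n) :
    ghzDiag b n μ₀ μ₁ x ≤ (2 * n).choose n * (1 / 2) := by
  have hn' : (0 : ℝ) < n := by exact_mod_cast hn
  have h1' : (n : ℝ) ≤ bitCount b x := by exact_mod_cast h1
  have h2' : (bitCount b x : ℝ) ≤ 2 * n := by exact_mod_cast h2.le
  have hc : ((bitCount b x).choose n : ℝ) ≤ (2 * n).choose n * (1 / 2) := by
    have e : ((2 * n).choose n : ℝ) = 2 * (2 * n - 1).choose n := by
      exact_mod_cast (two_mul_choose_pred n hn).symm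
    have e2 : ((bitCount b x).choose n : ℝ) ≤ (2 * n - 1).choose n := by
      exact_mod_cast Nat.choose_le_choose n (by omega)
    rw [e]; linarith
  have hg : (((bitCount b x : ℝ) - n) * μ₀ + (2 * n - bitCount b x) * μ₁) / n ≤ 1 := by
    rw [div_le_one hn']
    nlinarith [mul_nonneg (sub_nonneg.2 h1') h₁, mul_nonneg (sub_nonneg.2 h2') h₀]
  have hg0 : 0 ≤ (((bitCount b x : ℝ) - n) * μ₀ + (2 * n - bitCount b x) * μ₁) / n :=
    div_nonneg (add_nonneg (mul_nonneg (by linarith) h₀) (mul_nonneg (by linarith) h₁)) hn'.le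
  rw [ghzDiag]
  calc _ ≤ ((2 * n).choose n * (1 / 2) : ℝ) * 1 :=
        mul_le_mul hc hg hg0 (by positivity)
    _ = _ := mul_one _

theorem ghzDiag_of_eq_succ_le (hn : 2 ≤ n) (h₀ : 1 / 2 ≤ μ₀) (hs : μ₀ + μ₁ = 1)
    {b : Bool} {x : ι → Bool} (h : bitCount b x = n + 1) :
    ghzDiag b n μ₀ μ₁ x ≤ (n + 1) / 2 := by
  have hn' : (2 : ℝ) ≤ n := by exact_mod_cast hn
  rw [ghzDiag, h, Nat.choose_succ_self_right]
  have hg : (((((n + 1 : ℕ) : ℝ) - n) * μ₀ + (2 * n - ((n + 1 : ℕ) : ℝ)) * μ₁) / n) ≤ 1 / 2 := by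
    rw [div_le_iff₀ (by linarith)]
    push_cast
    have : μ₁ = 1 - μ₀ := by linarith
    subst this
    nlinarith
  push_cast at hg ⊢
  nlinarith

/-- Value of the diagonal on the strings `0…0`, `1…1` and those of weight `n`, and a bound on the
other strings. -/
theorem diagonal_le (hn : 3 ≤ n) (hN : Fintype.card ι = 2 * n) (h₀ : 1 / 2 ≤ μ₀) (h₁ : 0 ≤ μ₁)
    (hs : μ₀ + μ₁ = 1) (x : ι → Bool) :
    1 / ((2 * n).choose n : ℝ) * (ghzDiag false n μ₀ μ₁ x + ghzDiag true n μ₀ μ₁ x) +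
      1 / (2 * n * (2 * n - 1)) *
        (if weight x + 1 = n ∨ weight x = n + 1 then (n : ℝ) * (n + 1) else 0) ≤
    ((if x = fun _ => false then μ₀ else 0) + (if x = fun _ => true then μ₀ else 0) +
      if weight x = n then 2 * μ₁ / (2 * n).choose n else 0) +
      1 / 2 * (1 - ((if x = fun _ => false then 1 else 0) + (if x = fun _ => true then 1 else 0) +
        if weight x = n then 1 else 0)) := by
  have hB : (0 : ℝ) < (2 * n).choose n := by exact_mod_cast Nat.choose_pos (by omega)
  have hn' : (3 : ℝ) ≤ n := by exact_mod_cast hn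
  have hle := weight_le_card x
  have hT := bitCount_true x
  have hF := bitCount_false x
  have e0 : (x = fun _ => false) ↔ weight x = 0 := (weight_eq_zero_iff x).symm
  have e1 : (x = fun _ => true) ↔ weight x = 2 * n := by rw [← hN, weight_eq_card_iff]
  simp only [e0, e1]
  have hmid : ∀ g : ℝ, g ≤ (n + 1) / 2 → 1 / ((2 * n).choose n : ℝ) * g +
      1 / (2 * n * (2 * n - 1)) * ((n : ℝ) * (n + 1)) ≤ 1 / 2 := by
    intro g hg
    have h1 : 1 / (2 * (n : ℝ) * (2 * n - 1)) * ((n : ℝ) * (n + 1)) =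
        (n + 1) / (2 * (2 * n - 1)) := by
      have : (2 * (n : ℝ) - 1) ≠ 0 := by linarith
      field_simp
    have h2 : 1 / ((2 * n).choose n : ℝ) * g ≤ (n - 2) / (2 * (2 * n - 1)) := by
      rw [one_div_mul_eq_div, div_le_div_iff₀ hB (by linarith)]
      have := mul_le_sub_two_mul_choose n hn
      nlinarith
    rw [h1]
    have h3 : ((n : ℝ) - 2) / (2 * (2 * n - 1)) + (n + 1) / (2 * (2 * n - 1)) = 1 / 2 := by
      have : 0 < 2 * (n : ℝ) - 1 := by linarith
      rw [← add_div, div_eq_div_iff (by linarith) two_ne_zero]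
      ring
    linarith
  have hhalf : ∀ g : ℝ, g ≤ (2 * n).choose n * (1 / 2) →
      1 / ((2 * n).choose n : ℝ) * g ≤ 1 / 2 := by
    intro g hg
    rw [one_div_mul_eq_div, div_le_iff₀ hB]; linarith
  rcases Nat.lt_trichotomy (weight x) n with hlt | heq | hgt
  · rw [ghzDiag_of_lt (b := true) (by omega)]
    have c1 : weight x ≠ 2 * n := by omega
    have c2 : weight x ≠ n := by omega
    have c3 : weight x ≠ n + 1 := by omega
    by_cases hz : weight x = 0
    · have c4 : weight x + 1 ≠ n := by omega
      rw [ghzDiag_of_eq_two_mul (b := false) (by omega) (by omega)]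
      simp [hz, show (0 : ℕ) ≠ n by omega, show ¬ (1 = n) by omega, show ¬ (n = 0) by omega]
      field_simp
      exact le_rfl
    · by_cases hm : weight x + 1 = n
      · have := hmid (ghzDiag false n μ₀ μ₁ x) (ghzDiag_of_eq_succ_le (by omega) h₀ hs (by omega))
        simpa [hz, hm, c1, c2] using this
      · have := hhalf (ghzDiag false n μ₀ μ₁ x) (ghzDiag_le_half (by omega) (by linarith) h₁ hs
          (by omega) (by omega))
        simpa [hz, hm, c1, c2, c3] using this
  · rw [ghzDiag_of_eq (b := true) (by omega) (by omega),
      ghzDiag_of_eq (b := false) (by omega) (by omega)]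
    simp [heq, show ¬ (n = 0) by omega, show ¬ (n = 2 * n) by omega]
    field_simp
    linarith
  · rw [ghzDiag_of_lt (b := false) (by omega)]
    have c1 : weight x ≠ 0 := by omega
    have c2 : weight x ≠ n := by omega
    have c3 : weight x + 1 ≠ n := by omega
    by_cases hz : weight x = 2 * n
    · rw [ghzDiag_of_eq_two_mul (b := true) (by omega) (by omega)]
      simp [hz, show ¬ (2 * n + 1 = n) by omega, show ¬ (2 * n = n + 1) by omega,
        show ¬ (n = 0) by omega]
      field_simp
      exact le_rfl
    · by_cases hm : weight x = n + 1
      · have := hmid (ghzDiag true n μ₀ μ₁ x) (ghzDiag_of_eq_succ_le (by omega) h₀ hs (by omega))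
        simpa [hm, show ¬ (n + 1 = 2 * n) by omega] using this
      · have := hhalf (ghzDiag true n μ₀ μ₁ x) (ghzDiag_le_half (by omega) (by linarith) h₁ hs
          (by omega) (by omega))
        simpa [hz, hm, c1, c2, c3] using this

theorem diagonal_eq (hn : 3 ≤ n) (hN : Fintype.card ι = 2 * n) (x : ι → Bool)
    (hx : weight x = 0 ∨ weight x = n ∨ weight x = 2 * n) :
    1 / ((2 * n).choose n : ℝ) * (ghzDiag false n μ₀ μ₁ x + ghzDiag true n μ₀ μ₁ x) =
    (if x = fun _ => false then μ₀ else 0) + (if x = fun _ => true then μ₀ else 0) +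
      if weight x = n then 2 * μ₁ / (2 * n).choose n else 0 := by
  have hB : (0 : ℝ) < (2 * n).choose n := by exact_mod_cast Nat.choose_pos (by omega)
  have hT := bitCount_true x
  have hF := bitCount_false x
  have e0 : (x = fun _ => false) ↔ weight x = 0 := (weight_eq_zero_iff x).symm
  have e1 : (x = fun _ => true) ↔ weight x = 2 * n := by rw [← hN, weight_eq_card_iff]
  simp only [e0, e1]
  rcases hx with h | h | h
  · rw [ghzDiag_of_lt (b := true) (by omega),
      ghzDiag_of_eq_two_mul (b := false) (by omega) (by omega)]
    simp [h, show ¬ (0 = n) by omega, show ¬ (n = 0) by omega]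
    field_simp
  · rw [ghzDiag_of_eq (b := true) (by omega) (by omega),
      ghzDiag_of_eq (b := false) (by omega) (by omega)]
    simp [h, show ¬ (n = 0) by omega, show ¬ (n = 2 * n) by omega]
    field_simp
    ring
  · rw [ghzDiag_of_lt (b := false) (by omega),
      ghzDiag_of_eq_two_mul (b := true) (by omega) (by omega)]
    simp [h, show ¬ (n = 0) by omega, show ¬ (2 * n = n) by omega]
    field_simp

end Coefficients

/-! ### The quadratic form of the strategy -/

section StrategyForm

variable {n : ℕ}

/-- The real matrix of the strategy. -/
noncomputable def realStrategy (n : ℕ) (μ₀ μ₁ : ℝ) (x y : Fin (2 * n) → Bool) : ℝ :=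
  1 / ((2 * n).choose n : ℝ) *
    ∑ R ∈ Finset.powersetCard n (Finset.univ : Finset (Fin (2 * n))),
      (ghzPart R false n μ₀ μ₁ x y + ghzPart R true n μ₀ μ₁ x y + dickePart R n x y)

/-- The sum of the values on the slice of weight `n`. -/
def sliceSum (n : ℕ) (a : (Fin (2 * n) → Bool) → ℝ) : ℝ :=
  ∑ x ∈ Finset.univ.filter (fun x : Fin (2 * n) → Bool => weight x = n), a x

/-- The sum of the squares on the slice of weight `n`. -/
def sliceSq (n : ℕ) (a : (Fin (2 * n) → Bool) → ℝ) : ℝ :=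
  ∑ x : Fin (2 * n) → Bool, if weight x = n then a x ^ 2 else 0

/-- The form of the strategy: the diagonal of the GHZ-like tests, their coupling of `0…0` and `1…1`
to the slice of weight `n`, and the Dicke tests within this slice and between the weights `n ± 1`. -/
theorem realStrategy_form (hn : 2 ≤ n) (μ₀ μ₁ : ℝ) (a : (Fin (2 * n) → Bool) → ℝ) :
    ∑ x, ∑ y, realStrategy n μ₀ μ₁ x y * (a x * a y) =
      ∑ x, 1 / ((2 * n).choose n : ℝ) * (ghzDiag false n μ₀ μ₁ x + ghzDiag true n μ₀ μ₁ x) *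
        a x ^ 2 +
      2 * (Real.sqrt μ₀ * Real.sqrt μ₁) / (2 * n).choose n *
        ((a (fun _ => false) + a fun _ => true) * sliceSum n a) +
      (1 / (2 * n * (2 * n - 1)) * ((3 * (n : ℝ) ^ 2 - 2 * n) * sliceSq n a +
        1 / 2 * exchangeForm n a) - 2 / (2 * n).choose n * sliceSq n a +
      1 / ((2 * n).choose n * ((n : ℝ) * (n - 1))) * crossForm n a) := by
  have hN : Fintype.card (Fin (2 * n)) = 2 * n := Fintype.card_fin _
  have hB : (0 : ℝ) < (2 * n).choose n := by exact_mod_cast Nat.choose_pos (by omega)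
  have hn' : (2 : ℝ) ≤ n := by exact_mod_cast hn
  have h1 : ∑ x, ∑ y, realStrategy n μ₀ μ₁ x y * (a x * a y) = 1 / ((2 * n).choose n : ℝ) *
      (∑ R ∈ Finset.powersetCard n (Finset.univ : Finset (Fin (2 * n))),
        ∑ x, ∑ y, ghzPart R false n μ₀ μ₁ x y * (a x * a y) +
      ∑ R ∈ Finset.powersetCard n (Finset.univ : Finset (Fin (2 * n))),
        ∑ x, ∑ y, ghzPart R true n μ₀ μ₁ x y * (a x * a y) +
      ∑ R ∈ Finset.powersetCard n (Finset.univ : Finset (Fin (2 * n))),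
        ∑ x, ∑ y, dickePart R n x y * (a x * a y)) := by
    simp only [← Finset.sum_add_distrib, ← add_mul]
    simp only [realStrategy, mul_assoc, Finset.sum_mul, ← Finset.mul_sum]
    congr 1
    symm
    rw [Finset.sum_comm]
    exact Finset.sum_congr rfl fun x _ => Finset.sum_comm
  have hc := choose_sub_two_mul n hn
  have hc' : ((2 * n - 2).choose n : ℝ) / ((2 * n).choose n * ((n : ℝ) * (n - 1))) =
      1 / (2 * n * (2 * n - 1)) := by
    rw [div_eq_div_iff (mul_pos hB (by nlinarith)).ne' (by nlinarith), hc]; ring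
  rw [h1, sum_ghzPart_form hN, sum_ghzPart_form hN, sum_dickePart_form (by omega) hN, ← hc']
  have hP : (n : ℝ) * (n - 1) ≠ 0 := by nlinarith
  have h2 : ∀ x : Fin (2 * n) → Bool, 1 / ((2 * n).choose n : ℝ) *
      (ghzDiag false n μ₀ μ₁ x + ghzDiag true n μ₀ μ₁ x) * a x ^ 2 =
      1 / ((2 * n).choose n : ℝ) * (ghzDiag false n μ₀ μ₁ x * a x ^ 2) +
      1 / ((2 * n).choose n : ℝ) * (ghzDiag true n μ₀ μ₁ x * a x ^ 2) := fun x => by ring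
  simp only [h2, Finset.sum_add_distrib, ← Finset.mul_sum]
  unfold sliceSum sliceSq
  set P := (n : ℝ) * (n - 1)
  field_simp
  ring

theorem sum_ghz_add_slice (a : (Fin (2 * n) → Bool) → ℝ) (c d e : ℝ) :
    ∑ x, ((if x = fun _ => false then c else 0) + (if x = fun _ => true then d else 0) +
      if weight x = n then e else 0) * a x ^ 2 =
      c * a (fun _ => false) ^ 2 + d * a (fun _ => true) ^ 2 + e * sliceSq n a := by
  simp only [add_mul, Finset.sum_add_distrib, ite_mul, zero_mul, Finset.sum_ite_eq',
    Finset.mem_univ, if_true, sliceSq, Finset.mul_sum, mul_ite, mul_zero]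

/-- Upper bound for the quadratic form by its part on the strings `0…0`, `1…1` and the slice of
weight `n`. -/
theorem realStrategy_form_le (hn : 3 ≤ n) {μ₀ μ₁ : ℝ} (h₀ : 1 / 2 ≤ μ₀) (h₁ : 0 ≤ μ₁)
    (hs : μ₀ + μ₁ = 1) (a : (Fin (2 * n) → Bool) → ℝ) :
    ∑ x, ∑ y, realStrategy n μ₀ μ₁ x y * (a x * a y) ≤
      μ₀ * (a (fun _ => false) ^ 2 + a (fun _ => true) ^ 2) +
      2 * (Real.sqrt μ₀ * Real.sqrt μ₁) / (2 * n).choose n *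
        ((a (fun _ => false) + a fun _ => true) * sliceSum n a) +
      (1 - 1 / (2 * n - 1) - 2 * μ₀ / (2 * n).choose n) * sliceSq n a +
      1 / (2 * n - 1) * (sliceSum n a ^ 2 / (2 * n).choose n) +
      1 / 2 * (∑ x, a x ^ 2 - a (fun _ => false) ^ 2 - a (fun _ => true) ^ 2 - sliceSq n a) := by
  have hN : Fintype.card (Fin (2 * n)) = 2 * n := Fintype.card_fin _
  have hB : (0 : ℝ) < (2 * n).choose n := by exact_mod_cast Nat.choose_pos (by omega)
  have hn' : (3 : ℝ) ≤ n := by exact_mod_cast hn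
  have hP : 0 < (n : ℝ) * (n - 1) := by nlinarith
  have hQ : 0 < 2 * (n : ℝ) * (2 * n - 1) := by nlinarith
  rw [realStrategy_form (by omega)]
  have hX := exchangeForm_le (by omega) hN a
  change _ ≤ 2 * (((n : ℝ) ^ 2 - 2 * n) * sliceSq n a + 2 * n * sliceSum n a ^ 2 / _) at hX
  have hC := crossForm_le hN a
  have hc := choose_sub_two_mul n (by omega)
  have hc' : 1 / ((2 * n).choose n * ((n : ℝ) * (n - 1))) * ((2 * n - 2).choose n : ℝ) =
      1 / (2 * n * (2 * n - 1)) := by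
    rw [one_div_mul_eq_div, div_eq_div_iff (mul_pos hB hP).ne' hQ.ne', hc]; ring
  have hC' : 1 / ((2 * n).choose n * ((n : ℝ) * (n - 1))) * crossForm n a ≤
      1 / (2 * n * (2 * n - 1)) * ∑ x : Fin (2 * n) → Bool,
        (if weight x + 1 = n ∨ weight x = n + 1 then (n : ℝ) * (n + 1) else 0) * a x ^ 2 := by
    rw [← hc', mul_assoc]
    exact mul_le_mul_of_nonneg_left hC (by positivity)
  have hdiag : ∑ x, 1 / ((2 * n).choose n : ℝ) *
      (ghzDiag false n μ₀ μ₁ x + ghzDiag true n μ₀ μ₁ x) * a x ^ 2 +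
      1 / (2 * n * (2 * n - 1)) * ∑ x : Fin (2 * n) → Bool,
        (if weight x + 1 = n ∨ weight x = n + 1 then (n : ℝ) * (n + 1) else 0) * a x ^ 2 ≤
      (μ₀ * a (fun _ => false) ^ 2 + μ₀ * a (fun _ => true) ^ 2 +
        2 * μ₁ / (2 * n).choose n * sliceSq n a) +
      1 / 2 * (∑ x, a x ^ 2 - (1 * a (fun _ => false) ^ 2 + 1 * a (fun _ => true) ^ 2 +
        1 * sliceSq n a)) := by
    rw [← sum_ghz_add_slice, ← sum_ghz_add_slice, Finset.mul_sum, ← Finset.sum_add_distrib,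
      ← Finset.sum_sub_distrib, Finset.mul_sum, ← Finset.sum_add_distrib]
    refine Finset.sum_le_sum fun x _ => ?_
    have h := mul_le_mul_of_nonneg_right (diagonal_le hn hN h₀ h₁ hs x) (sq_nonneg (a x))
    linarith
  have hX' : 1 / (2 * n * (2 * n - 1)) * ((3 * (n : ℝ) ^ 2 - 2 * n) * sliceSq n a +
      1 / 2 * exchangeForm n a) ≤ (1 - 1 / (2 * n - 1)) * sliceSq n a +
        1 / (2 * n - 1) * (sliceSum n a ^ 2 / (2 * n).choose n) := by
    have e : (1 - 1 / (2 * (n : ℝ) - 1)) * sliceSq n a +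
        1 / (2 * n - 1) * (sliceSum n a ^ 2 / (2 * n).choose n) =
        1 / (2 * n * (2 * n - 1)) * ((3 * (n : ℝ) ^ 2 - 2 * n) * sliceSq n a + 1 / 2 *
        (2 * (((n : ℝ) ^ 2 - 2 * n) * sliceSq n a +
          2 * n * sliceSum n a ^ 2 / (2 * n).choose n))) := by
      have h1 : 2 * (n : ℝ) - 1 ≠ 0 := by linarith
      field_simp
      ring
    rw [e]
    refine mul_le_mul_of_nonneg_left ?_ (by positivity)
    linarith
  have e2 : 2 * μ₁ / ((2 * n).choose n : ℝ) * sliceSq n a =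
      2 / (2 * n).choose n * sliceSq n a - 2 * μ₀ / (2 * n).choose n * sliceSq n a := by
    rw [show μ₁ = 1 - μ₀ by linarith]; ring
  linarith

/-- The form on a vector supported on `0…0`, `1…1` and the slice of weight `n`, constant on the
slice. -/
theorem realStrategy_form_eq (hn : 3 ≤ n) {μ₀ μ₁ : ℝ} (hs : μ₀ + μ₁ = 1)
    (a : (Fin (2 * n) → Bool) → ℝ) (c : ℝ) (hc : ∀ x, weight x = n → a x = c)
    (ha : ∀ x, weight x ≠ 0 → weight x ≠ n → weight x ≠ 2 * n → a x = 0) :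
    ∑ x, ∑ y, realStrategy n μ₀ μ₁ x y * (a x * a y) =
      μ₀ * (a (fun _ => false) ^ 2 + a (fun _ => true) ^ 2) +
      2 * (Real.sqrt μ₀ * Real.sqrt μ₁) / (2 * n).choose n *
        ((a (fun _ => false) + a fun _ => true) * sliceSum n a) +
      (1 - 2 * μ₀ / (2 * n).choose n) * sliceSq n a := by
  have hN : Fintype.card (Fin (2 * n)) = 2 * n := Fintype.card_fin _
  have hn' : (3 : ℝ) ≤ n := by exact_mod_cast hn
  rw [realStrategy_form (by omega), exchangeForm_of_const hN a c hc,
    crossForm_eq_zero n a fun x hx => ha x (by omega) (by omega) (by omega), ← sliceSq]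
  have hdiag : ∑ x, 1 / ((2 * n).choose n : ℝ) *
      (ghzDiag false n μ₀ μ₁ x + ghzDiag true n μ₀ μ₁ x) * a x ^ 2 =
      μ₀ * a (fun _ => false) ^ 2 + μ₀ * a (fun _ => true) ^ 2 +
        2 * μ₁ / (2 * n).choose n * sliceSq n a := by
    rw [← sum_ghz_add_slice]
    refine Finset.sum_congr rfl fun x _ => ?_
    by_cases hx : weight x = 0 ∨ weight x = n ∨ weight x = 2 * n
    · rw [diagonal_eq hn hN x hx]
    · push Not at hx
      rw [ha x hx.1 hx.2.1 hx.2.2]; ring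
  have e1 : 1 / (2 * n * (2 * n - 1)) * ((3 * (n : ℝ) ^ 2 - 2 * n) * sliceSq n a +
      1 / 2 * (2 * (n : ℝ) ^ 2 * sliceSq n a)) = sliceSq n a := by
    have h1 : 2 * (n : ℝ) - 1 ≠ 0 := by linarith
    field_simp
    ring
  rw [hdiag, e1, show μ₁ = 1 - μ₀ by linarith]
  ring

end StrategyForm

/-! ### Positivity of the strategy -/

theorem posSemidef_proj {β : Type*} [Fintype β] (v : β → ℂ) : (proj v).PosSemidef :=
  Matrix.posSemidef_vecMulVec_self_star v

/-- A tensor product of rank-one projectors is the projector onto the product vector. -/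
theorem posSemidef_tensor {κ : Type*} [DecidableEq κ] [Fintype κ] (A : κ → Matrix Bool Bool ℂ)
    (h : ∀ i, ∃ v, A i = proj v) : (tensor A).PosSemidef := by
  choose v hv using h
  have : tensor A = proj fun x : κ → Bool => ∏ i, v i (x i) := by
    ext x y
    simp [tensor, hv, proj, Matrix.vecMulVec_apply, Finset.prod_mul_distrib]
  rw [this]
  exact posSemidef_proj _

theorem posSemidef_tensorSplit {κ : Type*} [Fintype κ] [DecidableEq κ] (R : Finset κ)
    {A : Op {i // i ∈ R}} {B : Op {i // i ∉ R}} (hA : A.PosSemidef) (hB : B.PosSemidef) :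
    (tensorSplit R A B).PosSemidef :=
  (hA.kronecker hB).submatrix fun x : κ → Bool => (fun i => x i.1, fun i => x i.1)

theorem posSemidef_smul {β : Type*} [Fintype β] {A : Matrix β β ℂ} (hA : A.PosSemidef) {c : ℝ}
    (hc : 0 ≤ c) : (((c : ℝ) : ℂ) • A).PosSemidef :=
  hA.smul (by exact_mod_cast hc)

theorem posSemidef_ghzLikeStrategy (κ : Type*) [DecidableEq κ] [Fintype κ] (μ₀ μ₁ : ℝ) :
    (ghzLikeStrategy κ 0 μ₀ μ₁).PosSemidef := by
  unfold ghzLikeStrategy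
  refine (posSemidef_smul (Matrix.posSemidef_sum _ fun b _ => posSemidef_tensor _ fun i =>
    ⟨_, rfl⟩) le_rfl).add (posSemidef_smul (posSemidef_smul (Matrix.posSemidef_sum _ fun k _ =>
      posSemidef_smul (Matrix.posSemidef_sum _ fun r _ => Matrix.posSemidef_sum _ fun o _ =>
        posSemidef_tensor _ fun i => ?_) (by positivity)) (by positivity)) (by norm_num))
  split_ifs
  · exact ⟨_, rfl⟩
  · exact ⟨_, rfl⟩

theorem posSemidef_dickeStrategy (κ : Type*) [LinearOrder κ] [Fintype κ] (k : ℕ) :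
    (dickeStrategy κ k).PosSemidef := by
  unfold dickeStrategy
  refine posSemidef_smul (Matrix.posSemidef_sum _ fun e _ => Matrix.posSemidef_sum _ fun o _ =>
    posSemidef_tensor _ fun i => ?_) (by positivity)
  split_ifs
  · exact ⟨_, rfl⟩
  · exact ⟨_, rfl⟩

theorem isHermitian_tensor_pauliX (κ : Type*) [Fintype κ] :
    (tensor fun _ : κ => pauliX).IsHermitian := by
  ext x y
  simp only [tensor, pauliX, Matrix.conjTranspose_apply, Matrix.of_apply, star_prod]
  refine Finset.prod_congr rfl fun i _ => ?_
  rcases eq_or_ne (x i) (y i) with h | h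
  · simp [h]
  · simp [h, h.symm]

theorem posSemidef_subStrategy (κ : Type*) [LinearOrder κ] [Fintype κ] (n : ℕ) (μ₀ μ₁ : ℝ)
    (l : ℕ) : (subStrategy κ n 0 μ₀ μ₁ l).PosSemidef := by
  unfold subStrategy
  split_ifs
  · exact posSemidef_ghzLikeStrategy κ μ₀ μ₁
  · have h := (posSemidef_ghzLikeStrategy κ μ₀ μ₁).mul_mul_conjTranspose_same
      (tensor fun _ : κ => pauliX)
    rwa [(isHermitian_tensor_pauliX κ).eq] at h
  · exact posSemidef_dickeStrategy κ (n - l)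

theorem posSemidef_strategy (n : ℕ) (q₀ q₁ : ℝ) : (strategy n 0 q₀ q₁).PosSemidef :=
  posSemidef_smul (Matrix.posSemidef_sum _ fun R _ => Matrix.posSemidef_sum _ fun o _ =>
    posSemidef_tensorSplit R (posSemidef_tensor _ fun _ => ⟨_, rfl⟩)
      (posSemidef_subStrategy _ n _ _ _)) (by positivity)

/-! ### Spectral gap and traces of positive operators -/

open scoped MatrixOrder in
theorem trace_mul_nonneg {β : Type*} [Fintype β] {A ρ : Matrix β β ℂ} (hA : A.PosSemidef)
    (hρ : ρ.PosSemidef) : 0 ≤ (A * ρ).trace.re := by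
  classical
  obtain ⟨C, rfl⟩ := CStarAlgebra.nonneg_iff_eq_star_mul_self.mp hρ.nonneg
  rw [Matrix.star_eq_conjTranspose]
  rw [← Matrix.mul_assoc, Matrix.trace_mul_comm, ← Matrix.mul_assoc]
  exact (Complex.le_def.mp (hA.mul_mul_conjTranspose_same C).trace_nonneg).1

theorem trace_proj_mul {β : Type*} [Fintype β] (u : β → ℂ) (ρ : Matrix β β ℂ) :
    (proj u * ρ).trace = star u ⬝ᵥ (ρ *ᵥ u) := by
  rw [Matrix.trace_mul_comm, proj, Matrix.mul_vecMulVec, Matrix.trace_vecMulVec, dotProduct_comm]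

open Classical in
/-- If `A ≤ b + (1 - b) |u⟩⟨u|` and `⟨u|A|u⟩ = 1`, then `u` is an eigenvector of eigenvalue `1` and
all other eigenvalues are at most `b`. -/
theorem le_spectralGap {β : Type*} [Fintype β] (hc : 2 ≤ Fintype.card β) {A : Matrix β β ℂ}
    (hA : A.IsHermitian) {u : β → ℂ} (hu : star u ⬝ᵥ u = 1) (hAu : star u ⬝ᵥ (A *ᵥ u) = 1) {b : ℝ}
    (hM : (((b : ℝ) : ℂ) • (1 : Matrix β β ℂ) + ((1 - b : ℝ) : ℂ) • proj u - A).PosSemidef) :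
    1 - b ≤ spectralGap A := by
  have hpu (v : β → ℂ) : proj u *ᵥ v = (star u ⬝ᵥ v) • u := by
    rw [proj, Matrix.vecMulVec_mulVec]; simp
  have hfix : A *ᵥ u = u := by
    have h : star u ⬝ᵥ ((((b : ℝ) : ℂ) • (1 : Matrix β β ℂ) +
        ((1 - b : ℝ) : ℂ) • proj u - A) *ᵥ u) = 0 := by
      rw [Matrix.sub_mulVec, Matrix.add_mulVec, Matrix.smul_mulVec, Matrix.smul_mulVec, hpu]
      simp [hu, hAu, dotProduct_sub, dotProduct_add]
    have h' := (hM.dotProduct_mulVec_zero_iff u).mp h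
    rw [Matrix.sub_mulVec, Matrix.add_mulVec, Matrix.smul_mulVec, Matrix.smul_mulVec, hpu, hu,
      sub_eq_zero] at h'
    rw [← h', Matrix.one_mulVec, one_smul, ← add_smul]
    simp
  have hu0 : u ≠ 0 := by rintro rfl; simp at hu
  have hfirst : 1 ≤ hA.eigenvalues₀ ⟨0, by omega⟩ := by
    have hmem : (1 : ℝ) ∈ Set.range hA.eigenvalues := by
      rw [← hA.spectrum_real_eq_range_eigenvalues]
      rw [spectrum.mem_iff]
      intro hun
      rw [← Matrix.mulVec_injective_iff_isUnit] at hun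
      refine hu0 (hun ?_)
      simp [Matrix.sub_mulVec, hfix]
    obtain ⟨i, hi⟩ := hmem
    rw [← hi]
    exact hA.eigenvalues₀_antitone (Fin.mk_le_mk.mpr (Nat.zero_le _))
  have hsecond : hA.eigenvalues₀ ⟨1, by omega⟩ ≤ b := by
    set σ := Fintype.equivOfCardEq (Fintype.card_fin (Fintype.card β)) with hσ
    set i := σ ⟨0, by omega⟩ with hi
    set j := σ ⟨1, by omega⟩ with hj
    have hij : i ≠ j := fun h => by simpa using σ.injective h
    have hei : hA.eigenvalues i = hA.eigenvalues₀ ⟨0, by omega⟩ := by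
      simp [Matrix.IsHermitian.eigenvalues, hi, hσ]
    have hej : hA.eigenvalues j = hA.eigenvalues₀ ⟨1, by omega⟩ := by
      simp [Matrix.IsHermitian.eigenvalues, hj, hσ]
    have hle : hA.eigenvalues j ≤ hA.eigenvalues i := by
      rw [hei, hej]
      exact hA.eigenvalues₀_antitone (Fin.mk_le_mk.mpr (Nat.zero_le _))
    rw [← hej]
    have horth (k l : β) : star (⇑(hA.eigenvectorBasis k) : β → ℂ) ⬝ᵥ ⇑(hA.eigenvectorBasis l) =
        if k = l then 1 else 0 := by
      rw [← orthonormal_iff_ite.mp hA.eigenvectorBasis.orthonormal k l,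
        EuclideanSpace.inner_eq_star_dotProduct, dotProduct_comm]
    have hAi := hA.mulVec_eigenvectorBasis i
    have hAj := hA.mulVec_eigenvectorBasis j
    have hii := horth i i
    have hjj := horth j j
    have hij' := horth i j
    have hji' := horth j i
    rw [if_pos rfl] at hii hjj
    rw [if_neg hij] at hij'
    rw [if_neg hij.symm] at hji'
    set f : β → ℂ := ⇑(hA.eigenvectorBasis i)
    set g : β → ℂ := ⇑(hA.eigenvectorBasis j)
    -- Two eigenvectors span a nonzero vector orthogonal to `u`.
    obtain ⟨s, t, hst, hperp⟩ : ∃ s t : ℂ, 0 < Complex.normSq s + Complex.normSq t ∧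
        s * (star u ⬝ᵥ f) + t * (star u ⬝ᵥ g) = 0 := by
      by_cases h : star u ⬝ᵥ g = 0
      · exact ⟨0, 1, by simp, by simp [h]⟩
      · exact ⟨star u ⬝ᵥ g, -(star u ⬝ᵥ f),
          add_pos_of_pos_of_nonneg (Complex.normSq_pos.mpr h) (Complex.normSq_nonneg _), by ring⟩
    have h := (Complex.le_def.mp (hM.dotProduct_mulVec_nonneg (s • f + t • g))).1
    rw [Matrix.sub_mulVec, Matrix.add_mulVec, Matrix.smul_mulVec, Matrix.smul_mulVec, hpu,
      dotProduct_add, dotProduct_smul, dotProduct_smul, smul_eq_mul, smul_eq_mul, hperp,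
      Matrix.one_mulVec, Matrix.mulVec_add, Matrix.mulVec_smul, Matrix.mulVec_smul, hAi, hAj] at h
    have hs : star s * s = (Complex.normSq s : ℂ) := Complex.normSq_eq_conj_mul_self.symm
    have ht : star t * t = (Complex.normSq t : ℂ) := Complex.normSq_eq_conj_mul_self.symm
    have key : star (s • f + t • g) ⬝ᵥ (((b : ℝ) : ℂ) • (s • f + t • g) +
        ((1 - b : ℝ) : ℂ) • (0 : ℂ) • u -
          (s • hA.eigenvalues i • f + t • hA.eigenvalues j • g)) =
        ((b * (Complex.normSq s + Complex.normSq t) - (hA.eigenvalues i * Complex.normSq s +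
          hA.eigenvalues j * Complex.normSq t) : ℝ) : ℂ) := by
      simp only [zero_smul, smul_zero, add_zero, star_add, star_smul,
        dotProduct_sub, dotProduct_add, dotProduct_smul, add_dotProduct, smul_dotProduct,
        hii, hjj, hij', hji', Complex.real_smul, smul_eq_mul]
      push_cast
      rw [← hs, ← ht]
      ring
    rw [key] at h
    have h' : 0 ≤ b * (Complex.normSq s + Complex.normSq t) - (hA.eigenvalues i * Complex.normSq s +
          hA.eigenvalues j * Complex.normSq t) := by simpa using h
    have h'' : hA.eigenvalues j * Complex.normSq s ≤ hA.eigenvalues i * Complex.normSq s :=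
      mul_le_mul_of_nonneg_right hle (Complex.normSq_nonneg _)
    refine le_of_mul_le_mul_right ?_ hst
    linarith
  unfold spectralGap
  rw [dif_pos ⟨hA, hc⟩]
  linarith

/-! ### The parameters of the protocol -/

section Parameters

variable {n : ℕ} {q₀ q₁ : ℝ}

theorem choose_pos (n : ℕ) : (0 : ℝ) < (2 * n).choose n := by
  exact_mod_cast Nat.choose_pos (by omega)

theorem lam_denominator_pos (n : ℕ) (h₀ : 0 < q₀) (h₁ : 0 < q₁) :
    0 < ((2 * n).choose n : ℝ) * q₀ + 2 * q₁ := by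
  have := choose_pos n
  positivity

theorem lam₀_pos (n : ℕ) (h₀ : 0 < q₀) (h₁ : 0 < q₁) : 0 < lam₀ n q₀ q₁ :=
  div_pos (mul_pos (choose_pos n) h₀) (lam_denominator_pos n h₀ h₁)

theorem lam₁_pos (n : ℕ) (h₀ : 0 < q₀) (h₁ : 0 < q₁) : 0 < lam₁ n q₀ q₁ :=
  div_pos (by linarith) (lam_denominator_pos n h₀ h₁)

theorem lam_add (n : ℕ) (h₀ : 0 < q₀) (h₁ : 0 < q₁) : lam₀ n q₀ q₁ + lam₁ n q₀ q₁ = 1 := by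
  have := (lam_denominator_pos n h₀ h₁).ne'
  rw [lam₀, lam₁, ← add_div, div_self this]

theorem half_le_lam₀ (h₀ : 0 < q₀) (h₁ : 0 < q₁) (hq : q₀ + q₁ = 1)
    (h : 2 / (((2 * n).choose n : ℝ) + 2) ≤ q₀) : 1 / 2 ≤ lam₀ n q₀ q₁ := by
  have hB := choose_pos n
  rw [div_le_iff₀ (by linarith)] at h
  rw [lam₀, div_le_div_iff₀ two_pos (lam_denominator_pos n h₀ h₁)]
  nlinarith

theorem sqrt_lam_mul (h₀ : 0 < q₀) (h₁ : 0 < q₁) :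
    Real.sqrt (lam₀ n q₀ q₁) * Real.sqrt (lam₁ n q₀ q₁) =
      Real.sqrt ((2 * n).choose n) * Real.sqrt 2 * Real.sqrt q₀ * Real.sqrt q₁ /
        (((2 * n).choose n : ℝ) * q₀ + 2 * q₁) := by
  have hB := choose_pos n
  have hD := lam_denominator_pos n h₀ h₁
  rw [lam₀, lam₁, Real.sqrt_div (by positivity), Real.sqrt_div (by positivity),
    Real.sqrt_mul hB.le, Real.sqrt_mul two_pos.le, div_mul_div_comm, Real.mul_self_sqrt hD.le]
  ring

end Parameters

/-! ### The target state -/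

section Target

variable {n : ℕ} {q₀ q₁ : ℝ}

/-- The amplitudes of the target state, which are real. -/
noncomputable def targetAmp (n : ℕ) (q₀ q₁ : ℝ) (x : Fin (2 * n) → Bool) : ℝ :=
  Real.sqrt q₀ / Real.sqrt 2 *
      ((if x = fun _ => false then 1 else 0) + if x = fun _ => true then 1 else 0) +
    Real.sqrt q₁ / Real.sqrt ((2 * n).choose n) * if weight x = n then 1 else 0

theorem targetState_apply (x : Fin (2 * n) → Bool) :
    targetState n q₀ q₁ x = (targetAmp n q₀ q₁ x : ℂ) := by
  have h : (∑ y ∈ Finset.univ.filter (fun y : Fin (2 * n) → Bool => weight y = n), ket y) x =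
      if weight x = n then 1 else 0 := by
    rw [Finset.sum_apply, Finset.sum_filter]
    simp only [ket, Pi.single_apply]
    rw [Finset.sum_congr rfl fun y _ => show (if weight y = n then if x = y then (1 : ℂ) else 0
      else 0) = if x = y then if weight x = n then 1 else 0 else 0 by split_ifs <;> simp_all]
    simp
  simp only [targetState, ghzState, dickeState, Pi.add_apply, Pi.smul_apply, h, smul_eq_mul,
    Fintype.card_fin, targetAmp]
  simp only [ket, Pi.single_apply]
  split_ifs <;> push_cast <;> ring

theorem sum_targetAmp_mul (a : (Fin (2 * n) → Bool) → ℝ) :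
    ∑ x, targetAmp n q₀ q₁ x * a x =
      Real.sqrt q₀ / Real.sqrt 2 * (a (fun _ => false) + a fun _ => true) +
        Real.sqrt q₁ / Real.sqrt ((2 * n).choose n) * sliceSum n a := by
  simp only [targetAmp, add_mul, mul_add, Finset.sum_add_distrib, sliceSum, Finset.sum_filter,
    mul_assoc, ite_mul, one_mul, zero_mul, mul_ite, mul_zero, Finset.sum_ite_eq', Finset.mem_univ,
    if_true, Finset.mul_sum]

theorem weight_true_const (n : ℕ) : weight (fun _ : Fin (2 * n) => true) = 2 * n := by
  simp [weight]

theorem weight_false_const (n : ℕ) : weight (fun _ : Fin (2 * n) => false) = 0 := by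
  simp [weight]

theorem targetAmp_false (hn : 0 < n) :
    targetAmp n q₀ q₁ (fun _ => false) = Real.sqrt q₀ / Real.sqrt 2 := by
  have : (fun _ : Fin (2 * n) => false) ≠ fun _ => true := fun h => by
    simpa using congrFun h ⟨0, by omega⟩
  simp [targetAmp, weight_false_const, this, hn.ne]

theorem targetAmp_true (hn : 0 < n) :
    targetAmp n q₀ q₁ (fun _ => true) = Real.sqrt q₀ / Real.sqrt 2 := by
  have : (fun _ : Fin (2 * n) => true) ≠ fun _ => false := fun h => by
    simpa using congrFun h ⟨0, by omega⟩
  simp [targetAmp, weight_true_const, this, show 2 * n ≠ n by omega]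

theorem targetAmp_of_weight_eq (hn : 0 < n) {x : Fin (2 * n) → Bool} (hx : weight x = n) :
    targetAmp n q₀ q₁ x = Real.sqrt q₁ / Real.sqrt ((2 * n).choose n) := by
  have h0 : x ≠ fun _ => false := by rintro rfl; rw [weight_false_const] at hx; omega
  have h1 : x ≠ fun _ => true := by rintro rfl; rw [weight_true_const] at hx; omega
  simp [targetAmp, h0, h1, hx]

theorem sliceSum_of_const {a : (Fin (2 * n) → Bool) → ℝ} {c : ℝ}
    (h : ∀ x, weight x = n → a x = c) : sliceSum n a = (2 * n).choose n * c := by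
  rw [sliceSum, Finset.sum_congr rfl fun x hx => h x (Finset.mem_filter.mp hx).2,
    Finset.sum_const, card_filter_weight, Fintype.card_fin, nsmul_eq_mul]

theorem sliceSq_of_const {a : (Fin (2 * n) → Bool) → ℝ} {c : ℝ}
    (h : ∀ x, weight x = n → a x = c) : sliceSq n a = (2 * n).choose n * c ^ 2 := by
  rw [← sliceSum_of_const (a := fun x => a x ^ 2) fun x hx => by rw [h x hx], sliceSq, sliceSum,
    Finset.sum_filter]

theorem sum_targetAmp_sq (hn : 0 < n) (h₀ : 0 < q₀) (h₁ : 0 < q₁) (hq : q₀ + q₁ = 1) :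
    ∑ x, targetAmp n q₀ q₁ x * targetAmp n q₀ q₁ x = 1 := by
  have hB := Real.sqrt_pos.mpr (choose_pos n)
  rw [sum_targetAmp_mul, targetAmp_false hn, targetAmp_true hn,
    sliceSum_of_const fun x hx => targetAmp_of_weight_eq hn hx]
  nth_rewrite 2 [← Real.mul_self_sqrt (choose_pos n).le]
  field_simp
  rw [Real.sq_sqrt h₀.le, Real.sq_sqrt h₁.le, Real.sq_sqrt two_pos.le]
  linarith

/-- The target state passes a round with certainty. -/
theorem realStrategy_form_target (hn : 3 ≤ n) (h₀ : 0 < q₀) (h₁ : 0 < q₁) (hq : q₀ + q₁ = 1) :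
    ∑ x, ∑ y, realStrategy n (lam₀ n q₀ q₁) (lam₁ n q₀ q₁) x y *
      (targetAmp n q₀ q₁ x * targetAmp n q₀ q₁ y) = 1 := by
  have hn' : 0 < n := by omega
  have hB := choose_pos n
  have hD := lam_denominator_pos n h₀ h₁
  have hc : ∀ x : Fin (2 * n) → Bool, weight x = n → targetAmp n q₀ q₁ x =
    Real.sqrt q₁ / Real.sqrt ((2 * n).choose n) := fun x hx => targetAmp_of_weight_eq hn' hx
  rw [realStrategy_form_eq hn (lam_add n h₀ h₁) _ _ hc, sliceSum_of_const hc, sliceSq_of_const hc,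
    sqrt_lam_mul h₀ h₁, targetAmp_false hn', targetAmp_true hn', lam₀]
  · have e0 := Real.sq_sqrt h₀.le
    have e1 := Real.sq_sqrt h₁.le
    have eB := Real.sq_sqrt hB.le
    have e2 := Real.sq_sqrt (two_pos (α := ℝ)).le
    have hs0 := Real.sqrt_pos.mpr h₀
    have hs1 := Real.sqrt_pos.mpr h₁
    have hsB := Real.sqrt_pos.mpr hB
    have hs2 := Real.sqrt_pos.mpr (two_pos (α := ℝ))
    rw [div_pow, div_pow, e0, e1, eB, e2]
    field_simp
    rw [e0, e1]
    have : q₁ = 1 - q₀ := by linarith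
    subst this
    ring
  · intro x hx0 hxn hx1
    have h0 : x ≠ fun _ => false := by rintro rfl; exact hx0 (weight_false_const n)
    have h1 : x ≠ fun _ => true := by rintro rfl; exact hx1 (weight_true_const n)
    simp [targetAmp, h0, h1, hxn]

end Target

/-! ### The operator inequality -/

section Gap

variable {n : ℕ} {q₀ q₁ : ℝ}

theorem sliceSum_sq_le (n : ℕ) (a : (Fin (2 * n) → Bool) → ℝ) :
    sliceSum n a ^ 2 ≤ (2 * n).choose n * sliceSq n a := by
  have h := sq_sum_le_card_mul_sum_sq (s := Finset.univ.filter
    fun x : Fin (2 * n) → Bool => weight x = n) (f := a)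
  rwa [card_filter_weight, Fintype.card_fin, Finset.sum_filter (fun x => weight x = n)
    fun x => a x ^ 2] at h

theorem ghz_add_sliceSq_le (hn : 0 < n) (a : (Fin (2 * n) → Bool) → ℝ) :
    a (fun _ => false) ^ 2 + a (fun _ => true) ^ 2 + sliceSq n a ≤ ∑ x, a x ^ 2 := by
  have h := sum_ghz_add_slice a 1 1 1
  rw [one_mul, one_mul, one_mul] at h
  rw [← h]
  refine Finset.sum_le_sum fun x _ => mul_le_of_le_one_left (sq_nonneg _) ?_
  have hft : (fun _ : Fin (2 * n) => false) ≠ fun _ => true := fun h => by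
    simpa using congrFun h ⟨0, by omega⟩
  by_cases h0 : x = fun _ => false
  · subst h0; simp [hft, weight_false_const, hn.ne]
  by_cases h1 : x = fun _ => true
  · subst h1; simp [hft.symm, weight_true_const, show 2 * n ≠ n by omega]
  simp only [h0, h1, if_false, zero_add]
  split_ifs <;> norm_num

/-- The bound for the second largest eigenvalue of the strategy: `λ₀` comes from the GHZ part, the
other term from the strings of weight `n`. -/
noncomputable def secondBound (n : ℕ) (q₀ q₁ : ℝ) : ℝ :=
  max (lam₀ n q₀ q₁) (1 - 1 / (2 * n - 1) - 2 * lam₀ n q₀ q₁ / (2 * n).choose n)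

/-- On the span of the GHZ state and the Dicke state, in the coordinates `s` and `t`, the form is
diagonal in the basis of the target state and its orthogonal complement. -/
theorem two_dim_block (n : ℕ) (h₀ : 0 < q₀) (h₁ : 0 < q₁) (hq : q₀ + q₁ = 1) (s t : ℝ) :
    lam₀ n q₀ q₁ * s ^ 2 + 4 * (Real.sqrt q₀ * Real.sqrt q₁) /
        (((2 * n).choose n : ℝ) * q₀ + 2 * q₁) * (s * t) +
        (1 - 2 * lam₀ n q₀ q₁ / (2 * n).choose n) * t ^ 2 =
      (Real.sqrt q₀ * s + Real.sqrt q₁ * t) ^ 2 +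
        lam₀ n q₀ q₁ * (1 - 2 / (2 * n).choose n) * (Real.sqrt q₁ * s - Real.sqrt q₀ * t) ^ 2 := by
  have hB := choose_pos n
  have hD := lam_denominator_pos n h₀ h₁
  have e0 := Real.sq_sqrt h₀.le
  have e1 := Real.sq_sqrt h₁.le
  rw [lam₀]
  set B : ℝ := ((2 * n).choose n : ℝ)
  set p := Real.sqrt q₀
  set r := Real.sqrt q₁
  rw [← e0, ← e1] at hD hq ⊢
  have hr : r ^ 2 = 1 - p ^ 2 := by linarith
  field_simp
  have h2 : r ^ 3 = r * (1 - p ^ 2) := by rw [← hr]; ring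
  have h4 : r ^ 4 = (1 - p ^ 2) ^ 2 := by rw [← hr]; ring
  ring_nf
  simp only [h4, h2, hr]
  ring

theorem cross_coefficient {B : ℝ} (hB : 0 < B) (p r D A S : ℝ) :
    2 * (Real.sqrt B * Real.sqrt 2 * p * r / D) / B * (A * S) =
      4 * (p * r) / D * (A / Real.sqrt 2 * (S / Real.sqrt B)) := by
  have e2 := Real.sq_sqrt (two_pos (α := ℝ)).le
  have eB := Real.sq_sqrt hB.le
  have hs2 := Real.sqrt_pos.mpr (two_pos (α := ℝ))
  have hsB := Real.sqrt_pos.mpr hB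
  have h2 : A = A / Real.sqrt 2 * Real.sqrt 2 := by field_simp
  have h3 : S = S / Real.sqrt B * Real.sqrt B := by field_simp
  calc 2 * (Real.sqrt B * Real.sqrt 2 * p * r / D) / B * (A * S)
      = 2 * (Real.sqrt B * Real.sqrt 2 * p * r / D) / B *
        (A / Real.sqrt 2 * Real.sqrt 2 * (S / Real.sqrt B * Real.sqrt B)) := by rw [← h2, ← h3]
    _ = 2 * (p * r) / D * (A / Real.sqrt 2 * (S / Real.sqrt B)) *
        (Real.sqrt 2 ^ 2 * Real.sqrt B ^ 2) / B := by ring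
    _ = _ := by rw [e2, eB]; field_simp; ring

/-- The block decomposition behind the bound: `s`, `t` are the overlaps with the GHZ and the Dicke
state, `A` and `W` the squared norms on the GHZ strings and on the slice, and `N` the squared norm
of the whole vector. -/
theorem block_bound {b l l' c g p r s t A W N m k : ℝ} (hl : 1 / 2 ≤ l) (hb : l ≤ b)
    (hl' : l' ≤ b) (hc : c ≤ b) (hcg : c + g = k) (hpr : p ^ 2 + r ^ 2 = 1)
    (hblock : l * s ^ 2 + m * (s * t) + k * t ^ 2 =
      (p * s + r * t) ^ 2 + l' * (r * s - p * t) ^ 2)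
    (hA : s ^ 2 ≤ A) (hW : t ^ 2 ≤ W) (hN : A + W ≤ N) :
    l * A + m * (s * t) + c * W + g * t ^ 2 + 1 / 2 * (N - A - W) ≤
      b * N + (1 - b) * (p * s + r * t) ^ 2 := by
  have hnorm : (p * s + r * t) ^ 2 + (r * s - p * t) ^ 2 = s ^ 2 + t ^ 2 := by
    linear_combination (s ^ 2 + t ^ 2) * hpr
  have k1 := mul_le_mul_of_nonneg_right hl' (sq_nonneg (r * s - p * t))
  have k2 := mul_le_mul_of_nonneg_right hc (sub_nonneg.mpr hW)
  have k3 := mul_le_mul_of_nonneg_right (hl.trans hb) (sub_nonneg.mpr hN)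
  have k4 := mul_le_mul_of_nonneg_right hb (sub_nonneg.mpr hA)
  have k5 : b * ((p * s + r * t) ^ 2 + (r * s - p * t) ^ 2) = b * (s ^ 2 + t ^ 2) := by rw [hnorm]
  rw [← hcg] at hblock
  linarith

/-- On real vectors the strategy is at most `β + (1 - β) |ψ⟩⟨ψ|`, where `ψ` is the target state and
`β` is `secondBound`. -/
theorem realStrategy_form_le_secondBound (hn : 3 ≤ n) (h₀ : 0 < q₀) (h₁ : 0 < q₁)
    (hq : q₀ + q₁ = 1) (h : 2 / (((2 * n).choose n : ℝ) + 2) ≤ q₀)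
    (a : (Fin (2 * n) → Bool) → ℝ) :
    ∑ x, ∑ y, realStrategy n (lam₀ n q₀ q₁) (lam₁ n q₀ q₁) x y * (a x * a y) ≤
      secondBound n q₀ q₁ * ∑ x, a x ^ 2 +
        (1 - secondBound n q₀ q₁) * (∑ x, targetAmp n q₀ q₁ x * a x) ^ 2 := by
  have hB := choose_pos n
  have hl := half_le_lam₀ h₀ h₁ hq h
  have hS : (sliceSum n a / Real.sqrt ((2 * n).choose n)) ^ 2 =
      sliceSum n a ^ 2 / (2 * n).choose n := by rw [div_pow, Real.sq_sqrt hB.le]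
  have hlB : lam₀ n q₀ q₁ * (1 - 2 / (2 * n).choose n) ≤ secondBound n q₀ q₁ := by
    have : 0 ≤ lam₀ n q₀ q₁ * (2 / (2 * n).choose n) :=
      mul_nonneg (by linarith) (by positivity)
    have : lam₀ n q₀ q₁ ≤ secondBound n q₀ q₁ := le_max_left _ _
    linarith
  have hW : (sliceSum n a / Real.sqrt ((2 * n).choose n)) ^ 2 ≤ sliceSq n a := by
    rw [hS, div_le_iff₀ hB, mul_comm]
    exact sliceSum_sq_le n a
  have hA : ((a (fun _ => false) + a fun _ => true) / Real.sqrt 2) ^ 2 ≤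
      a (fun _ => false) ^ 2 + a (fun _ => true) ^ 2 := by
    rw [div_pow, Real.sq_sqrt two_pos.le]
    nlinarith [sq_nonneg (a (fun _ => false) - a fun _ => true)]
  have hmain := block_bound hl (le_max_left _ _) hlB (le_max_right _ _)
    (g := 1 / (2 * (n : ℝ) - 1)) (by ring)
    (show Real.sqrt q₀ ^ 2 + Real.sqrt q₁ ^ 2 = 1 by
      rw [Real.sq_sqrt h₀.le, Real.sq_sqrt h₁.le, hq])
    (two_dim_block n h₀ h₁ hq _ _) hA hW (ghz_add_sliceSq_le (by omega) a)
  rw [← cross_coefficient hB, ← sqrt_lam_mul h₀ h₁, hS] at hmain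
  refine (realStrategy_form_le hn hl (lam₁_pos n h₀ h₁).le (lam_add n h₀ h₁) a).trans ?_
  rw [sum_targetAmp_mul, show ∀ u v w z : ℝ, u / v * w + z / Real.sqrt ((2 * n).choose n) *
    sliceSum n a = u * (w / v) + z * (sliceSum n a / Real.sqrt ((2 * n).choose n)) from
      fun u v w z => by ring]
  rw [← sub_sub] at hmain
  exact hmain

/-! ### From the real form to the operator -/

theorem strategy_apply_real (hn : 0 < n) (h₀ : 0 < q₀) (h₁ : 0 < q₁) (x y : Fin (2 * n) → Bool) :
    strategy n 0 q₀ q₁ x y = (realStrategy n (lam₀ n q₀ q₁) (lam₁ n q₀ q₁) x y : ℂ) :=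
  strategy_apply hn (lam₀_pos n h₀ h₁).le (lam₁_pos n h₀ h₁).le x y

/-- Since the entries of the strategy are real, the real and the imaginary part of a vector
contribute separately to the form. -/
theorem form_re (hn : 0 < n) (h₀ : 0 < q₀) (h₁ : 0 < q₁) (v : Ket (Fin (2 * n))) :
    (star v ⬝ᵥ (strategy n 0 q₀ q₁ *ᵥ v)).re =
      ∑ x, ∑ y, realStrategy n (lam₀ n q₀ q₁) (lam₁ n q₀ q₁) x y * ((v x).re * (v y).re) +
      ∑ x, ∑ y, realStrategy n (lam₀ n q₀ q₁) (lam₁ n q₀ q₁) x y * ((v x).im * (v y).im) := by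
  simp only [← Finset.sum_add_distrib, dotProduct, Matrix.mulVec, Complex.re_sum, Finset.mul_sum,
    strategy_apply_real hn h₀ h₁]
  refine Finset.sum_congr rfl fun x _ => Finset.sum_congr rfl fun y _ => ?_
  simp
  ring

theorem target_dot (v : Ket (Fin (2 * n))) :
    star (targetState n q₀ q₁) ⬝ᵥ v = ((∑ x, targetAmp n q₀ q₁ x * (v x).re : ℝ) : ℂ) +
      ((∑ x, targetAmp n q₀ q₁ x * (v x).im : ℝ) : ℂ) * Complex.I := by
  simp only [dotProduct, Pi.star_apply, targetState_apply]
  push_cast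
  rw [Finset.sum_mul, ← Finset.sum_add_distrib]
  refine Finset.sum_congr rfl fun x _ => ?_
  nth_rewrite 1 [← Complex.re_add_im (v x)]
  rw [Complex.star_def, Complex.conj_ofReal]
  ring

theorem target_dot_self (hn : 3 ≤ n) (h₀ : 0 < q₀) (h₁ : 0 < q₁) (hq : q₀ + q₁ = 1) :
    star (targetState n q₀ q₁) ⬝ᵥ targetState n q₀ q₁ = 1 := by
  have hn' : 0 < n := by omega
  simp [target_dot, targetState_apply, sum_targetAmp_sq hn' h₀ h₁ hq]

theorem target_form (hn : 3 ≤ n) (h₀ : 0 < q₀) (h₁ : 0 < q₁) (hq : q₀ + q₁ = 1) :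
    star (targetState n q₀ q₁) ⬝ᵥ (strategy n 0 q₀ q₁ *ᵥ targetState n q₀ q₁) = 1 := by
  have h := realStrategy_form_target hn h₀ h₁ hq
  apply_fun ((↑) : ℝ → ℂ) at h
  rw [Complex.ofReal_one] at h
  rw [← h]
  simp only [dotProduct, Matrix.mulVec, Finset.mul_sum,
    strategy_apply_real (show 0 < n by omega) h₀ h₁,
    Pi.star_apply, targetState_apply]
  push_cast
  refine Finset.sum_congr rfl fun x _ => Finset.sum_congr rfl fun y _ => ?_
  simp
  ring

/-- The operator inequality `Ω ≤ β + (1 - β) |ψ⟩⟨ψ|`. -/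
theorem posSemidef_secondBound (hn : 3 ≤ n) (h₀ : 0 < q₀) (h₁ : 0 < q₁)
    (hq : q₀ + q₁ = 1) (h : 2 / (((2 * n).choose n : ℝ) + 2) ≤ q₀) :
    (((secondBound n q₀ q₁ : ℝ) : ℂ) • (1 : Op (Fin (2 * n))) +
      ((1 - secondBound n q₀ q₁ : ℝ) : ℂ) • proj (targetState n q₀ q₁) -
      strategy n 0 q₀ q₁).PosSemidef := by
  have hH : (((secondBound n q₀ q₁ : ℝ) : ℂ) • (1 : Op (Fin (2 * n))) +
      ((1 - secondBound n q₀ q₁ : ℝ) : ℂ) • proj (targetState n q₀ q₁) -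
      strategy n 0 q₀ q₁).IsHermitian := by
    refine ((Matrix.isHermitian_one.smul ?_).add ((posSemidef_proj _).isHermitian.smul ?_)).sub
      (posSemidef_strategy n q₀ q₁).isHermitian <;> exact Complex.conj_ofReal _
  refine Matrix.PosSemidef.of_dotProduct_mulVec_nonneg hH fun v => ?_
  refine Complex.le_def.mpr ⟨?_, (hH.im_star_dotProduct_mulVec_self v).symm⟩
  have hr := realStrategy_form_le_secondBound hn h₀ h₁ hq h fun x => (v x).re
  have hi := realStrategy_form_le_secondBound hn h₀ h₁ hq h fun x => (v x).im
  have hpu : star v ⬝ᵥ (proj (targetState n q₀ q₁) *ᵥ v) =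
      (((∑ x, targetAmp n q₀ q₁ x * (v x).re) ^ 2 +
        (∑ x, targetAmp n q₀ q₁ x * (v x).im) ^ 2 : ℝ) : ℂ) := by
    have e : star v ⬝ᵥ targetState n q₀ q₁ = star (star (targetState n q₀ q₁) ⬝ᵥ v) := by
      rw [Matrix.star_dotProduct]
    rw [proj, Matrix.vecMulVec_mulVec, dotProduct_smul, e, target_dot]
    generalize ∑ x, targetAmp n q₀ q₁ x * (v x).re = c
    generalize ∑ x, targetAmp n q₀ q₁ x * (v x).im = d
    rw [op_smul_eq_mul, Complex.star_def, ← Complex.normSq_eq_conj_mul_self,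
      Complex.normSq_add_mul_I]
  have hv : (star v ⬝ᵥ v).re = ∑ x, (v x).re ^ 2 + ∑ x, (v x).im ^ 2 := by
    simp only [dotProduct, Complex.re_sum, ← Finset.sum_add_distrib]
    refine Finset.sum_congr rfl fun x _ => ?_
    simp
    ring
  rw [Matrix.sub_mulVec, Matrix.add_mulVec, Matrix.smul_mulVec, Matrix.smul_mulVec,
    Matrix.one_mulVec, dotProduct_sub, dotProduct_add, dotProduct_smul, dotProduct_smul, hpu,
    Complex.sub_re, form_re (by omega) h₀ h₁, Complex.add_re, smul_eq_mul, smul_eq_mul,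
    Complex.re_ofReal_mul, Complex.re_ofReal_mul, hv, Complex.ofReal_re, Complex.zero_re]
  linarith

end Gap

/-! ### Gap, completeness and failure probability -/

section Protocol

variable {n : ℕ} {q₀ q₁ : ℝ}

theorem one_sub_secondBound (n : ℕ) (h₀ : 0 < q₀) (h₁ : 0 < q₁) :
    1 - secondBound n q₀ q₁ =
      min (lam₁ n q₀ q₁) (1 / (2 * n - 1) + 2 * lam₀ n q₀ q₁ / (2 * n).choose n) := by
  rw [secondBound, ← min_sub_sub_left, ← lam_add n h₀ h₁]
  congr 1 <;> ring

theorem secondBound_le_spectralGap (hn : 3 ≤ n) (h₀ : 0 < q₀) (h₁ : 0 < q₁) (hq : q₀ + q₁ = 1)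
    (h : 2 / (((2 * n).choose n : ℝ) + 2) ≤ q₀) :
    1 - secondBound n q₀ q₁ ≤ spectralGap (strategy n 0 q₀ q₁) := by
  classical
  have hcard : 2 ≤ Fintype.card (Fin (2 * n) → Bool) := by
    rw [Fintype.card_fun, Fintype.card_bool, Fintype.card_fin]
    exact Nat.le_self_pow (by omega) 2
  convert le_spectralGap hcard (posSemidef_strategy n q₀ q₁).isHermitian
    (target_dot_self hn h₀ h₁ hq) (target_form hn h₀ h₁ hq) ?_
  convert posSemidef_secondBound hn h₀ h₁ hq h

theorem inv_lam₁_lt (hn : 0 < n) (h₀ : 0 < q₀) (h₁ : 0 < q₁) :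
    1 / lam₁ n q₀ q₁ < (4 ^ n / Real.sqrt (Real.pi * n) * q₀ + 2 * q₁) / (2 * q₁) := by
  rw [lam₁, one_div_div]
  have := mul_lt_mul_of_pos_right (choose_lt_four_pow_div_sqrt n hn) h₀
  gcongr

theorem secondBound_gap_pos (hn : 0 < n) (h₀ : 0 < q₀) (h₁ : 0 < q₁) :
    0 < 1 - secondBound n q₀ q₁ := by
  have h2 : (0 : ℝ) < 2 * n - 1 := by
    have : (1 : ℝ) ≤ n := by exact_mod_cast hn
    linarith
  have := lam₀_pos n h₀ h₁
  have := choose_pos n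
  rw [one_sub_secondBound n h₀ h₁]
  exact lt_min (lam₁_pos n h₀ h₁) (by positivity)

theorem inv_secondBound_lt_of_lt (hn : 0 < n) (h₀ : 0 < q₀) (h₁ : 0 < q₁)
    (h : lam₀ n q₀ q₁ * (1 + 2 / ((2 * n).choose n : ℝ)) + 1 / (2 * (n : ℝ) - 1) ≤ 1) :
    1 / (1 - secondBound n q₀ q₁) < 2 * (n : ℝ) - 1 := by
  have h2 : (0 : ℝ) < 2 * n - 1 := by
    have : (1 : ℝ) ≤ n := by exact_mod_cast hn
    linarith
  have h3 : 0 < 2 * lam₀ n q₀ q₁ / (2 * n).choose n :=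
    div_pos (mul_pos two_pos (lam₀_pos n h₀ h₁)) (choose_pos n)
  have hm : 1 / (2 * (n : ℝ) - 1) < 1 - secondBound n q₀ q₁ := by
    have e : lam₀ n q₀ q₁ * (1 + 2 / ((2 * n).choose n : ℝ)) =
      lam₀ n q₀ q₁ + 2 * lam₀ n q₀ q₁ / (2 * n).choose n := by ring
    have := lam_add n h₀ h₁
    rw [one_sub_secondBound n h₀ h₁, min_eq_right (by linarith)]
    linarith
  rw [one_div_lt (secondBound_gap_pos hn h₀ h₁) h2]
  exact hm

theorem inv_secondBound_lt_of_ge (hn : 0 < n) (h₀ : 0 < q₀) (h₁ : 0 < q₁)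
    (h : 1 ≤ lam₀ n q₀ q₁ * (1 + 2 / ((2 * n).choose n : ℝ)) + 1 / (2 * (n : ℝ) - 1)) :
    1 / (1 - secondBound n q₀ q₁) <
      (4 ^ n / Real.sqrt (Real.pi * n) * q₀ + 2 * q₁) / (2 * q₁) := by
  have e : lam₀ n q₀ q₁ * (1 + 2 / ((2 * n).choose n : ℝ)) =
    lam₀ n q₀ q₁ + 2 * lam₀ n q₀ q₁ / (2 * n).choose n := by ring
  have := lam_add n h₀ h₁
  rw [one_sub_secondBound n h₀ h₁, min_eq_left (by linarith)]
  exact inv_lam₁_lt hn h₀ h₁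

theorem trace_strategy_target (hn : 3 ≤ n) (h₀ : 0 < q₀) (h₁ : 0 < q₁) (hq : q₀ + q₁ = 1) :
    (strategy n 0 q₀ q₁ * proj (targetState n q₀ q₁)).trace = 1 := by
  rw [Matrix.trace_mul_comm, trace_proj_mul, target_form hn h₀ h₁ hq]

/-- A round accepts a state of fidelity at most `1 - ε` with probability at most
`1 - (1 - β) ε`. -/
theorem trace_strategy_le (hn : 3 ≤ n) (h₀ : 0 < q₀) (h₁ : 0 < q₁) (hq : q₀ + q₁ = 1)
    (h : 2 / (((2 * n).choose n : ℝ) + 2) ≤ q₀) {ρ : Op (Fin (2 * n))} (hρ : IsDensity ρ) {ε : ℝ}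
    (hε : fidelity (targetState n q₀ q₁) ρ ≤ 1 - ε) :
    (strategy n 0 q₀ q₁ * ρ).trace.re ≤ 1 - (1 - secondBound n q₀ q₁) * ε := by
  have h1 := trace_mul_nonneg (posSemidef_secondBound hn h₀ h₁ hq h) hρ.1
  rw [Matrix.sub_mul, Matrix.add_mul, Matrix.trace_sub, Matrix.trace_add, Matrix.smul_mul,
    Matrix.smul_mul, Matrix.trace_smul, Matrix.trace_smul, Matrix.one_mul, hρ.2, trace_proj_mul,
    smul_eq_mul, smul_eq_mul, Complex.sub_re, Complex.add_re, Complex.re_ofReal_mul,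
    Complex.re_ofReal_mul, Complex.one_re] at h1
  have h2 := mul_le_mul_of_nonneg_left hε (secondBound_gap_pos (by omega : 0 < n) h₀ h₁).le
  rw [fidelity] at h2
  linarith

theorem inv_secondBound_mul_le_sampleCount (hn : 0 < n) (h₀ : 0 < q₀) (h₁ : 0 < q₁) {ε δ : ℝ}
    (hε : 0 < ε) (hδ : 0 < δ) (hδ' : δ < 1) :
    1 / (1 - secondBound n q₀ q₁) * (Real.log δ⁻¹ / ε) ≤ sampleCount n q₀ q₁ ε δ := by
  have hL : 0 ≤ Real.log δ⁻¹ / ε := by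
    rw [Real.log_inv]
    exact div_nonneg (neg_nonneg.mpr (Real.log_nonpos hδ.le hδ'.le)) hε.le
  rw [sampleCount, Nat.cast_max]
  rcases le_total (lam₀ n q₀ q₁ * (1 + 2 / ((2 * n).choose n : ℝ)) + 1 / (2 * (n : ℝ) - 1)) 1
    with h | h
  · refine le_max_of_le_left (le_trans ?_ (Nat.le_ceil _))
    rw [mul_div_assoc]
    exact mul_le_mul_of_nonneg_right (inv_secondBound_lt_of_lt hn h₀ h₁ h).le hL
  · refine le_max_of_le_right (le_trans ?_ (Nat.le_ceil _))
    refine mul_le_mul_of_nonneg_right ((inv_secondBound_lt_of_ge hn h₀ h₁ h).le.trans_eq ?_) hL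
    have : Real.sqrt (Real.pi * n) ≠ 0 := by
      have : (0 : ℝ) < n := by exact_mod_cast hn
      positivity
    field_simp

theorem acceptProb_le (hn : 3 ≤ n) (h₀ : 0 < q₀) (h₁ : 0 < q₁) (hq : q₀ + q₁ = 1)
    (h : 2 / (((2 * n).choose n : ℝ) + 2) ≤ q₀) {ε δ : ℝ} (hε : 0 < ε) (hδ : 0 < δ) (hδ' : δ < 1)
    (ρ : Fin (sampleCount n q₀ q₁ ε δ) → Op (Fin (2 * n))) (hρ : ∀ j, IsDensity (ρ j))
    (hf : ∀ j, fidelity (targetState n q₀ q₁) (ρ j) ≤ 1 - ε) :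
    acceptProb (strategy n 0 q₀ q₁) ρ ≤ δ := by
  have hg := secondBound_gap_pos (n := n) (by omega) h₀ h₁
  have hM := inv_secondBound_mul_le_sampleCount (n := n) (by omega) h₀ h₁ hε hδ hδ'
  set g := 1 - secondBound n q₀ q₁ with hgdef
  calc acceptProb (strategy n 0 q₀ q₁) ρ
      ≤ ∏ _j : Fin (sampleCount n q₀ q₁ ε δ), Real.exp (-(g * ε)) := by
        refine Finset.prod_le_prod (fun j _ => trace_mul_nonneg (posSemidef_strategy n q₀ q₁)
          (hρ j).1) fun j _ => (trace_strategy_le hn h₀ h₁ hq h (hρ j) (hf j)).trans ?_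
        exact Real.one_sub_le_exp_neg _
    _ = Real.exp (-(g * ε * sampleCount n q₀ q₁ ε δ)) := by
        rw [Finset.prod_const, Finset.card_univ, Fintype.card_fin, ← Real.exp_nat_mul]
        ring_nf
    _ ≤ Real.exp (Real.log δ) := by
        rw [Real.exp_le_exp, ← neg_neg (Real.log δ), neg_le_neg_iff, ← Real.log_inv]
        calc Real.log δ⁻¹ = g * ε * (1 / g * (Real.log δ⁻¹ / ε)) := by field_simp
          _ ≤ _ := mul_le_mul_of_nonneg_left hM (by positivity)
    _ = δ := Real.exp_log hδ

end Protocol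

end QSV

theorem mainTheorem2 :
    (∀ (n : ℕ) (q₀ q₁ : ℝ), 3 ≤ n → 0 < q₀ → 0 < q₁ → q₀ + q₁ = 1 →
      2 / (((2 * n).choose n : ℝ) + 2) ≤ q₀ →
      -- the spectral gap for `p = 0`
      0 < QSV.spectralGap (QSV.strategy n 0 q₀ q₁) ∧
      (QSV.lam₀ n q₀ q₁ * (1 + 2 / ((2 * n).choose n : ℝ)) + 1 / (2 * (n : ℝ) - 1) < 1 →
        1 / QSV.spectralGap (QSV.strategy n 0 q₀ q₁) < 2 * (n : ℝ) - 1) ∧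
      (1 ≤ QSV.lam₀ n q₀ q₁ * (1 + 2 / ((2 * n).choose n : ℝ)) + 1 / (2 * (n : ℝ) - 1) →
        1 / QSV.spectralGap (QSV.strategy n 0 q₀ q₁) <
          (4 ^ n / Real.sqrt (Real.pi * n) * q₀ + 2 * q₁) / (2 * q₁)) ∧
      -- perfect completeness, for every number of rounds
      (∀ M : ℕ, QSV.acceptProb (QSV.strategy n 0 q₀ q₁)
        (fun _ : Fin M => QSV.proj (QSV.targetState n q₀ q₁)) = 1) ∧
      -- failure probability at most `δ`
      (∀ ε δ : ℝ, 0 < ε → ε ≤ 1 → 0 < δ → δ < 1 →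
        ∀ ρ : Fin (QSV.sampleCount n q₀ q₁ ε δ) → QSV.Op (Fin (2 * n)),
          (∀ j, QSV.IsDensity (ρ j)) →
          (∀ j, QSV.fidelity (QSV.targetState n q₀ q₁) (ρ j) ≤ 1 - ε) →
          QSV.acceptProb (QSV.strategy n 0 q₀ q₁) ρ ≤ δ)) ∧
    -- order of growth of the number of samples, for constant `q₀`
    (∀ q₀ q₁ : ℝ, 0 < q₀ → 0 < q₁ → q₀ + q₁ = 1 →
      (∃ C : ℝ, 0 < C ∧ ∀ (n : ℕ) (ε δ : ℝ), 3 ≤ n → 0 < ε → ε ≤ 1 → 0 < δ → δ < 1 →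
        (QSV.sampleCount n q₀ q₁ ε δ : ℝ) ≤
          C * (4 ^ n * Real.log δ⁻¹ / (Real.sqrt n * ε)) + 1) ∧
      (∀ δ₀ : ℝ, δ₀ < 1 →
        ∃ C : ℝ, 0 < C ∧ ∀ (n : ℕ) (ε δ : ℝ), 3 ≤ n → 0 < ε → ε ≤ 1 → 0 < δ → δ ≤ δ₀ →
          (QSV.sampleCount n q₀ q₁ ε δ : ℝ) ≤
            C * (4 ^ n * Real.log δ⁻¹ / (Real.sqrt n * ε)))) := by
  refine ⟨fun n q₀ q₁ hn h₀ h₁ hq h => ?_, fun q₀ q₁ h₀ h₁ _ => QSV.sampleCount_growth q₀ q₁ h₀ h₁⟩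
  have hn' : 0 < n := by omega
  have hpos := QSV.secondBound_gap_pos hn' h₀ h₁
  have hgap := QSV.secondBound_le_spectralGap hn h₀ h₁ hq h
  have hinv := one_div_le_one_div_of_le hpos hgap
  refine ⟨hpos.trans_le hgap, fun hlt => ?_, fun hge => ?_, fun M => ?_, ?_⟩
  · exact hinv.trans_lt (QSV.inv_secondBound_lt_of_lt hn' h₀ h₁ hlt.le)
  · exact hinv.trans_lt (QSV.inv_secondBound_lt_of_ge hn' h₀ h₁ hge)
  · simp [QSV.acceptProb, QSV.trace_strategy_target hn h₀ h₁ hq]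
  · exact fun ε δ hε _ hδ hδ' ρ hρ hf => QSV.acceptProb_le hn h₀ h₁ hq h hε hδ hδ' ρ hρ hf
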